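/- Let $k, m$ be positive integers with $k+3\le m\le k+\frac{k-1}{3}+3$ (ordinary division of real numbers), and let $G$ be a finite simple connected graph that is claw-free, i.e. has no induced subgraph isomorphic to $K_{1,3}$. Write $|G|$ for the number of vertices of $G$. For $j\ge 1$ let $\sigma_j(G)$ be the minimum of $\sum_{i=1}^{j}\deg_G(v_i)$ over all independent sets $\{v_1,\dots,v_j\}$ of $j$ distinct vertices of $G$, and let $\sigma_j(G)=+\infty$ if $G$ has no independent set of size $j$. If $$\sigma_{m+1}(G)\ \ge\ |G|-2k+m-4,$$ then $G$ has a spanning tree $T$ such that $|L(T)|+|B(T)|\le 2k+3$, where $L(T)$ is the set of leaves of $T$ (vertices of degree one in $T$) and $B(T)$ is the set of branch vertices of $T$ (vertices of degree at least three in $T$). -/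

import Mathlib

open scoped SimpleGraph

namespace ClawFreeTrees

/-- `G` has no induced subgraph isomorphic to the claw `K_{1,3}`. -/
def IsClawFree {V : Type*} (G : SimpleGraph V) : Prop :=
  ¬ (completeBipartiteGraph (Fin 1) (Fin 3) ⊴ G)

open Classical in
/-- `σ_j(G)`: the least degree sum of an independent set of exactly `j` vertices. It is the infimum
of an empty family, that is `⊤ = +∞`, exactly when `G` has no independent set of size `j`. -/
noncomputable def sigma {V : Type*} [Fintype V] (G : SimpleGraph V) (j : ℕ) : ℕ∞ :=
  ⨅ (s : Finset V) (_ : G.IsNIndepSet j s), ((∑ v ∈ s, G.degree v : ℕ) : ℕ∞)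

/-- A spanning tree of `G`, as a graph on the full vertex set of `G`. -/
def IsSpanningTree {V : Type*} (G T : SimpleGraph V) : Prop :=
  T ≤ G ∧ T.IsTree

open Classical in
/-- The vertices of degree one. -/
noncomputable def leaves {V : Type*} [Fintype V] (T : SimpleGraph V) : Finset V :=
  Finset.univ.filter fun v => T.degree v = 1

open Classical in
/-- The vertices of degree strictly greater than two. -/
noncomputable def branchVertices {V : Type*} [Fintype V] (T : SimpleGraph V) : Finset V :=
  Finset.univ.filter fun v => 2 < T.degree v

end ClawFreeTrees

open scoped SimpleGraph

namespace ClawFreeTrees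
open Classical
set_option linter.unusedSectionVars false

/-! ### Degrees, and deleting or inserting a single edge -/

section Basic

variable {V : Type*} [Fintype V]

/-! Call a tree edge oblique to `x` if it is the first edge on the tree path to `x` from some
`G`-neighbour `y` of `x`. Distinct neighbours give distinct edges, so `x` has exactly `deg x`
oblique edges. If no tree edge is oblique to two members of a set `S`, the degree sum of `S` is at
most `|G| - 1` minus the number of tree edges oblique to no member of `S` (`sum_dg_add_card_lt`).
Claw-freeness helps three times: it separates the oblique edges of different vertices, it supplies
unused edges at branch vertices, and it supplies adjacent tree neighbours of a branch vertex,
through which the vertex can lose two tree edges at the price of one new edge elsewhere.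

The tree is chosen extremal (`Opt`): fewest branch vertices; then, with a branch vertex `r` fixed as
root, least sum of squared branch degrees, least excess over three weighted heavily towards the
root, and fewest bad cubic vertices; among these, the largest distance sum `dd`. Each structural
fact is proved by an exchange of tree edges that would improve one of these quantities.
`Opt.not_surg_branch`, `Opt.not_surg` and `Opt.not_surg_below` package the three ways of winning.
`Opt.not_bad` removes bad vertices, and the distance sum serves only to exclude an edge oblique at
the same end to a leaf and to a cubic vertex (`Opt.oblique_leaf_same`).

For `S` take all leaves together with cubic vertices other than `r`. Leaves cause no conflict, and
neither does a leaf with a cubic vertex. Two cubic vertices cause none if a blocking vertex lies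
between them (`Opt.oblique_cubic_same`, `Opt.oblique_cubic_opposite`). By `Opt.linked_unique` at
least half of the cubic vertices are pairwise blocked. Each branch vertex outside `S` supplies an
unused edge to a child, and the root a second one (`Opt.exists_unused_set`).

Suppose leaves and branch vertices number at least `2k+4`. There are at most `m` leaves, since
otherwise `m+1` leaves alone violate the degree condition. The upper bound on `m` is exactly what
guarantees enough cubic vertices to fill `S` up to `m+1` elements, and then the degree sum of `S` is
less than `|G| - 2k + m - 4`. -/

/-- The degree of a vertex, with classical decidability. -/
noncomputable def dg (T : SimpleGraph V) (v : V) : ℕ := (Finset.univ.filter (T.Adj v)).card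

lemma degree_eq_dg (T : SimpleGraph V) (v : V) [Fintype (T.neighborSet v)] :
    T.degree v = dg T v := by
  unfold dg SimpleGraph.degree
  congr 1
  ext w
  simp

/-- The graph with the edge `ab` removed. -/
def del (T : SimpleGraph V) (a b : V) : SimpleGraph V := T.deleteEdges {s(a, b)}

/-- The graph with the edge `ab` added. -/
def ins (T : SimpleGraph V) (a b : V) : SimpleGraph V := T ⊔ SimpleGraph.edge a b

lemma del_adj {T : SimpleGraph V} {a b v w : V} :
    (del T a b).Adj v w ↔ T.Adj v w ∧ ¬ (v = a ∧ w = b) ∧ ¬ (v = b ∧ w = a) := by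
  simp [del, SimpleGraph.deleteEdges_adj, not_or]

lemma ins_adj {T : SimpleGraph V} {a b v w : V} (hab : a ≠ b) :
    (ins T a b).Adj v w ↔ T.Adj v w ∨ (v = a ∧ w = b) ∨ (v = b ∧ w = a) := by
  simp only [ins, SimpleGraph.sup_adj, SimpleGraph.edge_adj]
  constructor
  · rintro (h | ⟨h, -⟩)
    · exact Or.inl h
    · exact Or.inr h
  · rintro (h | ⟨rfl, rfl⟩ | ⟨rfl, rfl⟩)
    · exact Or.inl h
    · exact Or.inr ⟨Or.inl ⟨rfl, rfl⟩, hab⟩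
    · exact Or.inr ⟨Or.inr ⟨rfl, rfl⟩, hab.symm⟩

lemma dg_del {T : SimpleGraph V} {a b : V} (h : T.Adj a b) (v : V) :
    dg (del T a b) v + ((if v = a then 1 else 0) + (if v = b then 1 else 0)) = dg T v := by
  have hab := h.ne
  unfold dg
  by_cases hva : v = a
  · subst hva
    have : Finset.univ.filter (T.Adj v) =
        insert b (Finset.univ.filter ((del T v b).Adj v)) := by
      ext w
      simp only [Finset.mem_filter, Finset.mem_univ, true_and, Finset.mem_insert, del_adj]
      grind
    rw [this, Finset.card_insert_of_notMem (by simp [del_adj])]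
    simp [hab]
  · by_cases hvb : v = b
    · subst hvb
      have : Finset.univ.filter (T.Adj v) =
          insert a (Finset.univ.filter ((del T a v).Adj v)) := by
        ext w
        simp only [Finset.mem_filter, Finset.mem_univ, true_and, Finset.mem_insert, del_adj]
        have := h.symm
        grind
      rw [this, Finset.card_insert_of_notMem (by simp [del_adj])]
      simp [hva]
    · simp only [hva, hvb, if_false, add_zero]
      congr 1
      ext w
      simp [del_adj, hva, hvb]

lemma dg_ins {T : SimpleGraph V} {a b : V} (hab : a ≠ b) (h : ¬ T.Adj a b) (v : V) :
    dg (ins T a b) v = dg T v + ((if v = a then 1 else 0) + (if v = b then 1 else 0)) := by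
  have h1 : (ins T a b).Adj a b := by simp [ins_adj hab]
  rw [← dg_del h1 v]
  congr 1
  have : del (ins T a b) a b = T := by
    ext v w
    rw [del_adj, ins_adj hab]
    constructor
    · rintro ⟨h | h | h, h2, h3⟩
      · exact h
      · exact absurd h h2
      · exact absurd h h3
    · intro h4
      refine ⟨Or.inl h4, ?_, ?_⟩
      · rintro ⟨rfl, rfl⟩; exact h h4
      · rintro ⟨rfl, rfl⟩; exact h h4.symm
  rw [this]

/-- The degree sum. -/
noncomputable def degSum (T : SimpleGraph V) : ℕ := ∑ v, dg T v

lemma degSum_del {T : SimpleGraph V} {a b : V} (h : T.Adj a b) :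
    degSum (del T a b) + 2 = degSum T := by
  unfold degSum
  rw [← Finset.sum_congr rfl (fun v _ => dg_del h v), Finset.sum_add_distrib,
    Finset.sum_add_distrib]
  simp

lemma degSum_ins {T : SimpleGraph V} {a b : V} (hab : a ≠ b) (h : ¬ T.Adj a b) :
    degSum (ins T a b) = degSum T + 2 := by
  unfold degSum
  rw [Finset.sum_congr rfl (fun v _ => dg_ins hab h v), Finset.sum_add_distrib,
    Finset.sum_add_distrib]
  simp

lemma degSum_eq (T : SimpleGraph V) : degSum T = 2 * Nat.card T.edgeSet := by
  have := T.sum_degrees_eq_twice_card_edges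
  rw [Nat.card_eq_fintype_card, ← SimpleGraph.edgeFinset_card, ← this]
  exact Finset.sum_congr rfl fun v _ => (degree_eq_dg T v).symm

lemma degSum_tree {T : SimpleGraph V} (hT : T.IsTree) : degSum T + 2 = 2 * Fintype.card V := by
  have := (SimpleGraph.isTree_iff_connected_and_card.1 hT).2
  rw [degSum_eq]
  rw [Nat.card_eq_fintype_card (α := V)] at this
  omega

lemma isTree_of_degSum {T T' : SimpleGraph V} (hT : T.IsTree) (hc : T'.Connected)
    (h : degSum T' = degSum T) : T'.IsTree := by
  have h1 := degSum_tree hT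
  rw [SimpleGraph.isTree_iff_connected_and_card]
  refine ⟨hc, ?_⟩
  rw [← h, degSum_eq] at h1
  rw [Nat.card_eq_fintype_card (α := V)]
  omega

lemma connected_of_adj_reachable {T T' : SimpleGraph V} (hT : T.Connected)
    (h : ∀ a b, T.Adj a b → T'.Reachable a b) : T'.Connected := by
  have := hT.nonempty
  refine ⟨fun u v => ?_⟩
  obtain ⟨p⟩ := hT.preconnected u v
  induction p with
  | nil => exact SimpleGraph.Reachable.refl _
  | cons hadj _ ih => exact (h _ _ hadj).trans ih

end Basic

/-! ### Directions in a tree and the two sides of an edge -/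

section Tree

variable {V : Type*} [Fintype V] {T : SimpleGraph V}

/-- The neighbour of `v` on the way to `s`. -/
noncomputable def nx (T : SimpleGraph V) (v s : V) : V :=
  if h : ∃ q, T.Adj v q ∧ T.dist q s + 1 = T.dist v s then h.choose else v

lemma exists_nx (hT : T.IsTree) {v s : V} (h : v ≠ s) :
    ∃ q, T.Adj v q ∧ T.dist q s + 1 = T.dist v s := by
  obtain ⟨p, -, hp⟩ := hT.1.exists_path_of_dist v s
  cases p with
  | nil => exact absurd rfl h
  | @cons _ q _ hadj p' =>
    refine ⟨q, hadj, ?_⟩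
    have h1 := SimpleGraph.dist_le p'
    have h2 := hT.dist_eq_dist_add_one_of_adj s hadj
    rw [SimpleGraph.Walk.length_cons] at hp
    rw [SimpleGraph.dist_comm (u := s) (v := v), SimpleGraph.dist_comm (u := s) (v := q)] at h2
    omega

lemma nx_adj (hT : T.IsTree) {v s : V} (h : v ≠ s) : T.Adj v (nx T v s) := by
  have h1 := exists_nx hT h
  rw [nx, dif_pos h1]
  exact h1.choose_spec.1

lemma nx_dist (hT : T.IsTree) {v s : V} (h : v ≠ s) :
    T.dist (nx T v s) s + 1 = T.dist v s := by
  have h1 := exists_nx hT h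
  rw [nx, dif_pos h1]
  exact h1.choose_spec.2

lemma dist_adj (hT : T.IsTree) {v q : V} (s : V) (h : T.Adj v q) :
    T.dist v s = T.dist q s + 1 ∨ T.dist q s = T.dist v s + 1 := by
  have h2 := hT.dist_eq_dist_add_one_of_adj s h
  rw [SimpleGraph.dist_comm (u := s) (v := v), SimpleGraph.dist_comm (u := s) (v := q)] at h2
  omega

/-- Prepending `v` to a shortest path from a closer neighbour gives a path from `v` to `s`. Paths in
a tree are unique, so their second vertices agree. -/
lemma eq_of_closer (hT : T.IsTree) {v q q' s : V} (h : T.Adj v q) (h' : T.Adj v q')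
    (hd : T.dist q s < T.dist v s) (hd' : T.dist q' s < T.dist v s) : q = q' := by
  have e := dist_adj hT s h
  have e' := dist_adj hT s h'
  obtain ⟨p, hp, hl⟩ := hT.1.exists_path_of_dist q s
  obtain ⟨p', hp', hl'⟩ := hT.1.exists_path_of_dist q' s
  have key : ∀ {q : V} (h : T.Adj v q) (p : T.Walk q s), p.length = T.dist q s →
      T.dist q s < T.dist v s → (SimpleGraph.Walk.cons h p).IsPath := by
    intro q h p hl hd
    apply SimpleGraph.Walk.isPath_of_length_eq_dist
    have := dist_adj hT s h
    rw [SimpleGraph.Walk.length_cons]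
    omega
  have := (hT.2.subsingleton_path v s).elim ⟨_, key h p hl hd⟩ ⟨_, key h' p' hl' hd'⟩
  rw [Subtype.mk.injEq] at this
  have h3 := congrArg (fun w => w.snd) this
  simpa using h3

lemma nx_eq (hT : T.IsTree) {v q s : V} (h : T.Adj v q) (hd : T.dist q s < T.dist v s) :
    nx T v s = q := by
  have hvs : v ≠ s := by
    rintro rfl
    simp at hd
  have := nx_dist hT hvs
  exact eq_of_closer hT (nx_adj hT hvs) h (by omega) hd

lemma nx_self_adj (hT : T.IsTree) {v s : V} (h : T.Adj v s) : nx T v s = s :=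
  nx_eq hT h (by simp [SimpleGraph.dist_eq_one_iff_adj.2 h])

lemma farther (hT : T.IsTree) {v q s : V} (h : T.Adj v q) (hn : nx T v s ≠ q) :
    T.dist q s = T.dist v s + 1 := by
  rcases dist_adj hT s h with h1 | h1
  · exact absurd (nx_eq hT h (by omega)) hn
  · exact h1

/-- `v` is on the side of `a` when the edge `ab` is removed. -/
def side (T : SimpleGraph V) (a b v : V) : Prop := T.dist a v < T.dist b v

lemma side_self {a b : V} (h : T.Adj a b) : side T a b a := by
  simp [side, SimpleGraph.dist_eq_one_iff_adj.2 h.symm]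

lemma side_swap (hT : T.IsTree) {a b v : V} (h : T.Adj a b) :
    side T b a v ↔ ¬ side T a b v := by
  have := dist_adj hT v h
  unfold side
  omega

lemma side_iff_nx (hT : T.IsTree) {a b v : V} (h : T.Adj a b) :
    side T a b v ↔ v ≠ b ∧ nx T b v = a := by
  constructor
  · intro h1
    refine ⟨?_, nx_eq hT h.symm h1⟩
    rintro rfl
    simp [side] at h1
  · rintro ⟨h1, rfl⟩
    have := nx_dist hT h1.symm
    unfold side
    omega

lemma side_nx (hT : T.IsTree) {y s : V} (h : y ≠ s) : side T (nx T y s) y s := by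
  have := nx_dist hT h
  unfold side
  omega

/-- Were `uq` a second edge across, the step from `q` towards `b` would also approach `a`, hence
lead to `u` by `eq_of_closer`; but `u` is farther from `b` than `q` is. -/
lemma side_adj (hT : T.IsTree) {a b u q : V} (hab : T.Adj a b) (huq : T.Adj u q)
    (h1 : ¬ (u = a ∧ q = b)) (h : side T a b u) : side T a b q := by
  by_contra hq
  rw [← side_swap hT hab] at hq
  unfold side at h hq
  have e1 := dist_adj hT u hab
  have e2 := dist_adj hT q hab
  have e3 := dist_adj hT a huq
  have e4 := dist_adj hT b huq
  rw [SimpleGraph.dist_comm (u := u), SimpleGraph.dist_comm (u := q)] at e3 e4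
  have hqb : q ≠ b := by
    rintro rfl
    have h0 : T.dist q q = 0 := SimpleGraph.dist_self
    have : T.dist a u = 0 := by omega
    rw [hT.1.dist_eq_zero_iff] at this
    exact h1 ⟨this.symm, rfl⟩
  have h5 := nx_dist hT hqb
  have h6 := nx_adj hT hqb
  have h7 := dist_adj hT (nx T q b) hab
  rw [SimpleGraph.dist_comm (u := nx T q b), SimpleGraph.dist_comm (u := q)] at h5
  have h8 : nx T q b = u := by
    apply eq_of_closer hT (s := a) h6 huq.symm
    · rw [SimpleGraph.dist_comm (u := nx T q b), SimpleGraph.dist_comm (u := q)]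
      omega
    · rw [SimpleGraph.dist_comm (u := u), SimpleGraph.dist_comm (u := q)]
      omega
  rw [h8] at h5
  omega

lemma side_adj_iff (hT : T.IsTree) {a b u q : V} (hab : T.Adj a b) (huq : T.Adj u q)
    (h1 : ¬ (u = a ∧ q = b)) (h2 : ¬ (u = b ∧ q = a)) : side T a b u ↔ side T a b q :=
  ⟨side_adj hT hab huq h1, side_adj hT hab huq.symm (fun h => h2 ⟨h.2, h.1⟩)⟩

/-- Two vertices that no edge of `R` separates stay connected when `R` is removed. -/
lemma reachable_of_side (hT : T.IsTree) (R : Set (Sym2 V)) {T' : SimpleGraph V}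
    (hT' : ∀ v w, T.Adj v w → s(v, w) ∉ R → T'.Adj v w) {u v : V}
    (h : ∀ a b, T.Adj a b → s(a, b) ∈ R → (side T a b u ↔ side T a b v)) :
    T'.Reachable u v := by
  induction hn : T.dist u v generalizing u with
  | zero =>
    rw [hT.1.dist_eq_zero_iff] at hn
    rw [hn]
  | succ n ih =>
    have huv : u ≠ v := by
      rintro rfl
      simp at hn
    have h1 := nx_adj hT huv
    have h2 := nx_dist hT huv
    -- A removed first edge of the path would have `u` and `v` on different sides.
    have h3 : s(u, nx T u v) ∉ R := by
      intro h3
      have := (h _ _ h1 h3).1 (side_self h1)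
      unfold side at this
      omega
    refine (hT' _ _ h1 h3).reachable.trans (ih ?_ (by omega))
    intro a b hab hR
    rw [← h a b hab hR]
    refine (side_adj_iff hT hab h1 ?_ ?_).symm
    · rintro ⟨rfl, rfl⟩
      exact h3 hR
    · rintro ⟨rfl, h4⟩
      rw [h4, Sym2.eq_swap] at h3
      exact h3 hR

end Tree

/-! ### Exchanging one or two tree edges -/

section Surgery

variable {V : Type*} [Fintype V] {G T : SimpleGraph V}

lemma ins_le {c d : V} (h : T ≤ G) (hcd : G.Adj c d) : ins T c d ≤ G := by
  refine sup_le h ?_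
  rw [SimpleGraph.edge_le_iff]
  exact Or.inr hcd

lemma del_le {a b : V} (h : T ≤ G) : del T a b ≤ G :=
  (SimpleGraph.deleteEdges_le _).trans h

lemma reachable_del (hT : T.IsTree) {a b : V} (hab : T.Adj a b) {T' : SimpleGraph V}
    (hT' : del T a b ≤ T') {u v : V} (h : side T a b u ↔ side T a b v) : T'.Reachable u v := by
  refine reachable_of_side hT {s(a, b)} ?_ ?_
  · intro v w h1 h2
    refine hT' ?_
    rw [del, SimpleGraph.deleteEdges_adj]
    exact ⟨h1, h2⟩
  · intro a' b' h1 h2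
    rw [Set.mem_singleton_iff, Sym2.eq_iff] at h2
    rcases h2 with ⟨rfl, rfl⟩ | ⟨rfl, rfl⟩
    · exact h
    · rw [side_swap hT hab, side_swap hT hab, h]

lemma reachable_del2 (hT : T.IsTree) {a b c d : V} (hab : T.Adj a b) (hcd : T.Adj c d)
    {T' : SimpleGraph V} (hT' : del (del T a b) c d ≤ T') {u v : V}
    (h : side T a b u ↔ side T a b v) (h' : side T c d u ↔ side T c d v) : T'.Reachable u v := by
  refine reachable_of_side hT {s(a, b), s(c, d)} ?_ ?_
  · intro v w h1 h2
    refine hT' ?_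
    simp only [Set.mem_insert_iff, Set.mem_singleton_iff, not_or] at h2
    rw [del, SimpleGraph.deleteEdges_adj, del, SimpleGraph.deleteEdges_adj]
    exact ⟨⟨h1, h2.1⟩, h2.2⟩
  · intro a' b' h1 h2
    rw [Set.mem_insert_iff, Set.mem_singleton_iff, Sym2.eq_iff, Sym2.eq_iff] at h2
    rcases h2 with (⟨rfl, rfl⟩ | ⟨rfl, rfl⟩) | (⟨rfl, rfl⟩ | ⟨rfl, rfl⟩)
    · exact h
    · rw [side_swap hT hab, side_swap hT hab, h]
    · exact h'
    · rw [side_swap hT hcd, side_swap hT hcd, h']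

/-- Replacing the edge `ab` of a tree by an edge `cd` across it gives a tree. -/
lemma isTree_swap (hT : T.IsTree) {a b c d : V} (hab : T.Adj a b)
    (hc : side T a b c) (hd : ¬ side T a b d) :
    (ins (del T a b) c d).IsTree ∧ ∀ v, dg (ins (del T a b) c d) v +
      ((if v = a then 1 else 0) + (if v = b then 1 else 0)) =
      dg T v + ((if v = c then 1 else 0) + (if v = d then 1 else 0)) := by
  have hne : c ≠ d := by
    rintro rfl
    exact hd hc
  have hnadj : ¬ (del T a b).Adj c d := by
    rw [del_adj]
    rintro ⟨h1, h2, h3⟩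
    exact hd ((side_adj_iff hT hab h1 h2 h3).1 hc)
  have hle : del T a b ≤ ins (del T a b) c d := le_sup_left
  have hcd : (ins (del T a b) c d).Reachable c d :=
    SimpleGraph.Adj.reachable (by simp [ins_adj hne])
  have hab' : (ins (del T a b) c d).Reachable a b := by
    have h1 := reachable_del hT hab hle (u := a) (v := c) (by simp [side_self hab, hc])
    have h2 := reachable_del hT hab hle (u := d) (v := b)
      (by simp [hd, (side_swap hT hab).1 (side_self hab.symm)])
    exact (h1.trans hcd).trans h2
  refine ⟨isTree_of_degSum hT (connected_of_adj_reachable hT.1 ?_) ?_, ?_⟩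
  · intro v w h
    by_cases h2 : (v = a ∧ w = b) ∨ (v = b ∧ w = a)
    · rcases h2 with ⟨rfl, rfl⟩ | ⟨rfl, rfl⟩
      · exact hab'
      · exact hab'.symm
    · rw [not_or] at h2
      exact (hle (del_adj.2 ⟨h, h2.1, h2.2⟩)).reachable
  · rw [degSum_ins hne hnadj, degSum_del hab]
  · intro v
    rw [dg_ins hne hnadj, ← dg_del hab v]
    omega

/-- Replacing the edges `ab`, `a'b'` of a tree by `cd`, `c'd'` gives a tree, provided that the
result still connects `a` with `b` and `a'` with `b'`. -/
lemma isTree_swap2 (hT : T.IsTree) {a b a' b' c d c' d' : V} (hab : T.Adj a b) (hab' : T.Adj a' b')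
    (hne : ¬ (a' = a ∧ b' = b) ∧ ¬ (a' = b ∧ b' = a)) (hcd : c ≠ d) (hcd' : c' ≠ d')
    (hn : ¬ T.Adj c d) (hn' : ¬ T.Adj c' d') (hnn : ¬ (c' = c ∧ d' = d) ∧ ¬ (c' = d ∧ d' = c))
    (h1 : (ins (ins (del (del T a b) a' b') c d) c' d').Reachable a b)
    (h2 : (ins (ins (del (del T a b) a' b') c d) c' d').Reachable a' b') :
    (ins (ins (del (del T a b) a' b') c d) c' d').IsTree ∧
      ∀ v, dg (ins (ins (del (del T a b) a' b') c d) c' d') v +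
      ((if v = a then 1 else 0) + (if v = b then 1 else 0)) +
      ((if v = a' then 1 else 0) + (if v = b' then 1 else 0)) =
      dg T v + ((if v = c then 1 else 0) + (if v = d then 1 else 0)) +
      ((if v = c' then 1 else 0) + (if v = d' then 1 else 0)) := by
  have e1 : (del T a b).Adj a' b' := del_adj.2 ⟨hab', hne.1, hne.2⟩
  have e2 : ¬ (del (del T a b) a' b').Adj c d := by
    simp only [del_adj]
    exact fun h => hn h.1.1
  have e3 : ¬ (ins (del (del T a b) a' b') c d).Adj c' d' := by
    simp only [ins_adj hcd, del_adj]
    rintro (h | h | h)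
    · exact hn' h.1.1
    · exact hnn.1 h
    · exact hnn.2 h
  refine ⟨isTree_of_degSum hT (connected_of_adj_reachable hT.1 ?_) ?_, ?_⟩
  · intro v w h
    by_cases h3 : (v = a ∧ w = b) ∨ (v = b ∧ w = a)
    · rcases h3 with ⟨rfl, rfl⟩ | ⟨rfl, rfl⟩
      · exact h1
      · exact h1.symm
    by_cases h4 : (v = a' ∧ w = b') ∨ (v = b' ∧ w = a')
    · rcases h4 with ⟨rfl, rfl⟩ | ⟨rfl, rfl⟩
      · exact h2
      · exact h2.symm
    rw [not_or] at h3 h4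
    refine SimpleGraph.Adj.reachable ?_
    rw [ins_adj hcd', ins_adj hcd, del_adj, del_adj]
    exact Or.inl (Or.inl ⟨⟨h, h3.1, h3.2⟩, h4.1, h4.2⟩)
  · rw [degSum_ins hcd' e3, degSum_ins hcd e2]
    have := degSum_del hab
    have := degSum_del e1
    omega
  · intro v
    rw [dg_ins hcd' e3, dg_ins hcd e2, ← dg_del hab v, ← dg_del e1 v]
    omega

end Surgery

/-! ### Junctions and branch vertices between leaves -/

section Degree

variable {V : Type*} [Fintype V] {G T : SimpleGraph V}

lemma one_le_dg {v w : V} (h : T.Adj v w) : 1 ≤ dg T v :=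
  Finset.card_pos.2 ⟨w, by simpa using h⟩

lemma eq_of_dg_one {v a b : V} (h : dg T v = 1) (ha : T.Adj v a) (hb : T.Adj v b) : a = b := by
  rw [dg, Finset.card_eq_one] at h
  obtain ⟨c, hc⟩ := h
  have h1 : a ∈ Finset.univ.filter (T.Adj v) := by simpa using ha
  have h2 : b ∈ Finset.univ.filter (T.Adj v) := by simpa using hb
  rw [hc, Finset.mem_singleton] at h1 h2
  rw [h1, h2]

lemma two_le_dg {v a b : V} (ha : T.Adj v a) (hb : T.Adj v b) (h : a ≠ b) : 2 ≤ dg T v := by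
  have h1 := one_le_dg ha
  by_contra h2
  exact h (eq_of_dg_one (by omega) ha hb)

lemma three_le_dg {v a b c : V} (ha : T.Adj v a) (hb : T.Adj v b) (hc : T.Adj v c)
    (hab : a ≠ b) (hac : a ≠ c) (hbc : b ≠ c) : 3 ≤ dg T v := by
  have : ({a, b, c} : Finset V) ⊆ Finset.univ.filter (T.Adj v) := by
    intro w
    simp only [Finset.mem_insert, Finset.mem_singleton, Finset.mem_filter, Finset.mem_univ,
      true_and]
    rintro (rfl | rfl | rfl) <;> assumption
  have h1 := Finset.card_le_card this
  rwa [Finset.card_eq_three.2 ⟨a, b, c, hab, hac, hbc, rfl⟩] at h1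

/-- For any three vertices of a tree there is one where their directions part. -/
lemma exists_junction (hT : T.IsTree) (a b c : V) : ∃ J,
    (J ≠ a → J ≠ b → nx T J a ≠ nx T J b) ∧ (J ≠ a → J ≠ c → nx T J a ≠ nx T J c) ∧
    (J ≠ b → J ≠ c → nx T J b ≠ nx T J c) := by
  -- A minimizer of the distance sum works: a step common to two of the directions would gain two
  -- and lose at most one.
  obtain ⟨J, -, hJ⟩ := Finset.exists_min_image Finset.univ
    (fun J => T.dist J a + T.dist J b + T.dist J c) ⟨a, Finset.mem_univ a⟩
  have key : ∀ x y z, (∀ q, T.dist J x + T.dist J y + T.dist J z ≤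
      T.dist q x + T.dist q y + T.dist q z) → J ≠ x → J ≠ y → nx T J x ≠ nx T J y := by
    intro x y z h hx hy he
    have h1 := nx_dist hT hx
    have h2 := nx_dist hT hy
    have h3 := dist_adj hT z (nx_adj hT hx)
    have h4 := h (nx T J x)
    rw [← he] at h2
    omega
  refine ⟨J, key a b c (fun q => ?_), key a c b (fun q => ?_), key b c a (fun q => ?_)⟩ <;>
  · have := hJ q (Finset.mem_univ q)
    omega

lemma not_adj_of_adj_adj (hT : T.IsTree) {d y y' : V} (hy : T.Adj d y) (hy' : T.Adj d y') :
    ¬ T.Adj y y' := by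
  intro h
  have h1 := dist_adj hT d h
  rw [SimpleGraph.dist_eq_one_iff_adj.2 hy.symm, SimpleGraph.dist_eq_one_iff_adj.2 hy'.symm] at h1
  omega

lemma side_of_adj_adj (hT : T.IsTree) {d y y' : V} (hy : T.Adj d y) (hy' : T.Adj d y')
    (h : y ≠ y') : side T d y' y := by
  rw [side_swap hT hy'.symm, side_iff_nx hT hy'.symm, nx_self_adj hT hy]
  exact fun e => h e.2

lemma ne_of_dg {v w : V} (h : dg T v ≠ dg T w) : v ≠ w := by
  rintro rfl
  exact h rfl

/-- Two leaves are separated by an edge at a branch vertex. -/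
lemma exists_branch_separating (hT : T.IsTree) (hb : ∃ d, 3 ≤ dg T d) {u w : V} (huw : u ≠ w)
    (hu : dg T u = 1) (hw : dg T w = 1) :
    ∃ d y, 3 ≤ dg T d ∧ T.Adj d y ∧ side T d y u ∧ ¬ side T d y w := by
  obtain ⟨d₀, hd₀⟩ := hb
  obtain ⟨J, h1, h2, h3⟩ := exists_junction hT u w d₀
  have hud : u ≠ d₀ := ne_of_dg (T := T) (by omega)
  have hwd : w ≠ d₀ := ne_of_dg (T := T) (by omega)
  have hJu : J ≠ u := by
    rintro rfl
    exact h3 huw hud (eq_of_dg_one hu (nx_adj hT huw) (nx_adj hT hud))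
  have hJw : J ≠ w := by
    rintro rfl
    exact h2 huw.symm hwd (eq_of_dg_one hw (nx_adj hT huw.symm) (nx_adj hT hwd))
  have hJ : 3 ≤ dg T J := by
    by_cases hJd : J = d₀
    · rwa [hJd]
    · exact three_le_dg (nx_adj hT hJu) (nx_adj hT hJw) (nx_adj hT hJd) (h1 hJu hJw)
        (h2 hJu hJd) (h3 hJw hJd)
  have ha := nx_adj hT hJw
  refine ⟨J, nx T J w, hJ, ha, ?_, ?_⟩
  · rw [side_swap hT ha.symm, side_iff_nx hT ha.symm]
    exact fun h => h1 hJu hJw h.2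
  · rw [← side_swap hT ha, side_iff_nx hT ha.symm]
    exact ⟨hJw.symm, rfl⟩

end Degree

/-! ### Reduced trees and their leaves -/

section Reduced

variable {V : Type*} [Fintype V] {G T T' : SimpleGraph V}

/-- A spanning tree with a branch vertex in which no branch vertex can lose degree unless some
branch vertex gains degree or a new one arises. -/
structure Reduced (G T : SimpleGraph V) : Prop where
  le : T ≤ G
  tree : T.IsTree
  branch : ∃ d, 3 ≤ dg T d
  min : ∀ T' ≤ G, T'.IsTree → (∀ v, dg T' v ≤ max 2 (dg T v)) → ∀ v, 3 ≤ dg T v → dg T v ≤ dg T' v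

/-- The bounds `max 2 _` compose, so every competitor of `T'` already competes with `T`. Facts about
leaves may therefore be applied again after a harmless exchange. -/
lemma Reduced.of_le (h : Reduced G T) (hle : T' ≤ G) (hT' : T'.IsTree)
    (hd : ∀ v, dg T' v ≤ max 2 (dg T v)) : Reduced G T' := by
  obtain ⟨d, hd3⟩ := h.branch
  refine ⟨hle, hT', ⟨d, hd3.trans (h.min T' hle hT' hd d hd3)⟩, ?_⟩
  intro T'' hle'' hT'' hd'' v hv
  have h1 : ∀ v, dg T'' v ≤ max 2 (dg T v) := by
    intro v
    have := hd v
    have := hd'' v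
    omega
  have h2 := hd v
  exact (show dg T' v ≤ dg T v by omega).trans (h.min T'' hle'' hT'' h1 v (by omega))

/-- The edge `uw` would close a cycle through a branch vertex `d`. Dropping a cycle edge at `d`
lowers its degree, while the two leaves only rise to degree two. -/
lemma Reduced.leaves_not_adj (h : Reduced G T) {u w : V} (hu : dg T u = 1) (hw : dg T w = 1) :
    ¬ G.Adj u w := by
  intro huw
  obtain ⟨d, y, hd, hdy, h1, h2⟩ := exists_branch_separating h.tree h.branch huw.ne hu hw
  obtain ⟨hT', hdg⟩ := isTree_swap h.tree hdy h1 h2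
  have hud : d ≠ u := ne_of_dg (T := T) (by omega)
  have hwd : d ≠ w := ne_of_dg (T := T) (by omega)
  have h3 := h.min _ (ins_le (del_le h.le) huw) hT' ?_ d hd
  · have := hdg d
    simp only [if_true, if_neg hud, if_neg hwd] at this
    omega
  · intro v
    have := hdg v
    by_cases hvu : v = u
    · subst hvu
      simp only [if_true, if_neg huw.ne] at this
      omega
    · by_cases hvw : v = w
      · subst hvw
        simp only [if_true, if_neg hvu] at this
        omega
      · simp only [if_neg hvu, if_neg hvw] at this
        omega


/-- Attaching the leaf `u` to its neighbour `v` in place of the tree edge from `v` towards `u`. -/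
lemma Reduced.attach (h : Reduced G T) {u v : V} (hu : dg T u = 1) (huv : G.Adj u v)
    (hn : ¬ T.Adj u v) : dg T (nx T v u) = 2 ∧
    Reduced G (ins (del T (nx T v u) v) u v) ∧
    ∀ x, dg (ins (del T (nx T v u) v) u v) x + (if x = nx T v u then 1 else 0) =
      dg T x + (if x = u then 1 else 0) := by
  have hvu : v ≠ u := huv.ne'
  have hadj := nx_adj h.tree hvu
  obtain ⟨hT', hdg⟩ := isTree_swap h.tree hadj.symm (side_nx h.tree hvu)
    (d := v) (by simp [side])
  have hle := ins_le (del_le (a := nx T v u) (b := v) h.le) huv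
  have hzu : nx T v u ≠ u := fun e => hn (e ▸ hadj).symm
  have hdg' : ∀ x, dg (ins (del T (nx T v u) v) u v) x + (if x = nx T v u then 1 else 0) =
      dg T x + (if x = u then 1 else 0) := fun x => by
    have := hdg x
    omega
  have hd : ∀ x, dg (ins (del T (nx T v u) v) u v) x ≤ max 2 (dg T x) := by
    intro x
    have := hdg' x
    by_cases hxu : x = u
    · subst hxu
      rw [if_pos rfl] at this
      omega
    · rw [if_neg hxu] at this
      omega
  refine ⟨?_, h.of_le hle hT' hd, hdg'⟩
  have h1 := hdg' (nx T v u)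
  rw [if_pos rfl, if_neg hzu] at h1
  have h2 := h.min _ hle hT' hd (nx T v u)
  -- A branch vertex may not lose an edge, so the degree is at most two. The neighbours `v` and the
  -- next vertex towards `u` show that it is at least two.
  have h3 := two_le_dg hadj.symm (nx_adj h.tree hzu) (fun e => by
    have := nx_dist h.tree hvu
    have := nx_dist h.tree hzu
    rw [← e] at this
    omega)
  omega

/-- Attaching `u` to `v` turns `nx T v u` into a leaf and keeps `w` a leaf, and leaves of the new
reduced tree are not adjacent. -/
lemma Reduced.nx_not_adj_leaf (h : Reduced G T) {u v w : V} (hu : dg T u = 1) (hw : dg T w = 1)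
    (huw : w ≠ u) (huv : G.Adj u v) (hn : ¬ T.Adj u v) : ¬ G.Adj (nx T v u) w := by
  intro hzw
  obtain ⟨h1, h2, h3⟩ := h.attach hu huv hn
  have hzu : nx T v u ≠ u := fun e => hn (e ▸ nx_adj h.tree huv.ne').symm
  refine h2.leaves_not_adj (u := nx T v u) (w := w) ?_ ?_ hzw
  · have := h3 (nx T v u)
    rw [if_pos rfl, if_neg hzu] at this
    omega
  · have := h3 w
    rw [if_neg hzw.ne', if_neg huw] at this
    omega

/-- If a neighbour of a branch vertex is adjacent to another one, then the edge to it is not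
oblique to any leaf. -/
lemma Reduced.paired_unused (h : Reduced G T) {d y y' s : V} (hd : 3 ≤ dg T d) (hy : T.Adj d y)
    (hy' : T.Adj d y') (hyy : G.Adj y y') (hs : dg T s = 1) :
    ¬ (G.Adj s y ∧ nx T y s = d) ∧ ¬ (G.Adj s d ∧ nx T d s = y) := by
  have hds : d ≠ s := ne_of_dg (T := T) (by omega)
  have key : ∀ v, T.Adj d v → G.Adj s v → nx T v s ≠ d := by
    rintro v hv hsv rfl
    have hn : ¬ T.Adj s v := fun e => hds (nx_self_adj h.tree e.symm)
    have := (h.attach hs hsv hn).1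
    omega
  refine ⟨fun h1 => key y hy h1.1 h1.2, ?_⟩
  rintro ⟨hsd, hnx⟩
  by_cases hTs : T.Adj s d
  · have hys : y = s := by rw [← hnx, nx_self_adj h.tree hTs.symm]
    subst hys
    -- Here the leaf `s` is `y` itself, so the edge `yy'` of `G` would make the tree edge `dy'`
    -- oblique to `s`.
    refine key y' hy' hyy ?_
    refine nx_eq h.tree hy'.symm ?_
    have := farther h.tree (s := y) hy' (by rw [hnx]; exact hyy.ne)
    omega
  · have hys : y ≠ s := by
      rintro rfl
      exact hTs hy.symm
    have hsy : ¬ side T d y s := by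
      rw [← side_swap h.tree hy, side_iff_nx h.tree hy.symm]
      exact ⟨hds.symm, hnx⟩
    have hsy' : side T d y' s := by
      rw [side_swap h.tree hy'.symm, side_iff_nx h.tree hy'.symm]
      exact fun e => hyy.ne (hnx.symm.trans e.2)
    have hyd : ¬ side T d y y := (side_swap h.tree hy).1 (side_self hy.symm)
    have hyd' : side T d y' y := side_of_adj_adj h.tree hy hy' hyy.ne
    -- Trading `dy`, `dy'` for `sd`, `yy'` costs `d` one degree and raises only the leaf `s`. The
    -- tree stays connected because `s` lies beyond `y`.
    have hle : del (del T d y) d y' ≤ ins (ins (del (del T d y) d y') s d) y y' :=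
      le_sup_left.trans le_sup_left
    have hr : (ins (ins (del (del T d y) d y') s d) y y').Reachable d y := by
      have h1 : (ins (ins (del (del T d y) d y') s d) y y').Adj d s := by
        simp [ins_adj hyy.ne, ins_adj hds.symm]
      exact h1.reachable.trans (reachable_del2 h.tree hy hy' hle (by simp [hsy, hyd])
        (by simp [hsy', hyd']))
    have hr' : (ins (ins (del (del T d y) d y') s d) y y').Adj y y' := by
      simp [ins_adj hyy.ne]
    obtain ⟨hT', hdg⟩ := isTree_swap2 h.tree hy hy'
      ⟨fun e => hyy.ne e.2.symm, fun e => hy.ne e.1⟩ hds.symm hyy.ne hTs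
      (not_adj_of_adj_adj h.tree hy hy') ⟨fun e => hys e.1, fun e => hy.ne e.1.symm⟩
      hr (hr.trans hr'.reachable)
    have h4 := h.min _ (ins_le (ins_le (del_le (del_le h.le)) hsd) hyy) hT' ?_ d hd
    · have := hdg d
      simp only [if_true, if_neg hy.ne, if_neg hy'.ne, if_neg hds] at this
      omega
    · intro x
      have := hdg x
      by_cases hxs : x = s
      · subst hxs
        rw [if_neg hds.symm] at this
        split_ifs at this <;> omega
      · rw [if_neg hxs] at this
        split_ifs at this <;> omega

end Reduced

/-! ### Claw-freeness and the number of leaves -/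

section Claw

variable {V : Type*} [Fintype V] {G T : SimpleGraph V}

/-- Among three neighbours of a vertex of a claw-free graph two are adjacent. -/
lemma IsClawFree.adj_or (h : IsClawFree G) {c x y z : V} (hx : G.Adj c x) (hy : G.Adj c y)
    (hz : G.Adj c z) (hxy : x ≠ y) (hxz : x ≠ z) (hyz : y ≠ z) :
    G.Adj x y ∨ G.Adj x z ∨ G.Adj y z := by
  by_contra hcon
  simp only [not_or] at hcon
  obtain ⟨h1, h2, h3⟩ := hcon
  refine h ⟨⟨⟨Sum.elim (fun _ => c) ![x, y, z], ?_⟩, ?_⟩⟩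
  · rintro (a | a) (b | b) hab
    · exact congrArg _ (Subsingleton.elim a b)
    · fin_cases b <;> simp [hx.ne, hy.ne, hz.ne] at hab
    · fin_cases a <;> simp [hx.ne', hy.ne', hz.ne'] at hab
    · fin_cases a <;> fin_cases b <;> simp_all [eq_comm]
  · intro a b
    change G.Adj (Sum.elim (fun _ => c) ![x, y, z] a) (Sum.elim (fun _ => c) ![x, y, z] b) ↔ _
    rcases a with a | a <;> rcases b with b | b
    · simp
    · fin_cases b <;> simp [hx, hy, hz]
    · fin_cases a <;> simp [hx.symm, hy.symm, hz.symm]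
    · fin_cases a <;> fin_cases b <;> simp [h1, h2, h3, G.adj_comm y x, G.adj_comm z x,
        G.adj_comm z y]

/-- The number of leaves of a tree in terms of its branch vertices. -/
lemma sum_sub_two_leaves (hT : T.IsTree) (hc : 2 ≤ Fintype.card V) :
    (Finset.univ.filter fun v => dg T v = 1).card = 2 + ∑ v, (dg T v - 2) := by
  have h1 := degSum_tree hT
  have hpos : ∀ v, 1 ≤ dg T v := by
    intro v
    have : Nontrivial V := Fintype.one_lt_card_iff_nontrivial.1 (by omega)
    obtain ⟨w, hw⟩ := exists_ne v
    exact one_le_dg (nx_adj hT hw.symm)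
  have h2 : ∀ v, dg T v + (if dg T v = 1 then 1 else 0) = 2 + (dg T v - 2) := by
    intro v
    have := hpos v
    split_ifs <;> omega
  have h3 := Finset.sum_congr (rfl : (Finset.univ : Finset V) = Finset.univ) fun v _ => h2 v
  rw [Finset.sum_add_distrib, Finset.sum_add_distrib] at h3
  simp only [Finset.sum_const, smul_eq_mul, Finset.card_univ] at h3
  rw [Finset.card_filter]
  unfold degSum at h1
  omega

end Claw

/-! ### Oblique edges of leaves -/

section Oblique

variable {V : Type*} [Fintype V] {G T : SimpleGraph V}

/-- No tree edge is oblique to two leaves. -/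
lemma Reduced.oblique_unique (h : Reduced G T) (hclaw : IsClawFree G) {s s' y y' : V}
    (hs : dg T s = 1) (hs' : dg T s' = 1) (hy : G.Adj s y) (hy' : G.Adj s' y')
    (he : s(y, nx T y s) = s(y', nx T y' s')) : s = s' ∧ y = y' := by
  have hys := hy.ne'
  have hys' := hy'.ne'
  have a1 := nx_adj h.tree hys
  have a2 := nx_adj h.tree hys'
  rw [Sym2.eq_iff] at he
  rcases he with ⟨rfl, h2⟩ | ⟨h1, h2⟩
  · refine ⟨?_, rfl⟩
    by_contra hne
    -- If `sy` were a tree edge, the common first edge would end in `s`, and the path from `y` to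
    -- `s'` would run through the leaf `s`.
    have key : ∀ {s s'}, dg T s = 1 → dg T s' = 1 → G.Adj s y → G.Adj s' y → s ≠ s' →
        nx T y s = nx T y s' → ¬ T.Adj s y := by
      intro s s' hs hs' hy hy' hne h2 hsy
      rw [nx_self_adj h.tree hsy.symm] at h2
      have e := nx_adj h.tree hy'.ne'
      rw [← h2] at e
      have h5 := nx_adj h.tree hne
      have h6 := eq_of_dg_one hs h5 e.symm
      have h7 := nx_dist h.tree hne
      have h8 := nx_dist h.tree hy'.ne'
      rw [h6] at h7
      rw [← h2] at h8
      omega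
    have n1 := key hs hs' hy hy' hne h2
    have n2 := key hs' hs hy' hy (Ne.symm hne) h2.symm
    have c1 := h.leaves_not_adj hs hs'
    have c2 := h.nx_not_adj_leaf hs hs' (Ne.symm hne) hy n1
    have c3 := h.nx_not_adj_leaf hs' hs hne hy' n2
    have z1 : nx T y s ≠ s := fun e => n1 (e ▸ a1).symm
    have z2 : nx T y s ≠ s' := fun e => n2 ((h2 ▸ e) ▸ a2).symm
    rw [← h2] at c3
    -- The common next vertex and the two leaves are pairwise non-adjacent, so together with `y`
    -- they form a claw.
    rcases hclaw.adj_or (h.le a1) hy.symm hy'.symm z1 z2 hne with e | e | e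
    · exact c3 e
    · exact c2 e
    · exact c1 e
  · exfalso
    by_cases hne : s' = s
    · subst hne
      have h3 := nx_dist h.tree hys
      have h4 := nx_dist h.tree hys'
      rw [h2] at h3
      rw [← h1] at h4
      omega
    · have n1 : ¬ T.Adj s y ∨ ¬ T.Adj s' y' := by
        by_contra hcon
        simp only [not_or, not_not] at hcon
        have e1 := nx_self_adj h.tree hcon.1.symm
        have e2 := nx_self_adj h.tree hcon.2.symm
        refine h.leaves_not_adj hs hs' ?_
        rw [← e1, h2]
        exact hy'.symm
      rcases n1 with n1 | n1
      · exact h.nx_not_adj_leaf hs hs' hne hy n1 (h2 ▸ hy'.symm)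
      · exact h.nx_not_adj_leaf hs' hs (Ne.symm hne) hy' n1 (h1 ▸ hy.symm)

end Oblique

/-! ### Paired children, and the degree sum of the leaves -/

section LeafDegrees

variable {V : Type*} [Fintype V] {G T : SimpleGraph V}

/-- The children of branch vertices, for the root `r`, that have an adjacent sibling or are
adjacent to their grandparent. -/
noncomputable def paired (G T : SimpleGraph V) (r : V) : Finset V :=
  Finset.univ.filter fun v => v ≠ r ∧ 3 ≤ dg T (nx T v r) ∧
    ∃ w, T.Adj (nx T v r) w ∧ G.Adj v w

/-- All tree neighbours of a vertex but one are adjacent in `G` to another tree neighbour. -/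
lemma card_unpaired_le (hle : T ≤ G) (hclaw : IsClawFree G) (d : V) (hd : 3 ≤ dg T d) :
    (Finset.univ.filter fun v => T.Adj d v ∧ ¬ ∃ w, T.Adj d w ∧ G.Adj v w).card ≤ 1 := by
  rw [Finset.card_le_one]
  intro a ha b hb
  simp only [Finset.mem_filter, Finset.mem_univ, true_and, not_exists, not_and] at ha hb
  by_contra hab
  have : ∃ c, T.Adj d c ∧ c ≠ a ∧ c ≠ b := by
    by_contra hcon
    push Not at hcon
    have h1 : Finset.univ.filter (T.Adj d) ⊆ {a, b} := by
      intro c hc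
      simp only [Finset.mem_filter, Finset.mem_univ, true_and] at hc
      by_cases hca : c = a
      · simp [hca]
      · simp [hcon c hc hca]
    have h2 := Finset.card_le_card h1
    have h3 := Finset.card_le_two (a := a) (b := b)
    unfold dg at hd
    omega
  obtain ⟨c, hc, hca, hcb⟩ := this
  rcases hclaw.adj_or (hle ha.1) (hle hb.1) (hle hc) hab hca.symm hcb.symm with h | h | h
  · exact ha.2 b hb.1 h
  · exact ha.2 c hc h
  · exact hb.2 c hc h

/-- At each branch vertex `d` at least `deg d - 2` children are paired, and one more at the root. -/
lemma le_card_paired_fiber (hT : T.IsTree) (hle : T ≤ G) (hclaw : IsClawFree G) (r d : V)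
    (hd : 3 ≤ dg T d) : dg T d - 2 + (if d = r then 1 else 0) ≤
      ((paired G T r).filter fun v => nx T v r = d).card := by
  have h1 := card_unpaired_le hle hclaw d hd
  -- The tree neighbours of `d` are its paired children, at most one unpaired neighbour and, away
  -- from the root, the parent.
  have h2 : Finset.univ.filter (T.Adj d) ⊆
      ((paired G T r).filter fun v => nx T v r = d) ∪
      (Finset.univ.filter fun v => T.Adj d v ∧ ¬ ∃ w, T.Adj d w ∧ G.Adj v w) ∪
      (if d = r then ∅ else {nx T d r}) := by
    intro v hv
    simp only [Finset.mem_filter, Finset.mem_univ, true_and] at hv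
    simp only [Finset.mem_union, Finset.mem_filter, Finset.mem_univ, true_and, paired]
    by_cases hp : ∃ w, T.Adj d w ∧ G.Adj v w
    · by_cases hdr : d = r
      · subst hdr
        have e := nx_self_adj hT hv.symm
        refine Or.inl (Or.inl ⟨⟨hv.ne', ?_, ?_⟩, e⟩)
        · rwa [e]
        · rwa [e]
      · rw [if_neg hdr]
        by_cases hvd : v = nx T d r
        · exact Or.inr (by simp [hvd])
        · have e : nx T v r = d := nx_eq hT hv.symm (by
            have := farther hT (s := r) hv (Ne.symm hvd)
            omega)
          refine Or.inl (Or.inl ⟨⟨?_, ?_, ?_⟩, e⟩)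
          · rintro rfl
            exact hvd (nx_self_adj hT hv).symm
          · rwa [e]
          · rwa [e]
    · exact Or.inl (Or.inr ⟨hv, hp⟩)
  have h3 := (Finset.card_le_card h2).trans (Finset.card_union_le _ _)
  have h4 := Finset.card_union_le ((paired G T r).filter fun v => nx T v r = d)
    (Finset.univ.filter fun v => T.Adj d v ∧ ¬ ∃ w, T.Adj d w ∧ G.Adj v w)
  change dg T d ≤ _ at h3
  by_cases hdr : d = r
  · rw [if_pos hdr] at h3 ⊢
    simp only [Finset.card_empty] at h3
    omega
  · rw [if_neg hdr] at h3 ⊢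
    simp only [Finset.card_singleton] at h3
    omega

lemma le_card_paired (hT : T.IsTree) (hle : T ≤ G) (hclaw : IsClawFree G) (r : V)
    (hr : 3 ≤ dg T r) : ∑ v, (dg T v - 2) + 1 ≤ (paired G T r).card := by
  rw [Finset.card_eq_sum_card_fiberwise (f := fun v => nx T v r) (t := Finset.univ)
    (by simp)]
  have : ∑ v, (dg T v - 2) + 1 = ∑ v, (dg T v - 2 + (if v = r then 1 else 0)) := by
    rw [Finset.sum_add_distrib]
    simp
  rw [this]
  refine Finset.sum_le_sum fun d _ => ?_
  by_cases hd : 3 ≤ dg T d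
  · exact le_card_paired_fiber hT hle hclaw r d hd
  · rw [if_neg (by rintro rfl; exact hd hr)]
    omega

/-- The edges towards the root are pairwise distinct. -/
lemma parent_edge_inj (hT : T.IsTree) {r v w : V} (hv : v ≠ r) (hw : w ≠ r)
    (h : s(v, nx T v r) = s(w, nx T w r)) : v = w := by
  rw [Sym2.eq_iff] at h
  rcases h with h | ⟨h1, h2⟩
  · exact h.1
  · have h3 := nx_dist hT hv
    have h4 := nx_dist hT hw
    rw [h2] at h3
    rw [← h1] at h4
    omega

/-- In a claw-free graph the degrees of the leaves of a reduced tree are small. -/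
theorem Reduced.sum_leaves_le (h : Reduced G T) (hclaw : IsClawFree G) :
    ∑ s ∈ Finset.univ.filter (fun v => dg T v = 1), dg G s +
      (Finset.univ.filter fun v => dg T v = 1).card ≤ Fintype.card V := by
  obtain ⟨r, hr⟩ := h.branch
  set U := Finset.univ.filter fun v => dg T v = 1 with hU
  have hcard : 2 ≤ Fintype.card V := by
    have h1 : dg T r ≤ Fintype.card V := Finset.card_le_univ _
    omega
  have h1 : U.card = 2 + ∑ v, (dg T v - 2) := by
    convert sum_sub_two_leaves h.tree hcard
  have h2 := le_card_paired h.tree h.le hclaw r hr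
  set A := U.sigma fun s => Finset.univ.filter (G.Adj s) with hA
  have hAmem : ∀ p : (_ : V) × V, p ∈ A ↔ dg T p.1 = 1 ∧ G.Adj p.1 p.2 := by
    intro p
    simp [hA, hU]
  have hAcard : A.card = ∑ s ∈ U, dg G s := by
    rw [hA, Finset.card_sigma]
    rfl
  -- The map `f` sends a leaf and a neighbour to the oblique edge, and `g` sends a paired child to
  -- its parent edge. Both are injective with disjoint images among the `|V| - 1` tree edges; there
  -- are at least `|U| - 1` paired children.
  set f : (_ : V) × V → Sym2 V := fun p => s(p.2, nx T p.2 p.1) with hf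
  set g : V → Sym2 V := fun v => s(v, nx T v r) with hg
  have hfinj : Set.InjOn f A := by
    rintro ⟨s, y⟩ hp ⟨s', y'⟩ hp' he
    rw [Finset.mem_coe, hAmem] at hp hp'
    obtain ⟨rfl, rfl⟩ := h.oblique_unique hclaw hp.1 hp'.1 hp.2 hp'.2 he
    rfl
  have hpm : ∀ v ∈ paired G T r, v ≠ r ∧ 3 ≤ dg T (nx T v r) ∧
      ∃ w, T.Adj (nx T v r) w ∧ G.Adj v w := by
    intro v hv
    simpa [paired] using hv
  have hginj : Set.InjOn g (paired G T r) := by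
    intro v hv w hw he
    exact parent_edge_inj h.tree (hpm v hv).1 (hpm w hw).1 he
  have hdisj : Disjoint (A.image f) ((paired G T r).image g) := by
    rw [Finset.disjoint_left]
    intro e he he'
    obtain ⟨⟨s, y⟩, hp, rfl⟩ := Finset.mem_image.1 he
    obtain ⟨v, hv, hev⟩ := Finset.mem_image.1 he'
    rw [hAmem] at hp
    obtain ⟨hvr, hd, w, hw, hvw⟩ := hpm v hv
    have h3 := h.paired_unused hd (nx_adj h.tree hvr).symm hw hvw hp.1
    rw [hg, hf, Sym2.eq_iff] at hev
    rcases hev with ⟨e1, e2⟩ | ⟨e1, e2⟩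
    · refine h3.1 ⟨e1 ▸ hp.2, ?_⟩
      rw [e2, e1]
    · refine h3.2 ⟨e2 ▸ hp.2, ?_⟩
      rw [e2, e1]
  have hsub : A.image f ∪ (paired G T r).image g ⊆ T.edgeFinset := by
    intro e he
    rw [SimpleGraph.mem_edgeFinset]
    rcases Finset.mem_union.1 he with he | he
    · obtain ⟨⟨s, y⟩, hp, rfl⟩ := Finset.mem_image.1 he
      rw [hAmem] at hp
      exact nx_adj h.tree hp.2.ne'
    · obtain ⟨v, hv, rfl⟩ := Finset.mem_image.1 he
      exact nx_adj h.tree (hpm v hv).1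
  have h4 := Finset.card_le_card hsub
  rw [Finset.card_union_of_disjoint hdisj, Finset.card_image_of_injOn hfinj,
    Finset.card_image_of_injOn hginj, hAcard] at h4
  have h5 : T.edgeFinset.card + 1 = Fintype.card V := by
    convert h.tree.card_edgeFinset
  omega

end LeafDegrees

/-! ### Too many leaves violate the degree condition -/

section DegreeCondition

variable {V : Type*} [Fintype V] {G T : SimpleGraph V}

lemma card_leaves (T : SimpleGraph V) :
    (leaves T).card = (Finset.univ.filter fun v => dg T v = 1).card := by
  unfold leaves
  congr 1
  ext v
  simp [degree_eq_dg]

lemma card_branchVertices (T : SimpleGraph V) :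
    (branchVertices T).card = (Finset.univ.filter fun v => 3 ≤ dg T v).card := by
  unfold branchVertices
  congr 1
  ext v
  simp [degree_eq_dg]
  omega

/-- A large independent set has large degree sum. -/
lemma le_sum_of_sigma {j c : ℕ} {b : ℕ∞} (h : b ≤ sigma G j + (c : ℕ∞)) {S : Finset V}
    (hS : ∀ u ∈ S, ∀ v ∈ S, ¬ G.Adj u v) (hcard : S.card = j) :
    b ≤ ((∑ v ∈ S, dg G v + c : ℕ) : ℕ∞) := by
  refine h.trans ?_
  push_cast
  gcongr
  refine (iInf₂_le S ?_).trans ?_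
  · exact ⟨fun u hu v hv _ => hS u hu v hv, hcard⟩
  · push_cast
    refine le_of_eq (Finset.sum_congr rfl fun v _ => ?_)
    rw [degree_eq_dg]

/-- Dropping vertices of positive degree from a set of vertices. -/
lemma exists_subset_sum_add_le (hpos : ∀ v, 1 ≤ dg G v) {S : Finset V} {j : ℕ} (hj : j ≤ S.card) :
    ∃ S' ⊆ S, S'.card = j ∧ ∑ v ∈ S', dg G v + (S.card - j) ≤ ∑ v ∈ S, dg G v := by
  obtain ⟨S', hS', hc⟩ := Finset.exists_subset_card_eq hj
  refine ⟨S', hS', hc, ?_⟩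
  rw [← Finset.sum_sdiff hS', add_comm, ← hc, ← Finset.card_sdiff_of_subset hS']
  gcongr
  rw [Finset.card_eq_sum_ones]
  exact Finset.sum_le_sum fun v _ => hpos v

/-- The leaves of a reduced tree contradict the degree condition if there are too many. -/
lemma Reduced.card_leaves_le (h : Reduced G T) (hclaw : IsClawFree G) {k m : ℕ} (hkm : k + 3 ≤ m)
    (hσ : ((Fintype.card V + m : ℕ) : ℕ∞) ≤ sigma G (m + 1) + ((2 * k + 4 : ℕ) : ℕ∞)) :
    (Finset.univ.filter fun v => dg T v = 1).card ≤ m := by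
  by_contra! hcon
  obtain ⟨d, hd⟩ := h.branch
  have hpos : ∀ v, 1 ≤ dg G v := by
    intro v
    by_cases hvd : v = d
    · obtain ⟨w, hw⟩ := Finset.card_pos.1 (show 0 < dg T d by omega)
      exact one_le_dg (h.le (by simpa [hvd] using hw))
    · exact one_le_dg (h.le (nx_adj h.tree hvd))
  obtain ⟨S, hS, hc, hsum⟩ := exists_subset_sum_add_le hpos hcon
  have h1 : ∀ u ∈ S, ∀ v ∈ S, ¬ G.Adj u v := by
    intro u hu v hv
    have hu' := hS hu
    have hv' := hS hv
    simp only [Finset.mem_filter, Finset.mem_univ, true_and] at hu' hv'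
    exact h.leaves_not_adj hu' hv'
  have h2 := le_sum_of_sigma hσ h1 hc
  rw [Nat.cast_le] at h2
  have h3 := h.sum_leaves_le hclaw
  have h4 : ∑ s ∈ Finset.univ.filter (fun v => dg T v = 1), dg G s +
      (Finset.univ.filter fun v => dg T v = 1).card ≤ Fintype.card V := by
    convert h3
  -- With `L` leaves in all, the `m + 1` chosen ones have degree sum at most `|V| - L - (L - m -
  -- 1)`, hence at most `|V| - m - 1`. The hypothesis demands at least `|V| + m - 2k - 4`,
  -- impossible for `m ≥ k + 3`.
  omega

end DegreeCondition

/-! ### Comparing directions from different vertices -/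

section Directions

variable {V : Type*} [Fintype V] {T : SimpleGraph V}

@[simp] lemma nx_self (T : SimpleGraph V) (v : V) : nx T v v = v := by
  rw [nx, dif_neg]
  rintro ⟨q, -, h⟩
  simp at h

/-- The default value `nx T b b = b` absorbs the case `v = b`, so sides of removed edges can be
expressed through `nx` alone. -/
lemma side_iff (hT : T.IsTree) {a b v : V} (h : T.Adj a b) : side T a b v ↔ nx T b v = a := by
  rw [side_iff_nx hT h]
  constructor
  · exact fun h => h.2
  · intro h'
    refine ⟨?_, h'⟩
    rintro rfl
    rw [nx_self] at h'
    exact h.ne h'.symm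

lemma nx_ne_self (hT : T.IsTree) {v s : V} (h : v ≠ s) : nx T v s ≠ v :=
  (nx_adj hT h).ne'

/-- Adjacent vertices lie in the same direction from a third vertex. -/
lemma nx_congr_adj (hT : T.IsTree) {J v w : V} (h : T.Adj v w) (hv : J ≠ v) (hw : J ≠ w) :
    nx T J v = nx T J w := by
  have h1 := nx_adj hT hv
  have h2 : side T (nx T J v) J v := side_nx hT hv
  rw [side_adj_iff hT h1.symm h (fun e => hw e.2.symm) (fun e => hv e.1.symm),
    side_iff hT h1.symm] at h2
  exact h2.symm

/-- If `q` separates `v` from `p`, then `v` lies in the direction of `q` from `p`. -/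
lemma nx_through (hT : T.IsTree) {p q v : V} (hqp : q ≠ p) (h : nx T q v ≠ nx T q p) :
    nx T p v = nx T p q := by
  induction hn : T.dist p q generalizing p with
  | zero =>
    rw [hT.1.dist_eq_zero_iff] at hn
    exact absurd hn.symm hqp
  | succ n ih =>
    have h1 := nx_adj hT hqp.symm
    have h2 := nx_dist hT hqp.symm
    -- Induction along the path from `p` to `q`: already its second vertex does not see `v` behind
    -- `p`.
    have h4 : nx T (nx T p q) v ≠ p := by
      by_cases he : nx T p q = q
      · rw [he] at h1 ⊢
        rwa [nx_self_adj hT h1.symm] at h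
      · have h5 : nx T q (nx T p q) = nx T q p := nx_congr_adj hT h1.symm (Ne.symm he) hqp
        rw [ih (Ne.symm he) (by rwa [h5]) (by omega)]
        intro e
        have := nx_dist hT he
        rw [e] at this
        omega
    by_contra hc
    rw [← side_iff hT h1.symm, ← side_swap hT h1.symm, side_iff hT h1] at hc
    exact h4 hc

end Directions

/-! ### Exchanging lists of edges -/

section Surgery

variable {V : Type*} [Fintype V] {G T : SimpleGraph V}

/-- The graph with the edges of `R` removed and then the edges of `A` added. -/
def surg (T : SimpleGraph V) (R A : List (V × V)) : SimpleGraph V :=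
  A.foldr (fun e H => ins H e.1 e.2) (R.foldr (fun e H => del H e.1 e.2) T)

/-- The number of edges of a list at a vertex. -/
noncomputable def cnt (l : List (V × V)) (v : V) : ℕ :=
  (l.map fun e => (if v = e.1 then 1 else 0) + (if v = e.2 then 1 else 0)).sum

@[simp] lemma cnt_nil (v : V) : cnt [] v = 0 := rfl

@[simp] lemma cnt_cons (e : V × V) (l : List (V × V)) (v : V) :
    cnt (e :: l) v = (if v = e.1 then 1 else 0) + (if v = e.2 then 1 else 0) + cnt l v := by
  simp [cnt]

lemma ins_self (T : SimpleGraph V) (a : V) : ins T a a = T := by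
  simp [ins]

lemma foldr_del_adj {R : List (V × V)} {v w : V} :
    (R.foldr (fun e H => del H e.1 e.2) T).Adj v w ↔
      T.Adj v w ∧ ∀ e ∈ R, ¬ (v = e.1 ∧ w = e.2) ∧ ¬ (v = e.2 ∧ w = e.1) := by
  induction R with
  | nil => simp
  | cons e R ih =>
    rw [List.foldr_cons, del_adj, ih]
    simp only [List.mem_cons, forall_eq_or_imp]
    tauto

lemma surg_adj {R A : List (V × V)} {v w : V} :
    (surg T R A).Adj v w ↔
      (T.Adj v w ∧ ∀ e ∈ R, ¬ (v = e.1 ∧ w = e.2) ∧ ¬ (v = e.2 ∧ w = e.1)) ∨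
      ∃ e ∈ A, e.1 ≠ e.2 ∧ ((v = e.1 ∧ w = e.2) ∨ (v = e.2 ∧ w = e.1)) := by
  have key : ∀ H : SimpleGraph V, (A.foldr (fun e H => ins H e.1 e.2) H).Adj v w ↔
      H.Adj v w ∨ ∃ e ∈ A, e.1 ≠ e.2 ∧ ((v = e.1 ∧ w = e.2) ∨ (v = e.2 ∧ w = e.1)) := by
    intro H
    induction A with
    | nil => simp
    | cons e A ih =>
      simp only [List.foldr_cons, List.mem_cons, exists_eq_or_imp]
      generalize A.foldr (fun e H => ins H e.1 e.2) H = K at ih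
      obtain ⟨a, b⟩ := e
      by_cases he : a = b
      · subst he
        rw [ins_self, ih]
        simp
      · rw [ins_adj he, ih]
        simp only [ne_eq, he, not_false_eq_true, true_and]
        rw [or_assoc, or_comm (b := v = a ∧ w = b ∨ v = b ∧ w = a)]
  rw [← foldr_del_adj]
  exact key _

lemma surg_le {R A : List (V × V)} (hle : T ≤ G) (hA : ∀ e ∈ A, G.Adj e.1 e.2) :
    surg T R A ≤ G := by
  intro v w h
  rcases surg_adj.1 h with h | ⟨e, he, -, ⟨rfl, rfl⟩ | ⟨rfl, rfl⟩⟩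
  · exact hle h.1
  · exact hA e he
  · exact (hA e he).symm

/-- Inserting a loop or an edge already present changes nothing. Without excluding these cases only
the upper bound survives, and it is all that most exchanges need. -/
lemma dg_ins_le (a b v : V) :
    dg (ins T a b) v ≤ dg T v + ((if v = a then 1 else 0) + (if v = b then 1 else 0)) := by
  by_cases hab : a = b
  · rw [hab, ins_self]
    omega
  · by_cases h : T.Adj a b
    · have : ins T a b = T := by
        unfold ins
        rw [sup_eq_left, SimpleGraph.edge_le_iff]
        exact Or.inr h
      rw [this]
      omega
    · exact (dg_ins hab h v).le

lemma dg_foldr_del {R : List (V × V)} (hR : ∀ e ∈ R, T.Adj e.1 e.2)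
    (hnd : (R.map fun e => s(e.1, e.2)).Nodup) (v : V) :
    dg (R.foldr (fun e H => del H e.1 e.2) T) v + cnt R v = dg T v := by
  induction R with
  | nil => simp
  | cons e R ih =>
    simp only [List.mem_cons, forall_eq_or_imp, List.map_cons, List.nodup_cons, List.mem_map,
      not_exists, not_and] at hR hnd
    have hadj : (R.foldr (fun e H => del H e.1 e.2) T).Adj e.1 e.2 := by
      rw [foldr_del_adj]
      refine ⟨hR.1, fun f hf => ?_⟩
      have := hnd.1 f hf
      rw [Sym2.eq_iff] at this
      grind
    rw [List.foldr_cons, cnt_cons, ← ih hR.2 hnd.2, ← dg_del hadj v]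
    omega

lemma dg_surg {R A : List (V × V)} (hR : ∀ e ∈ R, T.Adj e.1 e.2)
    (hnd : (R.map fun e => s(e.1, e.2)).Nodup) (v : V) :
    dg (surg T R A) v + cnt R v ≤ dg T v + cnt A v := by
  rw [← dg_foldr_del hR hnd v]
  unfold surg
  induction A with
  | nil => simp
  | cons e A ih =>
    rw [List.foldr_cons, cnt_cons]
    have := dg_ins_le (T := A.foldr (fun e H => ins H e.1 e.2)
      (R.foldr (fun e H => del H e.1 e.2) T)) e.1 e.2 v
    omega

/-- To see that a modified tree is connected it suffices to connect the ends of the removed edges,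
using added edges and pairs of vertices that no removed edge separates. -/
lemma surg_connected (hT : T.IsTree) {R A : List (V × V)}
    (h : ∀ κ : V → (surg T R A).ConnectedComponent, (∀ e ∈ A, κ e.1 = κ e.2) →
      (∀ u v, (∀ e ∈ R, (nx T e.2 u = e.1 ↔ nx T e.2 v = e.1)) → κ u = κ v) →
      ∀ e ∈ R, κ e.1 = κ e.2) : (surg T R A).Connected := by
  -- Stating the obligation for an arbitrary labelling `κ` turns connectivity into equational
  -- reasoning; the labelling by components is the one that matters.
  have h1 := h (surg T R A).connectedComponentMk ?_ ?_
  · refine connected_of_adj_reachable hT.1 fun v w hvw => ?_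
    by_cases he : ∃ e ∈ R, (v = e.1 ∧ w = e.2) ∨ (v = e.2 ∧ w = e.1)
    · obtain ⟨e, he, ⟨rfl, rfl⟩ | ⟨rfl, rfl⟩⟩ := he
      · exact SimpleGraph.ConnectedComponent.exact (h1 e he)
      · exact (SimpleGraph.ConnectedComponent.exact (h1 e he)).symm
    · push Not at he
      refine SimpleGraph.Adj.reachable ?_
      rw [surg_adj]
      refine Or.inl ⟨hvw, fun e hh => ?_⟩
      have := he e hh
      tauto
  · intro e he
    rw [SimpleGraph.ConnectedComponent.eq]
    by_cases h2 : e.1 = e.2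
    · rw [h2]
    · refine SimpleGraph.Adj.reachable ?_
      rw [surg_adj]
      exact Or.inr ⟨e, he, h2, Or.inl ⟨rfl, rfl⟩⟩
  · intro u v huv
    rw [SimpleGraph.ConnectedComponent.eq]
    refine reachable_of_side hT {e | ∃ f ∈ R, s(f.1, f.2) = e} ?_ ?_
    · intro v w hvw hn
      rw [surg_adj]
      refine Or.inl ⟨hvw, fun e hh => ?_⟩
      simp only [Set.mem_ofPred_eq, not_exists, not_and, Sym2.eq_iff] at hn
      have := hn e hh
      grind
    · rintro a b hab ⟨f, hf, he⟩
      have := huv f hf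
      rw [Sym2.eq_iff] at he
      rcases he with ⟨rfl, rfl⟩ | ⟨rfl, rfl⟩
      · rw [side_iff hT hab, side_iff hT hab, this]
      · rw [side_swap hT hab.symm, side_swap hT hab.symm, side_iff hT hab.symm,
          side_iff hT hab.symm, this]

lemma sum_cnt (l : List (V × V)) : ∑ v, cnt l v = 2 * l.length := by
  induction l with
  | nil => simp
  | cons e l ih =>
    simp only [cnt_cons, Finset.sum_add_distrib, ih, List.length_cons]
    simp
    omega

lemma degSum_ge_of_connected {H : SimpleGraph V} (hH : H.Connected) :
    2 * Fintype.card V ≤ degSum H + 2 := by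
  obtain ⟨T, hle, hT⟩ := hH.exists_isTree_le
  rw [← degSum_tree hT]
  gcongr
  refine Finset.sum_le_sum fun v _ => Finset.card_le_card ?_
  intro w hw
  simp only [Finset.mem_filter, Finset.mem_univ, true_and] at hw ⊢
  exact hle hw

/-- A connected modification with as many added as removed edges is a tree. -/
lemma surg_isTree (hT : T.IsTree) {R A : List (V × V)} (hR : ∀ e ∈ R, T.Adj e.1 e.2)
    (hnd : (R.map fun e => s(e.1, e.2)).Nodup) (hl : A.length = R.length)
    (hc : (surg T R A).Connected) : (surg T R A).IsTree ∧
      ∀ v, dg (surg T R A) v + cnt R v = dg T v + cnt A v := by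
  have h1 := degSum_ge_of_connected hc
  have h2 := degSum_tree hT
  have h3 : ∀ v ∈ Finset.univ, dg (surg T R A) v + cnt R v ≤ dg T v + cnt A v :=
    fun v _ => dg_surg hR hnd v
  have h4 := Finset.sum_le_sum h3
  have e1 := sum_cnt R
  have e2 := sum_cnt A
  rw [Finset.sum_add_distrib, Finset.sum_add_distrib, e1, e2] at h4
  unfold degSum at h1 h2
  refine ⟨isTree_of_degSum hT hc (by unfold degSum; omega), fun v => ?_⟩
  -- Connectedness bounds the degree sum from below by that of a tree, and the bounds at single
  -- vertices add up to the same number; so all of them are equalities.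
  refine (Finset.sum_eq_sum_iff_of_le h3).1 ?_ v (Finset.mem_univ v)
  rw [Finset.sum_add_distrib, Finset.sum_add_distrib, e1, e2]
  omega

end Surgery

/-! ### The potentials, optimal trees and forbidden exchanges -/

section Potential

variable {V : Type*} [Fintype V] {G T T' : SimpleGraph V}

/-- The number of branch vertices. -/
noncomputable def nb (T : SimpleGraph V) : ℕ := (Finset.univ.filter fun v => 3 ≤ dg T v).card

/-- The sum of the squares of the degrees of the branch vertices. -/
noncomputable def sq (T : SimpleGraph V) : ℕ := ∑ v, if 3 ≤ dg T v then dg T v ^ 2 else 0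

/-- `b` is a proper ancestor of `v` in the tree `T` with root `r`. -/
def anc (T : SimpleGraph V) (r b v : V) : Prop := b ≠ v ∧ nx T b v ≠ nx T b r

/-- The number of branch vertices above `v`. -/
noncomputable def qd (T : SimpleGraph V) (r v : V) : ℕ :=
  (Finset.univ.filter fun b => 3 ≤ dg T b ∧ anc T r b v).card

/-- The sum of the excesses of the branch vertices, with much larger weights near the root. -/
noncomputable def om (T : SimpleGraph V) (r : V) : ℕ :=
  ∑ v, (dg T v - 3) * (2 * Fintype.card V) ^ (Fintype.card V - qd T r v)

/-- A cubic vertex is bad if some child is not adjacent to any other tree neighbour. -/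
def Bad (G T : SimpleGraph V) (r x : V) : Prop :=
  dg T x = 3 ∧ x ≠ r ∧ ∃ w, T.Adj x w ∧ w ≠ nx T x r ∧ ∀ w', T.Adj x w' → ¬ G.Adj w w'

/-- The number of bad vertices. -/
noncomputable def zb (G T : SimpleGraph V) (r : V) : ℕ := (Finset.univ.filter (Bad G T r)).card

/-- The recursion along the path to the root by which ancestors in two trees are compared. Since `nx
T r r = r`, the root is an ancestor of every other vertex. -/
lemma anc_parent (hT : T.IsTree) {r b v : V} (hv : v ≠ r) :
    anc T r b v ↔ b = nx T v r ∨ anc T r b (nx T v r) := by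
  have h1 := nx_adj hT hv
  have h2 := nx_dist hT hv
  constructor
  · rintro ⟨h3, h4⟩
    by_cases hb : b = nx T v r
    · exact Or.inl hb
    · exact Or.inr ⟨hb, by rwa [← nx_congr_adj hT h1 h3 hb]⟩
  · rintro (rfl | ⟨h3, h4⟩)
    · refine ⟨h1.ne', ?_⟩
      rw [nx_self_adj hT h1.symm]
      by_cases h5 : nx T v r = r
      · rw [h5, nx_self]
        exact hv
      · intro h6
        have := nx_dist hT h5
        rw [← h6] at this
        omega
    · have hb : b ≠ v := by
        rintro rfl
        exact h4 (nx_self_adj hT h1)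
      exact ⟨hb, by rwa [nx_congr_adj hT h1 hb h3]⟩

lemma anc_trans (hT : T.IsTree) {r a b v : V} (h1 : anc T r a b) (h2 : anc T r b v) :
    anc T r a v := by
  have h3 : nx T b r = nx T b a := nx_through hT h1.1 (Ne.symm h1.2)
  have h4 : nx T a v = nx T a b := nx_through hT h1.1.symm (by rw [← h3]; exact h2.2)
  refine ⟨?_, by rw [h4]; exact h1.2⟩
  rintro rfl
  rw [nx_self] at h4
  exact nx_ne_self hT h1.1 h4.symm

lemma not_anc_self (r v : V) : ¬ anc T r v v := fun h => h.1 rfl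

lemma not_anc_root (r v : V) : ¬ anc T r v r := fun h => h.2 rfl

lemma anc_adj (hT : T.IsTree) {r p v w : V} (hv : anc T r p v) (hw : ¬ anc T r p w)
    (h : T.Adj v w) : w = p := by
  by_contra hne
  exact hw ⟨Ne.symm hne, by rw [← nx_congr_adj hT h hv.1 (Ne.symm hne)]; exact hv.2⟩

lemma qd_lt_of_anc (hT : T.IsTree) {r p v : V} (hp : 3 ≤ dg T p) (h : anc T r p v) :
    qd T r p < qd T r v := by
  refine Finset.card_lt_card ?_
  rw [Finset.ssubset_iff_of_subset]
  · exact ⟨p, by simp [hp, h], by simp [not_anc_self]⟩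
  · intro b
    simp only [Finset.mem_filter, Finset.mem_univ, true_and]
    exact fun hb => ⟨hb.1, anc_trans hT hb.2 h⟩

lemma qd_le_card (T : SimpleGraph V) (r v : V) : qd T r v ≤ Fintype.card V := Finset.card_le_univ _

/-- The total excess stays below the base of the weights in `om`, so a single unit of excess
outweighs all excess with more branch vertices above it. -/
lemma sum_sub_three_lt (hT : T.IsTree) (s : Finset V) :
    ∑ v ∈ s, (dg T v - 3) < 2 * Fintype.card V := by
  have h1 := degSum_tree hT
  unfold degSum at h1
  have h2 : ∑ v ∈ s, (dg T v - 3) ≤ ∑ v, dg T v :=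
    (Finset.sum_le_sum fun v _ => Nat.sub_le _ _).trans
      (Finset.sum_le_sum_of_subset (Finset.subset_univ s))
  omega

section Below

variable {r p : V}

/-- The path to the root from a vertex not below `p` never goes below `p`, so it consists of kept
edges. -/
lemma nx_eq_of_kept (hT : T.IsTree) (hT' : T'.IsTree)
    (h2 : ∀ v w, ¬ anc T r p v → ¬ anc T r p w → T.Adj v w → T'.Adj v w) {v : V}
    (hv : ¬ anc T r p v) (hvr : v ≠ r) : ¬ anc T r p (nx T v r) ∧ nx T' v r = nx T v r := by
  induction hn : T.dist v r generalizing v with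
  | zero =>
    rw [hT.1.dist_eq_zero_iff] at hn
    exact absurd hn hvr
  | succ n ih =>
    have h3 : ¬ anc T r p (nx T v r) := by
      rw [anc_parent hT hvr] at hv
      exact fun h => hv (Or.inr h)
    refine ⟨h3, ?_⟩
    have h4 := nx_adj hT hvr
    have h5 := nx_dist hT hvr
    have h6 := h2 _ _ hv h3 h4
    by_cases hr : nx T v r = r
    · rw [hr] at h6 ⊢
      exact nx_self_adj hT' h6
    · by_contra hne
      have h7 := farther hT' h6 hne
      have h8 : nx T' (nx T v r) r = v := nx_eq hT' h6.symm (by omega)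
      rw [(ih h3 hr (by omega)).2] at h8
      have := nx_dist hT hr
      rw [h8] at this
      omega

lemma anc_iff_of_kept (hT : T.IsTree) (hT' : T'.IsTree)
    (h2 : ∀ v w, ¬ anc T r p v → ¬ anc T r p w → T.Adj v w → T'.Adj v w) {b v : V}
    (hv : ¬ anc T r p v) : anc T' r b v ↔ anc T r b v := by
  induction hn : T.dist v r generalizing v with
  | zero =>
    rw [hT.1.dist_eq_zero_iff] at hn
    rw [hn]
    simp [not_anc_root]
  | succ n ih =>
    have hvr : v ≠ r := by
      rintro rfl
      simp at hn
    obtain ⟨h3, h4⟩ := nx_eq_of_kept hT hT' h2 hv hvr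
    have h5 := nx_dist hT hvr
    rw [anc_parent hT hvr, anc_parent hT' hvr, h4, ih h3 (by omega)]

/-- In the new tree too, the vertices that were below `p` can be left only through `p`, so the path
to the root meets `p`. -/
lemma anc_of_below (hT' : T'.IsTree)
    (h3 : ∀ v w, anc T r p v → ¬ anc T r p w → T'.Adj v w → w = p) {v : V}
    (hv : anc T r p v) : anc T' r p v := by
  induction hn : T'.dist v r generalizing v with
  | zero =>
    rw [hT'.1.dist_eq_zero_iff] at hn
    rw [hn] at hv
    exact absurd hv (not_anc_root _ _)
  | succ n ih =>
    have hvr : v ≠ r := by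
      rintro rfl
      exact not_anc_root _ _ hv
    have h5 := nx_dist hT' hvr
    rw [anc_parent hT' hvr]
    by_cases h : anc T r p (nx T' v r)
    · exact Or.inr (ih h (by omega))
    · exact Or.inl (h3 _ _ hv h (nx_adj hT' hvr)).symm

/-- Moving excess from `p` to places below `p` decreases the weighted excess. -/
lemma om_lt (hT : T.IsTree) (hT' : T'.IsTree) (hp : 4 ≤ dg T p) (hp' : dg T' p + 1 = dg T p)
    (hbelow : ∃ v, anc T r p v)
    (h1 : ∀ v, v ≠ p → ¬ anc T r p v → dg T' v = dg T v)
    (h2 : ∀ v w, ¬ anc T r p v → ¬ anc T r p w → T.Adj v w → T'.Adj v w)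
    (h3 : ∀ v w, anc T r p v → ¬ anc T r p w → T'.Adj v w → w = p) : om T' r < om T r := by
  set N := Fintype.card V with hN
  have hanc : ∀ v, ¬ anc T r p v → ∀ b, anc T r b v → ¬ anc T r p b :=
    fun v hv b hb h => hv (anc_trans hT h hb)
  have hqd : ∀ v, ¬ anc T r p v → qd T' r v = qd T r v := by
    intro v hv
    unfold qd
    congr 1
    ext b
    simp only [Finset.mem_filter, Finset.mem_univ, true_and]
    rw [anc_iff_of_kept hT hT' h2 hv]
    refine and_congr_left fun hb => ?_
    by_cases hbp : b = p
    · subst hbp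
      omega
    · rw [h1 b hbp (hanc v hv b hb)]
  have hlt : ∀ v, anc T r p v → qd T r p + 1 ≤ qd T' r v := by
    intro v hv
    rw [← hqd p (not_anc_self _ _)]
    exact qd_lt_of_anc hT' (by omega) (anc_of_below hT' h3 hv)
  obtain ⟨v₀, hv₀⟩ := hbelow
  have hqN : qd T r p + 1 ≤ N := (qd_lt_of_anc hT (by omega) hv₀).trans_le (qd_le_card T r v₀)
  set K := (2 * N) ^ (N - (qd T r p + 1)) with hK
  have hN0 : 0 < 2 * N := by omega
  have hKpos : 0 < K := Nat.pow_pos hN0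
  -- The unit of excess lost at `p` weighs `2 * N * K`. Everything below `p` has weight at most `K`
  -- per unit and fewer than `2 * N` units.
  have hpK : (2 * N) ^ (N - qd T r p) = 2 * N * K := by
    rw [hK, ← pow_succ']
    congr 1
    omega
  set B := Finset.univ.filter fun v => anc T r p v with hB
  set C := Finset.univ.filter fun v => ¬ anc T r p v with hC
  have hsplit : ∀ f : V → ℕ, ∑ v, f v = ∑ v ∈ B, f v + ∑ v ∈ C, f v := by
    intro f
    rw [hB, hC, Finset.sum_filter_add_sum_filter_not]
  have hpC : p ∈ C := by simp [hC, not_anc_self]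
  have hsB : ∑ v ∈ B, (dg T' v - 3) * (2 * N) ^ (N - qd T' r v) < 2 * N * K := by
    have : ∑ v ∈ B, (dg T' v - 3) * (2 * N) ^ (N - qd T' r v) ≤ ∑ v ∈ B, (dg T' v - 3) * K := by
      refine Finset.sum_le_sum fun v hv => Nat.mul_le_mul_left _ ?_
      simp only [hB, Finset.mem_filter, Finset.mem_univ, true_and] at hv
      have := hlt v hv
      exact Nat.pow_le_pow_right hN0 (by omega)
    rw [← Finset.sum_mul] at this
    refine this.trans_lt ?_
    exact Nat.mul_lt_mul_of_pos_right (sum_sub_three_lt hT' B) hKpos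
  have hsC : ∑ v ∈ C, (dg T' v - 3) * (2 * N) ^ (N - qd T' r v) + 2 * N * K =
      ∑ v ∈ C, (dg T v - 3) * (2 * N) ^ (N - qd T r v) := by
    rw [← Finset.add_sum_erase _ _ hpC, ← Finset.add_sum_erase _ _ hpC, hqd p (not_anc_self _ _),
      hpK]
    have : ∑ v ∈ C.erase p, (dg T' v - 3) * (2 * N) ^ (N - qd T' r v) =
        ∑ v ∈ C.erase p, (dg T v - 3) * (2 * N) ^ (N - qd T r v) := by
      refine Finset.sum_congr rfl fun v hv => ?_
      rw [Finset.mem_erase, hC, Finset.mem_filter] at hv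
      rw [hqd v hv.2.2, h1 v hv.1 hv.2.2]
    rw [this]
    have e : dg T p - 3 = (dg T' p - 3) + 1 := by omega
    rw [e]
    ring
  unfold om
  rw [← hN, hsplit, hsplit, ← hsC]
  omega

end Below

/-- A spanning tree with the fewest branch vertices and, among those that branch at `r`, with the
smallest potentials. -/
structure Opt (G T : SimpleGraph V) (r : V) : Prop where
  le : T ≤ G
  tree : T.IsTree
  root : 3 ≤ dg T r
  nb_le : ∀ T' ≤ G, T'.IsTree → nb T ≤ nb T'
  sq_le : ∀ T' ≤ G, T'.IsTree → 3 ≤ dg T' r → nb T' = nb T → sq T ≤ sq T'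
  om_le : ∀ T' ≤ G, T'.IsTree → 3 ≤ dg T' r → nb T' = nb T → sq T' = sq T → om T r ≤ om T' r
  zb_le : ∀ T' ≤ G, T'.IsTree → 3 ≤ dg T' r → nb T' = nb T → sq T' = sq T → om T' r = om T r →
    zb G T r ≤ zb G T' r

/-- By lexicographic minimality each inequality is an equality, once the earlier ones are known to
be equalities. -/
lemma Opt.of_le {r : V} (h : Opt G T r) (hle : T' ≤ G) (hT' : T'.IsTree) (hr : 3 ≤ dg T' r)
    (hnb : nb T' = nb T) (hsq : sq T' ≤ sq T) (hom : om T' r ≤ om T r)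
    (hzb : zb G T' r ≤ zb G T r) : Opt G T' r := by
  have e1 := hsq.antisymm (h.sq_le T' hle hT' hr hnb)
  have e2 := hom.antisymm (h.om_le T' hle hT' hr hnb e1)
  have e3 := hzb.antisymm (h.zb_le T' hle hT' hr hnb e1 e2)
  refine ⟨hle, hT', hr, ?_, ?_, ?_, ?_⟩
  · rw [hnb]; exact h.nb_le
  · rw [hnb, e1]; exact h.sq_le
  · rw [hnb, e1, e2]; exact h.om_le
  · rw [hnb, e1, e2, e3]; exact h.zb_le

lemma dg_mono {H K : SimpleGraph V} (h : H ≤ K) (v : V) : dg H v ≤ dg K v := by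
  refine Finset.card_le_card ?_
  intro w hw
  simp only [Finset.mem_filter, Finset.mem_univ, true_and] at hw ⊢
  exact h hw

lemma sq_mono {H K : SimpleGraph V} (h : H ≤ K) : sq H ≤ sq K := by
  refine Finset.sum_le_sum fun v _ => ?_
  have h1 := dg_mono h v
  have h2 := Nat.pow_le_pow_left h1 2
  split_ifs <;> omega

/-- A spanning tree of `H` branches only where `T` does, hence at the same vertices by minimality of
`nb`. In particular it branches at `r`, so the minimality of `sq` applies. Exchanges therefore need
only be connected, not acyclic. -/
lemma Opt.connected {r : V} (h : Opt G T r) {H : SimpleGraph V} (hle : H ≤ G) (hc : H.Connected)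
    (hd : ∀ v, dg T v ≤ 2 → dg H v ≤ 2) : (∀ v, 3 ≤ dg T v → 3 ≤ dg H v) ∧ sq T ≤ sq H := by
  obtain ⟨T', hle', hT'⟩ := hc.exists_isTree_le
  have hsub : (Finset.univ.filter fun v => 3 ≤ dg T' v) ⊆
      Finset.univ.filter fun v => 3 ≤ dg T v := by
    intro v
    simp only [Finset.mem_filter, Finset.mem_univ, true_and]
    intro hv
    by_contra hcon
    have := hd v (by omega)
    have := dg_mono hle' v
    omega
  have h1 := h.nb_le T' (hle'.trans hle) hT'
  have h2 := Finset.eq_of_subset_of_card_le hsub h1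
  have h3 : ∀ v, 3 ≤ dg T v → 3 ≤ dg T' v := by
    intro v hv
    have : v ∈ Finset.univ.filter fun v => 3 ≤ dg T' v := by
      rw [h2]
      simpa using hv
    simpa using this
  refine ⟨fun v hv => (h3 v hv).trans (dg_mono hle' v), ?_⟩
  refine (h.sq_le T' (hle'.trans hle) hT' (h3 r h.root) ?_).trans (sq_mono hle')
  unfold nb
  rw [h2]

/-- No modification turns a branch vertex `c` into a vertex of degree at most two without creating
a new branch vertex. -/
lemma Opt.not_surg_branch {r : V} (h : Opt G T r) (R A : List (V × V)) (c : V)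
    (hR : ∀ e ∈ R, T.Adj e.1 e.2) (hnd : (R.map fun e => s(e.1, e.2)).Nodup)
    (hA : ∀ e ∈ A, G.Adj e.1 e.2) (hc : 3 ≤ dg T c) (hdc : dg T c + cnt A c ≤ cnt R c + 2)
    (hd : ∀ v, dg T v ≤ 2 → dg T v + cnt A v ≤ cnt R v + 2)
    (hconn : ∀ κ : V → (surg T R A).ConnectedComponent, (∀ e ∈ A, κ e.1 = κ e.2) →
      (∀ u v, (∀ e ∈ R, (nx T e.2 u = e.1 ↔ nx T e.2 v = e.1)) → κ u = κ v) →
      ∀ e ∈ R, κ e.1 = κ e.2) : False := by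
  have hdg := fun v => dg_surg (T := T) (A := A) hR hnd v
  have h1 := (h.connected (surg_le h.le hA) (surg_connected h.tree hconn) (by
    intro v hv
    have e := hdg v
    have := hd v hv
    omega)).1 c hc
  have := hdg c
  omega

/-- No modification lowers a branch vertex `c` by much while raising at most two cubic vertices by
little, all other vertices keeping their degree or staying below three. -/
lemma Opt.not_surg {r : V} (h : Opt G T r) (R A : List (V × V)) (x x' c : V) (a a' b : ℕ)
    (hR : ∀ e ∈ R, T.Adj e.1 e.2) (hnd : (R.map fun e => s(e.1, e.2)).Nodup)
    (hA : ∀ e ∈ A, G.Adj e.1 e.2)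
    (hc : 3 ≤ dg T c) (hx : dg T x = 3) (hx' : dg T x' = 3) (hxc : x ≠ c) (hxc' : x' ≠ c)
    (hdx : cnt A x ≤ cnt R x + a) (hdx' : x' ≠ x → cnt A x' ≤ cnt R x' + a') (hdc : cnt A c + b ≤ cnt R c)
    (hab : dg T c ≤ b + 2 ∨
      (3 + a) ^ 2 + (3 + a') ^ 2 + (dg T c - b) ^ 2 < 18 + dg T c ^ 2)
    (hd : ∀ v, v ≠ x → v ≠ x' → v ≠ c → cnt A v ≤ cnt R v ∨ dg T v + cnt A v ≤ cnt R v + 2)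
    (hconn : ∀ κ : V → (surg T R A).ConnectedComponent, (∀ e ∈ A, κ e.1 = κ e.2) →
      (∀ u v, (∀ e ∈ R, (nx T e.2 u = e.1 ↔ nx T e.2 v = e.1)) → κ u = κ v) →
      ∀ e ∈ R, κ e.1 = κ e.2) : False := by
  have hdg := fun v => dg_surg (T := T) (A := A) hR hnd v
  obtain ⟨h1, h2⟩ := h.connected (surg_le h.le hA) (surg_connected h.tree hconn) (by
    intro v hv
    have e := hdg v
    by_cases e1 : v = x
    · subst e1; omega
    by_cases e2 : v = x'
    · subst e2
      have := hdx' e1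
      omega
    by_cases e3 : v = c
    · subst e3; omega
    rcases hd v e1 e2 e3 with e4 | e4 <;> omega)
  have hc1 := h1 c hc
  have hc2 := hdg c
  rcases hab with hab | hab
  · omega
  have key : sq (surg T R A) + (18 + dg T c ^ 2) ≤
      sq T + ((3 + a) ^ 2 + (3 + a') ^ 2 + (dg T c - b) ^ 2) := by
    -- The two nines are the contributions of the cubic vertices. If `x = x'`, both are counted at
    -- the same vertex, and taking `a' = 0` makes the second one neutral.
    have e1 : 18 + dg T c ^ 2 = ∑ v, ((if v = x then 9 else 0) + (if v = x' then 9 else 0) +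
        (if v = c then dg T c ^ 2 else 0)) := by
      simp [Finset.sum_add_distrib]
    have e2 : (3 + a) ^ 2 + (3 + a') ^ 2 + (dg T c - b) ^ 2 =
        ∑ v, ((if v = x then (3 + a) ^ 2 else 0) + (if v = x' then (3 + a') ^ 2 else 0) +
        (if v = c then (dg T c - b) ^ 2 else 0)) := by
      simp [Finset.sum_add_distrib]
    unfold sq
    rw [e1, e2, ← Finset.sum_add_distrib, ← Finset.sum_add_distrib]
    refine Finset.sum_le_sum fun v _ => ?_
    have e := hdg v
    have ha : 9 ≤ (3 + a) ^ 2 := Nat.pow_le_pow_left (Nat.le_add_right 3 a) 2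
    have ha' : 9 ≤ (3 + a') ^ 2 := Nat.pow_le_pow_left (Nat.le_add_right 3 a') 2
    by_cases e3 : v = c
    · subst e3
      simp only [if_neg hxc.symm, if_neg hxc'.symm, if_true, hc, hc1]
      have := Nat.pow_le_pow_left (show dg (surg T R A) v ≤ dg T v - b by omega) 2
      omega
    simp only [if_neg e3]
    by_cases d1 : v = x
    · subst d1
      simp only [if_true, hx, le_refl]
      have h3 := Nat.pow_le_pow_left (show dg (surg T R A) v ≤ 3 + a by omega) 2
      by_cases d2 : v = x'
      · subst d2
        simp only [if_true]
        split_ifs <;> omega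
      · simp only [if_neg d2]
        split_ifs <;> omega
    · by_cases d2 : v = x'
      · subst d2
        simp only [if_neg d1, if_true, hx', le_refl]
        have := hdx' d1
        have h3 := Nat.pow_le_pow_left (show dg (surg T R A) v ≤ 3 + a' by omega) 2
        split_ifs <;> omega
      · simp only [if_neg d1, if_neg d2]
        rcases hd v d1 d2 e3 with e4 | e4
        · have := Nat.pow_le_pow_left (show dg (surg T R A) v ≤ dg T v by omega) 2
          split_ifs <;> omega
        · split_ifs <;> omega
  omega

/-- No modification below a branch vertex `p` moves degree from `p` to a cubic vertex `x`. -/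
lemma Opt.not_surg_below {r : V} (h : Opt G T r) (R A : List (V × V)) (x p : V)
    (hR : ∀ e ∈ R, T.Adj e.1 e.2) (hnd : (R.map fun e => s(e.1, e.2)).Nodup)
    (hA : ∀ e ∈ A, G.Adj e.1 e.2) (hl : A.length = R.length)
    (hp : 3 ≤ dg T p) (hx : dg T x = 3) (hpx : anc T r p x)
    (hbR : ∀ e ∈ R, (anc T r p e.1 ∨ e.1 = p) ∧ (anc T r p e.2 ∨ e.2 = p))
    (hbA : ∀ e ∈ A, (anc T r p e.1 ∨ e.1 = p) ∧ (anc T r p e.2 ∨ e.2 = p))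
    (hdx : cnt A x ≤ cnt R x + 1) (hdp : cnt A p + 1 = cnt R p)
    (hd : ∀ v, v ≠ x → v ≠ p → cnt A v ≤ cnt R v ∨ dg T v + cnt A v ≤ cnt R v + 2)
    (hconn : ∀ κ : V → (surg T R A).ConnectedComponent, (∀ e ∈ A, κ e.1 = κ e.2) →
      (∀ u v, (∀ e ∈ R, (nx T e.2 u = e.1 ↔ nx T e.2 v = e.1)) → κ u = κ v) →
      ∀ e ∈ R, κ e.1 = κ e.2) : False := by
  have hxp : x ≠ p := hpx.1.symm
  -- From degree four, degrees `4, 3` become `3, 4` and `sq` cannot decide, so `om` must. At degree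
  -- three `p` stops branching, and from five on the squares drop.
  by_cases h4 : dg T p = 4
  · obtain ⟨hT', hdg⟩ := surg_isTree h.tree hR hnd hl (surg_connected h.tree hconn)
    have hle := surg_le h.le hA (R := R)
    have hp3 : dg (surg T R A) p = 3 := by
      have := hdg p
      omega
    have hx4 : dg (surg T R A) x ≤ 4 := by
      have := hdg x
      omega
    have hother : ∀ v, v ≠ x → v ≠ p → (dg (surg T R A) v ≤ dg T v ∨ dg (surg T R A) v ≤ 2) := by
      intro v h1 h2
      have := hdg v
      rcases hd v h1 h2 with h3 | h3 <;> omega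
    have hsub : ∀ v, 3 ≤ dg (surg T R A) v → 3 ≤ dg T v := by
      intro v hv
      by_cases h1 : v = x
      · subst h1; omega
      by_cases h2 : v = p
      · subst h2; omega
      rcases hother v h1 h2 with h3 | h3 <;> omega
    obtain ⟨hsup, hsq'⟩ := h.connected hle hT'.1 fun v hv => by
      by_contra hcon
      have := hsub v (by omega)
      omega
    have hbr : ∀ v, 3 ≤ dg (surg T R A) v ↔ 3 ≤ dg T v := fun v => ⟨hsub v, hsup v⟩
    have hsq : sq (surg T R A) ≤ sq T := by
      have key : sq (surg T R A) + 25 ≤ sq T + 25 := by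
        have e1 : 25 = ∑ v : V, ((if v = x then 9 else 0) + (if v = p then 16 else 0)) := by
          simp [Finset.sum_add_distrib]
        have e2 : 25 = ∑ v : V, ((if v = x then 16 else 0) + (if v = p then 9 else 0)) := by
          simp [Finset.sum_add_distrib]
        conv_lhs => rw [e1]
        conv_rhs => rw [e2]
        unfold sq
        rw [← Finset.sum_add_distrib, ← Finset.sum_add_distrib]
        refine Finset.sum_le_sum fun v _ => ?_
        by_cases h1 : v = x
        · subst h1
          have := Nat.pow_le_pow_left hx4 2
          simp only [hx, if_true, if_neg hxp]
          split_ifs <;> omega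
        by_cases h2 : v = p
        · subst h2
          simp [h4, hp3, h1]
        simp only [if_neg h1, if_neg h2]
        rcases hother v h1 h2 with h3 | h3
        · have := Nat.pow_le_pow_left h3 2
          split_ifs <;> omega
        · rw [if_neg (by omega)]
          omega
      omega
    have hom := h.om_le _ hle hT' ((hbr r).2 h.root) (by unfold nb; simp only [hbr])
      (hsq.antisymm hsq')
    refine absurd hom (not_le.2 ?_)
    refine om_lt h.tree hT' (p := p) (by omega) (by omega) ⟨x, hpx⟩ ?_ ?_ ?_
    · intro v hv hav
      have hz : ∀ l : List (V × V), (∀ e ∈ l, (anc T r p e.1 ∨ e.1 = p) ∧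
          (anc T r p e.2 ∨ e.2 = p)) → cnt l v = 0 := by
        intro l hl
        induction l with
        | nil => simp
        | cons e l ih =>
          simp only [List.mem_cons, forall_eq_or_imp] at hl
          rw [cnt_cons, ih hl.2, if_neg, if_neg]
          · rintro rfl
            tauto
          · rintro rfl
            tauto
      have := hdg v
      rw [hz R hbR, hz A hbA] at this
      omega
    · intro v w hv hw hvw
      rw [surg_adj]
      refine Or.inl ⟨hvw, fun e he => ?_⟩
      have h1 := hbR e he
      have h2 := (hR e he).ne
      constructor <;> rintro ⟨rfl, rfl⟩ <;> simp_all
    · intro v w hv hw hvw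
      rcases surg_adj.1 hvw with h1 | ⟨e, he, -, ⟨rfl, rfl⟩ | ⟨rfl, rfl⟩⟩
      · exact anc_adj h.tree hv hw h1.1
      · exact (hbA e he).2.resolve_left hw
      · exact (hbA e he).1.resolve_left hw
  · refine h.not_surg R A x x p 1 0 1 hR hnd hA hp hx hx hxp hxp hdx (absurd rfl) hdp.le ?_ ?_
      hconn
    · by_cases h3 : dg T p = 3
      · exact Or.inl h3.le
      · right
        obtain ⟨q, hq⟩ : ∃ q, dg T p = q + 5 := ⟨dg T p - 5, by omega⟩
        rw [hq, show q + 5 - 1 = q + 4 by omega]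
        nlinarith
    · exact fun v h1 _ h2 => hd v h1 h2

end Potential

/-! ### Cubic vertices against leaves -/

variable {V : Type*} [Fintype V] {G T T' : SimpleGraph V}

/-- A cubic vertex is not adjacent to a leaf in the direction of one of its children. -/
lemma Opt.not_adj_leaf_child {r x u : V} (h : Opt G T r) (hgood : ¬ Bad G T r x)
    (hx : dg T x = 3) (hxr : x ≠ r) (hu : dg T u = 1) (hk : nx T x u ≠ nx T x r) :
    ¬ G.Adj x u := by
  intro hxu
  have hd := nx_adj h.tree hxu.ne
  obtain ⟨w, hw, hdw⟩ : ∃ w, T.Adj x w ∧ G.Adj (nx T x u) w := by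
    by_contra hcon
    push Not at hcon
    exact hgood ⟨hx, hxr, _, hd, hk, hcon⟩
  generalize hde : nx T x u = d at *
  have hud : u ≠ w := by
    rintro rfl
    rw [nx_self_adj h.tree hw] at hde
    exact hdw.ne hde.symm
  by_cases hT : T.Adj x u
  · rw [nx_self_adj h.tree hT] at hde
    subst hde
    refine h.not_surg_branch [(w, x)] [(u, w)] x ?_ ?_ ?_ ?_ ?_ ?_ ?_
    · simp [hw.symm]
    · simp
    · simp [hdw]
    · omega
    · simp [hx, hxu.ne, hw.ne]
    · intro v hv
      simp
      grind
    · intro κ hA hS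
      have := hS u x (by simp [nx_self_adj h.tree hT, hdw.ne, hw.ne])
      simp at hA ⊢
      grind
  · have hdu : d ≠ u := by
      rintro rfl
      exact hT hd
    -- Because `dw` is an edge of `G`, `x` can give up both `d` and `w` for the single edge to `u`.
    refine h.not_surg_branch [(d, x), (w, x)] [(x, u), (d, w)] x ?_ ?_ ?_ ?_ ?_ ?_ ?_
    · simp [hw.symm, hd.symm]
    · simp [hdw.ne, hd.ne']
    · simp [hdw, hxu]
    · omega
    · simp [hx, hxu.ne, hw.ne, hd.ne]
    · intro v hv
      simp
      grind
    · intro κ hA hS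
      have := hS d u (by simp [nx_self_adj h.tree hd, hde])
      simp at hA ⊢
      grind


lemma nx_swap (hT : T.IsTree) {y z u : V} (h : T.Adj y z) : nx T y u = z ↔ nx T z u ≠ y := by
  rw [← side_iff hT h.symm, Ne, ← side_iff hT h, side_swap hT h]

lemma anc_nx (hT : T.IsTree) {r p v : V} (h : anc T r p v) : anc T r p (nx T p v) := by
  have h1 := nx_adj hT h.1
  exact ⟨h1.ne, by rw [nx_self_adj hT h1]; exact h.2⟩

/-- From a vertex neither equal to `p` nor below it, everything below `p` is seen in the direction
of `p`. -/
lemma anc_of_between (hT : T.IsTree) {r p x u y : V} (hx : anc T r p x) (hu : anc T r p u)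
    (hy : nx T y x ≠ nx T y u) : anc T r p y ∨ y = p := by
  by_contra hcon
  simp only [not_or] at hcon
  have h1 : nx T p y = nx T p r := by
    by_contra h1
    exact hcon.1 ⟨Ne.symm hcon.2, h1⟩
  exact hy ((nx_through hT (Ne.symm hcon.2) (by rw [h1]; exact hx.2)).trans
    (nx_through hT (Ne.symm hcon.2) (by rw [h1]; exact hu.2)).symm)

/-- Two vertices below the root that do not lie below each other branch off from a common
ancestor. -/
lemma exists_junction_below (hT : T.IsTree) {r x u : V} (hr : 3 ≤ dg T r) (hxu : x ≠ u)
    (hx : x ≠ r) (hu : u ≠ r) (h1 : nx T x u = nx T x r) (h2 : nx T u x = nx T u r) :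
    ∃ p, 3 ≤ dg T p ∧ anc T r p x ∧ anc T r p u ∧ nx T p x ≠ nx T p u := by
  obtain ⟨p, e1, e2, e3⟩ := exists_junction hT r x u
  have hpx : p ≠ x := by
    rintro rfl
    exact e2 hx hxu h1.symm
  have hpu : p ≠ u := by
    rintro rfl
    exact e1 hu hxu.symm h2.symm
  by_cases hpr : p = r
  · subst hpr
    refine ⟨p, hr, ⟨hpx, ?_⟩, ⟨hpu, ?_⟩, e3 hpx hpu⟩
    · rw [nx_self]
      exact nx_ne_self hT hpx
    · rw [nx_self]
      exact nx_ne_self hT hpu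
  · exact ⟨p, three_le_dg (nx_adj hT hpr) (nx_adj hT hpx) (nx_adj hT hpu) (e1 hpr hpx)
      (e2 hpr hpu) (e3 hpx hpu), ⟨hpx, (e1 hpr hpx).symm⟩, ⟨hpu, (e2 hpr hpu).symm⟩, e3 hpx hpu⟩

/-- If a branch vertex lost degree and no degree rose above `max 2` of its old value, `sq` would
decrease. -/
lemma Opt.reduced {r : V} (h : Opt G T r) : Reduced G T := by
  refine ⟨h.le, h.tree, ⟨r, h.root⟩, fun T' hle hT' hdg v hv => ?_⟩
  obtain ⟨-, h2⟩ := h.connected hle hT'.1 fun v hv => by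
    have := hdg v
    omega
  by_contra hcon
  refine absurd h2 (not_le.2 (Finset.sum_lt_sum (fun w _ => ?_) ⟨v, Finset.mem_univ v, ?_⟩))
  · have h3 := hdg w
    by_cases h4 : 3 ≤ dg T' w
    · rw [if_pos h4, if_pos (by omega)]
      exact Nat.pow_le_pow_left (by omega) 2
    · rw [if_neg h4]
      exact Nat.zero_le _
  · rw [if_pos hv]
    have := Nat.pow_lt_pow_left (show dg T' v < dg T v by omega) two_ne_zero
    split_ifs <;> omega

/-- A cubic vertex is not adjacent to a leaf. -/
lemma Opt.not_adj_leaf {r x u : V} (h : Opt G T r) (hgood : ¬ Bad G T r x)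
    (hx : dg T x = 3) (hxr : x ≠ r) (hu : dg T u = 1) : ¬ G.Adj x u := by
  by_cases hk : nx T x u ≠ nx T x r
  · exact h.not_adj_leaf_child hgood hx hxr hu hk
  intro hxu
  have hur : u ≠ r := ne_of_dg (T := T) (by have := h.root; omega)
  push Not at hk
  obtain ⟨p, hp, hpx, hpu, hne⟩ := exists_junction_below h.tree h.root hxu.ne hxr hur hk
    (eq_of_dg_one hu (nx_adj h.tree hxu.ne') (nx_adj h.tree hur))
  have ha := nx_adj h.tree hpx.1
  have hpx' := hpx.1
  have hpu' := hpu.1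
  -- The part of the tree containing `x` is detached from `p` and hung on `u`, which moves one
  -- degree from `p` down to `x`.
  refine h.not_surg_below [(nx T p x, p)] [(x, u)] x p ?_ ?_ ?_ rfl hp hx hpx ?_ ?_ ?_ ?_ ?_ ?_
  · simp [ha.symm]
  · simp
  · simp [hxu]
  · simp [anc_nx h.tree hpx]
  · simp [hpx, hpu]
  · simp [hxu.ne]
  · simp [ha.ne, hpx.1, hpu.1]
  · intro v hv
    simp
    grind
  · intro κ hA hS
    have := hS (nx T p x) x (by simp [nx_self_adj h.tree ha])
    have := hS p u (by simp [hne.symm, ha.ne])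
    simp at hA ⊢
    grind

/-- No tree edge is oblique to a cubic vertex at one end and to a leaf at the other end. -/
lemma Opt.oblique_leaf_opposite {r x u y z : V} (h : Opt G T r) (hgood : ¬ Bad G T r x)
    (hx : dg T x = 3) (hxr : x ≠ r) (hu : dg T u = 1) (hyz : T.Adj y z) (hxy : G.Adj x y)
    (huz : G.Adj u z) (hz : nx T y x = z) (hy : nx T z u = y) : False := by
  have hT := h.tree
  have hxu := h.not_adj_leaf hgood hx hxr hu
  have hur : u ≠ r := ne_of_dg (T := T) (by have := h.root; omega)
  have hzx : z ≠ x := by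
    rintro rfl
    exact hxu huz.symm
  have hyu : y ≠ u := by
    rintro rfl
    exact hxu hxy
  have hxu' : x ≠ u := ne_of_dg (T := T) (by omega)
  have hzu : ¬ T.Adj u z := fun e => hyu (by rw [← hy, nx_self_adj hT e.symm])
  have hy2 : dg T y = 2 := by
    have := (h.reduced.attach hu huz hzu).1
    rwa [hy] at this
  have hyx := hxy.ne'
  have e1 : nx T y u ≠ z := by
    rw [Ne, nx_swap hT hyz]
    exact fun e => e hy
  have e2 : nx T z x ≠ y := (nx_swap hT hyz).1 hz
  have e3 : nx T x u = nx T x y := nx_through hT hyx (by rw [hz]; exact e1)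
  have e4 : nx T x z = nx T x y := nx_congr_adj hT hyz.symm hzx.symm hyx.symm
  have hd := nx_adj hT hxy.ne
  have hdy : nx T x y ≠ y := by
    intro e
    rw [e] at hd
    exact hzx (by rw [← hz, nx_self_adj hT hd.symm])
  have e5 : nx T y (nx T x y) = z := by
    rw [← nx_congr_adj hT hd hyx hdy.symm, hz]
  by_cases hk : nx T x y ≠ nx T x r
  · obtain ⟨w, hw, hdw⟩ : ∃ w, T.Adj x w ∧ G.Adj (nx T x y) w := by
      by_contra hcon
      push Not at hcon
      exact hgood ⟨hx, hxr, _, hd, hk, hcon⟩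
    have hdw' := hdw.ne
    generalize hde : nx T x y = d at *
    refine h.not_surg_branch [(z, y), (d, x), (w, x)] [(u, z), (x, y), (d, w)] x
      ?_ ?_ ?_ ?_ ?_ ?_ ?_
    · simp [hw.symm, hd.symm, hyz.symm]
    · simp
      grind
    · simp [hdw, hxy, huz]
    · omega
    · simp [hx, hzx.symm, hyx.symm, hw.ne, hd.ne, hxu']
    · intro v hv
      simp
      grind
    · intro κ hA hS
      have := hS u y (by simp [e1, hyz.ne, e3, hde])
      have := hS d z (by simp [e5, nx_self_adj hT hyz, nx_self_adj hT hd, e4])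
      simp at hA ⊢
      grind
  · push Not at hk
    obtain ⟨p, hp, hpx, hpu, hne⟩ := exists_junction_below h.tree h.root hxu' hxr hur
      (e3.trans hk) (eq_of_dg_one hu (nx_adj h.tree hxu'.symm) (nx_adj h.tree hur))
    have ha := nx_adj h.tree hpx.1
    have hpx' := hpx.1
    have hpu' := hpu.1
    have hpy : p ≠ y := ne_of_dg (T := T) (by omega)
    have by1 := anc_of_between hT hpx hpu (y := y) (by rw [hz]; exact e1.symm)
    have by2 := anc_of_between hT hpx hpu (y := z) (by rw [hy]; exact e2)
    have e6 : z = p → nx T p x ≠ y := by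
      rintro rfl
      exact e2
    refine h.not_surg_below [(z, y), (nx T p x, p)] [(u, z), (x, y)] x p
      ?_ ?_ ?_ rfl hp hx hpx ?_ ?_ ?_ ?_ ?_ ?_
    · simp [hyz.symm, ha.symm]
    · simp
      grind
    · simp [huz, hxy]
    · simp [anc_nx h.tree hpx, by1, by2]
    · simp [hpx, hpu, by1, by2]
    · simp [hxu', hyx.symm, hzx.symm]
    · simp [ha.ne, hpx.1, hpu.1, hpy]
    · intro v hv
      simp
      grind
    · intro κ hA hS
      -- The reconnection depends on the side of `yz` that contains `p`.
      by_cases hc : nx T y p = z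
      · have hpy' : y ≠ nx T p x := by
          intro e
          have h1 := ha
          rw [← e] at h1
          rw [nx_self_adj hT h1.symm] at hc
          exact e6 hc.symm e.symm
        have f1 : nx T p u = nx T p y := nx_through hT hpy.symm (by rw [hc]; exact e1)
        have f2 : nx T p z ≠ nx T p x := by
          by_cases hzp : z = p
          · rw [hzp, nx_self]
            exact ha.ne
          · rw [← nx_congr_adj hT hyz hpy (Ne.symm hzp), ← f1]
            exact hne.symm
        have := hS (nx T p x) x (by
          simp [nx_self_adj hT ha, hz, ← nx_congr_adj hT ha hpy.symm hpy', hc])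
        have := hS p z (by simp [hc, nx_self_adj hT hyz, f2, ha.ne])
        have := hS y u (by simp [e1, ← f1, hne.symm, hyz.ne])
        simp at hA ⊢
        grind
      · have hzp : p ≠ z := by
          rintro rfl
          exact hc (nx_self_adj hT hyz)
        have f1 : nx T p x = nx T p y := nx_through hT hpy.symm (by rw [hz]; exact Ne.symm hc)
        have f2 : nx T p z = nx T p x := by rw [f1, nx_congr_adj hT hyz hpy hzp]
        have f3 : nx T y (nx T p x) ≠ z := by
          by_cases e : y = nx T p x
          · rw [← e, nx_self]
            exact hyz.ne
          · rwa [← nx_congr_adj hT ha hpy.symm e]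
        have := hS x z (by simp [hz, nx_self_adj hT hyz, f2])
        have := hS (nx T p x) y (by simp [f3, nx_self_adj hT ha, ← f1, hyz.ne])
        have := hS p u (by simp [hc, e1, ha.ne, hne.symm])
        simp at hA ⊢
        grind

/-! ### Ancestors and weighted excess under a change of tree -/

section Contract

variable {V : Type*} [Fintype V] {G T T' : SimpleGraph V}

/-- If a map sends edges away from `b'` to pairs in the same direction from `b`, then it sends pairs
in the same direction from `b'` to pairs in the same direction from `b`. -/
lemma nx_eq_of_contract (hT' : T'.IsTree) {b b' : V} (f : V → V)
    (hf : ∀ c d, T'.Adj c d → c ≠ b' → d ≠ b' → nx T b (f c) = nx T b (f d)) {v w : V}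
    (hv : v ≠ b') (hw : w ≠ b') (h : nx T' b' v = nx T' b' w) :
    nx T b (f v) = nx T b (f w) := by
  have key : ∀ n v, T'.dist v b' = n → v ≠ b' → nx T b (f v) = nx T b (f (nx T' b' v)) := by
    intro n
    induction n with
    | zero =>
      intro v hn hv
      rw [hT'.1.dist_eq_zero_iff] at hn
      exact absurd hn hv
    | succ n ih =>
      intro v hn hv
      have h1 := nx_adj hT' hv
      have h2 := nx_dist hT' hv
      by_cases hb : nx T' v b' = b'
      · rw [hb] at h1
        rw [nx_self_adj hT' h1.symm]
      · rw [nx_congr_adj hT' h1 hv.symm (Ne.symm hb), ← ih _ (by omega) hb]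
        exact hf _ _ h1 hv hb
  rw [key _ v rfl hv, key _ w rfl hw, h]

/-- If `b'` did not separate `v'` from the root in `T'`, their images under `f` would lie in the
same direction from `b` in `T`. -/
lemma anc_of_contract (hT' : T'.IsTree) {r b b' v v' : V} (f : V → V)
    (hf : ∀ c d, T'.Adj c d → c ≠ b' → d ≠ b' → nx T b (f c) = nx T b (f d))
    (hbv : b' ≠ v') (hfr : nx T b (f r) = nx T b r) (hfv : nx T b (f v') = nx T b v)
    (h : anc T r b v) : anc T' r b' v' := by
  refine ⟨hbv, fun he => ?_⟩
  by_cases hr : r = b'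
  · subst hr
    rw [nx_self] at he
    exact nx_ne_self hT' hbv he
  · refine h.2 ?_
    rw [← hfr, ← hfv]
    exact nx_eq_of_contract hT' f hf hbv.symm hr he

/-- Branch ancestors pull back along `σ`, so at corresponding branch vertices `qd` can only grow and
the weight can only shrink. -/
lemma om_le_of_anc (r : V) (σ : V ≃ V) (hdeg : ∀ v, dg T' v - 3 = dg T (σ v) - 3)
    (hbr : ∀ v, 3 ≤ dg T' v ↔ 3 ≤ dg T (σ v))
    (hanc : ∀ b v, 3 ≤ dg T' b → 3 ≤ dg T' v → b ≠ v → anc T r (σ b) (σ v) → anc T' r b v) :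
    om T' r ≤ om T r := by
  unfold om
  rw [← Equiv.sum_comp σ fun v =>
    (dg T v - 3) * (2 * Fintype.card V) ^ (Fintype.card V - qd T r v)]
  refine Finset.sum_le_sum fun v _ => ?_
  rw [hdeg]
  by_cases hv : 3 ≤ dg T' v
  · refine Nat.mul_le_mul_left _ (Nat.pow_le_pow_right ?_ ?_)
    · have : 0 < Fintype.card V := Fintype.card_pos_iff.2 ⟨v⟩
      omega
    · refine Nat.sub_le_sub_left ?_ _
      refine Finset.card_le_card_of_injOn σ.symm ?_ σ.symm.injective.injOn
      intro b hb
      simp only [Finset.coe_filter, Finset.mem_univ, true_and, Set.mem_ofPred_eq] at hb ⊢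
      have h1 : 3 ≤ dg T' (σ.symm b) := by
        rw [hbr]
        simpa using hb.1
      refine ⟨h1, hanc _ _ h1 hv ?_ (by simpa using hb.2)⟩
      rintro rfl
      simp [not_anc_self] at hb
  · rw [hbr] at hv
    rw [show dg T (σ v) - 3 = 0 by omega, zero_mul, zero_mul]

end Contract

/-! ### Pushing bad cubic vertices towards the root -/

section Push

variable {V : Type*} [Fintype V] {G T T' : SimpleGraph V}

lemma exists_third (T : SimpleGraph V) {x a v : V} (hx : dg T x = 3) (ha : T.Adj x a)
    (hv : T.Adj x v) (hav : a ≠ v) :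
    ∃ b, T.Adj x b ∧ b ≠ a ∧ b ≠ v ∧ ∀ c, T.Adj x c → c = a ∨ c = v ∨ c = b := by
  have h1 : ({a, v} : Finset V) ⊆ Finset.univ.filter (T.Adj x) := by
    intro w
    simp only [Finset.mem_insert, Finset.mem_singleton, Finset.mem_filter, Finset.mem_univ,
      true_and]
    rintro (rfl | rfl) <;> assumption
  have h2 : (Finset.univ.filter (T.Adj x) \ {a, v}).card = 1 := by
    rw [Finset.card_sdiff_of_subset h1, Finset.card_pair hav]
    unfold dg at hx
    omega
  rw [Finset.card_eq_one] at h2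
  obtain ⟨b, hb⟩ := h2
  have h3 : ∀ c, c ∈ Finset.univ.filter (T.Adj x) \ {a, v} ↔ c = b := by
    intro c
    rw [hb, Finset.mem_singleton]
  simp only [Finset.mem_sdiff, Finset.mem_filter, Finset.mem_univ, true_and, Finset.mem_insert,
    Finset.mem_singleton, not_or] at h3
  have h4 := (h3 b).2 rfl
  refine ⟨b, h4.1, h4.2.1, h4.2.2, fun c hc => ?_⟩
  have := h3 c
  tauto

lemma exists_second (T : SimpleGraph V) {y z : V} (hy : dg T y = 2) (hz : T.Adj y z) :
    ∃ b, T.Adj y b ∧ b ≠ z ∧ ∀ c, T.Adj y c → c = z ∨ c = b := by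
  have h1 : ({z} : Finset V) ⊆ Finset.univ.filter (T.Adj y) := by simpa using hz
  have h2 : (Finset.univ.filter (T.Adj y) \ {z}).card = 1 := by
    rw [Finset.card_sdiff_of_subset h1, Finset.card_singleton]
    unfold dg at hy
    omega
  rw [Finset.card_eq_one] at h2
  obtain ⟨b, hb⟩ := h2
  have h3 : ∀ c, c ∈ Finset.univ.filter (T.Adj y) \ {z} ↔ c = b := by
    intro c
    rw [hb, Finset.mem_singleton]
  simp only [Finset.mem_sdiff, Finset.mem_filter, Finset.mem_univ, true_and,
    Finset.mem_singleton] at h3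
  have h4 := (h3 b).2 rfl
  refine ⟨b, h4.1, h4.2, fun c hc => ?_⟩
  have := h3 c
  tauto

lemma nx_ne_leaf (hT : T.IsTree) {u v w : V} (hu : dg T u = 1) (hwu : T.Adj w u) (hv : v ≠ u) :
    nx T w v ≠ u := by
  intro e
  have hwv : w ≠ v := by
    rintro rfl
    rw [nx_self] at e
    exact hwu.ne e
  have h1 := nx_dist hT hwv
  have h2 := nx_adj hT hv.symm
  have h3 := nx_dist hT hv.symm
  rw [e] at h1
  rw [eq_of_dg_one hu h2 hwu.symm] at h3
  omega

lemma exists_ne_of_dg (T : SimpleGraph V) (y : V) (s : Finset V) (h : s.card < dg T y) :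
    ∃ w, T.Adj y w ∧ w ∉ s := by
  by_contra! hcon
  refine absurd (Finset.card_le_card (?_ : Finset.univ.filter (T.Adj y) ⊆ s)) (not_le.2 h)
  intro w hw
  exact hcon w (by simpa using hw)

/-- Both quantities depend only on the multiset of degrees above two. -/
lemma sum_branch_comp {σ : V ≃ V} (h : ∀ v, dg T' v = dg T (σ v) ∨
    (dg T' v ≤ 2 ∧ dg T (σ v) ≤ 2)) : nb T' = nb T ∧ sq T' = sq T := by
  constructor
  · unfold nb
    rw [Finset.card_filter, Finset.card_filter, ← Equiv.sum_comp σ (fun v => if 3 ≤ dg T v then 1 else 0)]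
    refine Finset.sum_congr rfl fun v _ => ?_
    rcases h v with h | h
    · rw [h]
    · rw [if_neg (by omega), if_neg (by omega)]
  · unfold sq
    rw [← Equiv.sum_comp σ (fun v => if 3 ≤ dg T v then dg T v ^ 2 else 0)]
    refine Finset.sum_congr rfl fun v _ => ?_
    rcases h v with h | h
    · rw [h]
    · rw [if_neg (by omega), if_neg (by omega)]

/-- If `T` is optimal, then there are no bad cubic vertices. -/
lemma Opt.not_bad {r x : V} (h : Opt G T r) (hclaw : IsClawFree G) : ¬ Bad G T r x := by
  rintro hbad
  obtain ⟨hx, hxr, v, hv, hvp, hvn⟩ := id hbad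
  have hT := h.tree
  have ha := nx_adj hT hxr
  have har := nx_dist hT hxr
  have hroot := h.root
  obtain ⟨b, hb, hba, hbv, hall⟩ := exists_third T hx ha hv hvp.symm
  generalize hae : nx T x r = a at *
  -- The child `v` has no neighbour among `a`, `b`, so the claw at `x` is avoided only by `ab`.
  have hab : G.Adj a b := by
    rcases hclaw.adj_or (h.le ha) (h.le hv) (h.le hb) hvp.symm hba.symm hbv.symm with e | e | e
    · exact absurd e.symm (hvn a ha)
    · exact e
    · exact absurd e (hvn b hb)
  have nxa := nx_self_adj hT ha
  have nxb := nx_self_adj hT hb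
  have nxv := nx_self_adj hT hv
  have hxa := ha.ne
  have hxb := hb.ne
  have hxv := hv.ne
  -- If `a` branched already, replacing `bx` by `ab` would remove the branch vertex `x` without
  -- creating one.
  have ha2 : dg T a ≤ 2 := by
    by_contra hcon
    refine h.not_surg_branch [(b, x)] [(a, b)] x ?_ ?_ ?_ ?_ ?_ ?_ ?_
    · simp [hb.symm]
    · simp
    · simp [hab]
    · omega
    · simp [hx, ha.ne, hb.ne]
    · intro w hw
      simp
      grind
    · intro κ hA hS
      have := hS a x (by simp [nxa, hba.symm, hb.ne])
      simp at hA ⊢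
      grind
  have hb2 : dg T b ≤ 2 := by
    by_contra hcon
    refine h.not_surg_branch [(a, x)] [(a, b)] x ?_ ?_ ?_ ?_ ?_ ?_ ?_
    · simp [ha.symm]
    · simp
    · simp [hab]
    · omega
    · simp [hx, ha.ne, hb.ne]
    · intro w hw
      simp
      grind
    · intro κ hA hS
      have := hS b x (by simp [nxb, hba, ha.ne])
      simp at hA ⊢
      grind
  have har' : a ≠ r := ne_of_dg (T := T) (by omega)
  have haa := nx_adj hT har'
  have hax : nx T a r ≠ x := by
    intro e
    have := nx_dist hT har'
    rw [e] at this
    omega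
  have ha2' : dg T a = 2 := by
    have := two_le_dg ha.symm haa hax.symm
    omega
  obtain ⟨c₀, hc₀, hc₀x, hcall⟩ := exists_second T ha2' ha.symm
  have hc₀e : nx T a r = c₀ := (hcall _ haa).resolve_left hax
  have hR : ∀ e ∈ [(b, x)], T.Adj e.1 e.2 := by simp [hb.symm]
  -- Now the same exchange passes the branching from `x` up to its parent `a`, with equal `nb` and
  -- `sq`.
  obtain ⟨hT', hdg⟩ := surg_isTree hT (R := [(b, x)]) (A := [(a, b)]) hR (by simp) rfl
    (surg_connected hT (by
      intro κ hA hS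
      have := hS a x (by simp [nxa, hba.symm, hb.ne])
      simp at hA ⊢
      grind))
  have hle : surg T [(b, x)] [(a, b)] ≤ G := surg_le h.le (by simp [hab])
  have hadj : ∀ c d, (surg T [(b, x)] [(a, b)]).Adj c d ↔ (T.Adj c d ∧ ¬ (c = b ∧ d = x) ∧
      ¬ (c = x ∧ d = b)) ∨ (c = a ∧ d = b) ∨ (c = b ∧ d = a) := by
    intro c d
    rw [surg_adj]
    simp [hba.symm]
  generalize surg T [(b, x)] [(a, b)] = T' at *
  have hx2 : dg T' x = 2 := by
    have := hdg x
    simp [ha.ne, hb.ne] at this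
    omega
  have ha3 : dg T' a = 3 := by
    have := hdg a
    simp [ha.ne', hba.symm] at this
    omega
  have hoth : ∀ w, w ≠ a → w ≠ x → dg T' w = dg T w := by
    intro w h1 h2
    have := hdg w
    simp [h1, h2] at this
    omega
  have hσ : ∀ w, dg T' w = dg T (Equiv.swap a x w) ∨
      (dg T' w ≤ 2 ∧ dg T (Equiv.swap a x w) ≤ 2) := by
    intro w
    by_cases h1 : w = a
    · subst h1
      rw [Equiv.swap_apply_left]
      omega
    · by_cases h2 : w = x
      · subst h2
        rw [Equiv.swap_apply_right]
        omega
      · rw [Equiv.swap_apply_of_ne_of_ne h1 h2, hoth w h1 h2]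
        exact Or.inl rfl
  obtain ⟨hnb, hsq⟩ := sum_branch_comp hσ
  have hf : ∀ b₀, b₀ ≠ a → b₀ ≠ x → b₀ ≠ b → ∀ c d, T'.Adj c d → c ≠ b₀ → d ≠ b₀ →
      nx T b₀ (id c) = nx T b₀ (id d) := by
    intro b₀ h1 h2 h3 c d hcd hc hd
    have e : nx T b₀ a = nx T b₀ b :=
      (nx_congr_adj hT ha.symm h1 h2).trans (nx_congr_adj hT hb h2 h3)
    rcases (hadj c d).1 hcd with h4 | ⟨rfl, rfl⟩ | ⟨rfl, rfl⟩
    · exact nx_congr_adj hT h4.1 hc.symm hd.symm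
    · exact e
    · exact e.symm
  -- The new branch vertex `a` plays the role of `x`; the old `x`, now on the way from `a` to `v`,
  -- is represented by `v`.
  have hfa : ∀ c d, T'.Adj c d → c ≠ a → d ≠ a →
      nx T x ((fun w => if w = x then v else w) c) =
      nx T x ((fun w => if w = x then v else w) d) := by
    have key : ∀ d, T.Adj x d → d ≠ a → d ≠ b → d = v := by
      intro d h1 h2 h3
      rcases hall d h1 with h4 | h4 | h4
      · exact absurd h4 h2
      · exact h4
      · exact absurd h4 h3
    intro c d hcd hc hd
    rcases (hadj c d).1 hcd with h4 | h4 | h4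
    · by_cases h5 : c = x
      · subst h5
        have h6 : d = v := key d h4.1 hd (by tauto)
        subst h6
        simp [hv.ne']
      · by_cases h6 : d = x
        · subst h6
          have h6 : c = v := key c h4.1.symm hc (by tauto)
          subst h6
          simp [hv.ne']
        · simp only [if_neg h5, if_neg h6]
          exact nx_congr_adj hT h4.1 (Ne.symm h5) (Ne.symm h6)
    · exact absurd h4.1 hc
    · exact absurd h4.2 hd
  have hrx : r ≠ x := hxr.symm
  have hom : om T' r ≤ om T r := by
    refine om_le_of_anc r (Equiv.swap a x) (fun w => ?_) (fun w => ?_) ?_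
    · rcases hσ w with e | e <;> omega
    · rcases hσ w with e | e <;> omega
    · intro b₀ v₀ hb₀ hv₀ hne hanc
      have hv₀x : v₀ ≠ x := by
        rintro rfl
        omega
      have hb₀x : b₀ ≠ x := by
        rintro rfl
        omega
      by_cases hb₀a : b₀ = a
      · subst hb₀a
        rw [Equiv.swap_apply_left, Equiv.swap_apply_of_ne_of_ne hne.symm hv₀x] at hanc
        refine anc_of_contract hT' (fun w => if w = x then v else w) hfa hne ?_ ?_ hanc
        · simp [hrx]
        · simp [hv₀x]
      · rw [Equiv.swap_apply_of_ne_of_ne hb₀a hb₀x] at hanc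
        have hb₀b : b₀ ≠ b := by
          rintro rfl
          have := hoth b₀ hb₀a hb₀x
          omega
        refine anc_of_contract hT' id (hf b₀ hb₀a hb₀x hb₀b) hne rfl ?_ hanc
        by_cases h1 : v₀ = a
        · subst h1
          rw [Equiv.swap_apply_left]
          exact nx_congr_adj hT ha.symm hb₀a hb₀x
        · rw [Equiv.swap_apply_of_ne_of_ne h1 hv₀x]
          rfl
  have hr' : 3 ≤ dg T' r := by rwa [hoth r har'.symm hrx]
  have hom' := hom.antisymm (h.om_le T' hle hT' hr' hnb hsq)
  refine absurd (h.zb_le T' hle hT' hr' hnb hsq hom') (not_le.2 ?_)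
  refine Finset.card_lt_card ?_
  rw [Finset.ssubset_iff_of_subset]
  · refine ⟨x, by simpa using hbad, ?_⟩
    simp [Bad, hx2]
  intro w
  simp only [Finset.mem_filter, Finset.mem_univ, true_and]
  rintro ⟨hw, hwr, w₁, hw₁, hw₁p, hw₁n⟩
  have hwx : w ≠ x := by
    rintro rfl
    omega
  -- The vertex `a` is not bad: its children `x` and `b` are adjacent in `G`, and its third
  -- neighbour is its parent. Thus `x` stops being bad and nothing new becomes bad.
  have hwa : w ≠ a := by
    rintro rfl
    have hwx' : T'.Adj w x := by
      rw [hadj]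
      exact Or.inl ⟨ha.symm, by tauto, fun e => hxa e.1.symm⟩
    have hwb' : T'.Adj w b := by
      rw [hadj]
      simp
    rcases (hadj _ _).1 hw₁ with e | e | e
    · rcases hcall _ e.1 with rfl | rfl
      · exact hw₁n b hwb' (h.le hb)
      · apply hw₁p
        by_contra hne
        have hq := nx_adj hT' har'
        have hcon : nx T' w r = x ∨ nx T' w r = b := by
          rcases (hadj _ _).1 hq with e | e | e
          · rcases hcall _ e.1 with e | e
            · exact Or.inl e
            · exact absurd e.symm hne
          · exact Or.inr e.2
          · exact absurd e.1 hba.symm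
        rcases hcon with e | e
        · have := nx_eq_of_contract hT' (b := x) _ hfa (v := r) (w := x) har'.symm hxa
            (by rw [e, nx_self_adj hT' hwx'])
          simp only [if_neg hrx, if_true, hae, nxv] at this
          exact hvp this.symm
        · have := nx_eq_of_contract hT' (b := x) _ hfa (v := r) (w := b) har'.symm hba
            (by rw [e, nx_self_adj hT' hwb'])
          simp only [if_neg hrx, if_neg hxb.symm, hae, nxb] at this
          exact hba this.symm
    · rw [e.2] at hw₁n
      exact hw₁n x hwx' (h.le hb.symm)
    · exact hba.symm e.1
  have hw3 : dg T w = 3 := by rw [← hoth w hwa hwx, hw]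
  have hwb : w ≠ b := by
    rintro rfl
    omega
  have hadjw : ∀ q, T'.Adj w q ↔ T.Adj w q := by
    intro q
    rw [hadj]
    simp [hwa, hwb, hwx]
  refine ⟨hw3, hwr, w₁, (hadjw _).1 hw₁, ?_, fun w' hw' => hw₁n w' ((hadjw _).2 hw')⟩
  have hq := nx_adj hT' hwr
  have := nx_eq_of_contract hT' _ (hf w hwa hwx hwb) (v := nx T' w r) (w := r) hq.ne' hwr.symm
    (nx_self_adj hT' hq)
  simp only [id] at this
  rw [← this, nx_self_adj hT ((hadjw _).1 hq)]
  exact hw₁p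

end Push

/-! ### Exchanges that keep optimality, and the distance sum -/

section Neutral

variable {V : Type*} [Fintype V] {G T T' : SimpleGraph V}

/-- Vertices with the same parent and the same neighbours keep their badness. -/
lemma zb_le_of {r : V} (h : ∀ w, dg T' w = 3 → w ≠ r →
    dg T w = 3 ∧ (∀ q, T'.Adj w q ↔ T.Adj w q) ∧ nx T' w r = nx T w r) :
    zb G T' r ≤ zb G T r := by
  refine Finset.card_le_card ?_
  intro w
  simp only [Finset.mem_filter, Finset.mem_univ, true_and]
  rintro ⟨hw, hwr, w₁, hw₁, hw₁p, hw₁n⟩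
  obtain ⟨h1, h2, h3⟩ := h w hw hwr
  refine ⟨h1, hwr, w₁, (h2 _).1 hw₁, h3 ▸ hw₁p, fun w' hw' => hw₁n w' ((h2 _).2 hw')⟩

lemma nx_root_eq_of_contract (hT : T.IsTree) (hT' : T'.IsTree) {r w : V} (hwr : w ≠ r) (f : V → V)
    (hf : ∀ c d, T'.Adj c d → c ≠ w → d ≠ w → nx T w (f c) = nx T w (f d))
    (hadj : ∀ q, T'.Adj w q → T.Adj w q ∧ f q = q) (hfr : f r = r) : nx T' w r = nx T w r := by
  have hq := nx_adj hT' hwr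
  obtain ⟨h1, h2⟩ := hadj _ hq
  have := nx_eq_of_contract hT' f hf (v := nx T' w r) (w := r) hq.ne' hwr.symm
    (nx_self_adj hT' hq)
  rwa [h2, hfr, nx_self_adj hT h1] at this

/-- Moving a leg of the tree from `y` to a leaf `u` keeps optimality. -/
lemma Opt.move_leg {r u y y' : V} (h : Opt G T r) (hy : dg T y = 2) (hyy : T.Adj y y')
    (hu : dg T u = 1) (huy : G.Adj u y') (huy' : u ≠ y) (hside : nx T y u ≠ y')
    (hleg : ∀ b, 3 ≤ dg T b → nx T y b ≠ y') :
    Opt G (surg T [(y', y)] [(u, y')]) r ∧ dg (surg T [(y', y)] [(u, y')]) y = 1 ∧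
      (∀ v, v ≠ u → v ≠ y → dg (surg T [(y', y)] [(u, y')]) v = dg T v) := by
  have hT := h.tree
  have hroot := h.root
  have hyy' := hyy.ne
  have huy'' := huy.ne
  have e1 := nx_self_adj hT hyy
  obtain ⟨hT', hdg⟩ := surg_isTree hT (R := [(y', y)]) (A := [(u, y')]) (by simp [hyy.symm])
    (by simp) rfl (surg_connected hT (by
      intro κ hA hS
      have := hS u y (by simp [hyy', hside])
      simp at hA ⊢
      grind))
  have hle : surg T [(y', y)] [(u, y')] ≤ G := surg_le h.le (by simp [huy])
  have hadj : ∀ c d, (surg T [(y', y)] [(u, y')]).Adj c d ↔ (T.Adj c d ∧ ¬ (c = y' ∧ d = y) ∧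
      ¬ (c = y ∧ d = y')) ∨ (c = u ∧ d = y') ∨ (c = y' ∧ d = u) := by
    intro c d
    rw [surg_adj]
    simp [huy'']
  generalize surg T [(y', y)] [(u, y')] = T' at *
  have hu' : dg T' u = 2 := by
    have := hdg u
    simp [huy', huy''] at this
    omega
  have hy1 : dg T' y = 1 := by
    have := hdg y
    simp [hyy', huy'.symm] at this
    omega
  have hoth : ∀ w, w ≠ u → w ≠ y → dg T' w = dg T w := by
    intro w h1 h2
    have := hdg w
    simp [h1, h2] at this
    omega
  have hσ : ∀ w, dg T' w = dg T (Equiv.refl V w) ∨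
      (dg T' w ≤ 2 ∧ dg T (Equiv.refl V w) ≤ 2) := by
    intro w
    rw [Equiv.refl_apply]
    by_cases h1 : w = u
    · subst h1
      omega
    · by_cases h2 : w = y
      · subst h2
        omega
      · exact Or.inl (hoth w h1 h2)
  obtain ⟨hnb, hsq⟩ := sum_branch_comp hσ
  have hbr : ∀ w, 3 ≤ dg T' w ↔ 3 ≤ dg T w := by
    intro w
    have := hσ w
    rw [Equiv.refl_apply] at this
    omega
  have hfb : ∀ b, 3 ≤ dg T b → (if nx T y b = y' then u else b) = b :=
    fun b hb => if_neg (hleg b hb)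
  -- The leg beyond `y'` contains no branch vertex, so collapsing it to `u` preserves all directions
  -- from branch vertices.
  have hf : ∀ b, 3 ≤ dg T b → ∀ c d, T'.Adj c d → c ≠ b → d ≠ b →
      nx T b ((fun w => if nx T y w = y' then u else w) c) =
      nx T b ((fun w => if nx T y w = y' then u else w) d) := by
    intro b hb c d hcd hc hd
    have key : ∀ c d, T.Adj c d → ¬ (c = y' ∧ d = y) → ¬ (c = y ∧ d = y') →
        (nx T y c = y' ↔ nx T y d = y') := by
      intro c d h1 h2 h3
      rw [← side_iff hT hyy.symm, ← side_iff hT hyy.symm]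
      exact side_adj_iff hT hyy.symm h1 h2 h3
    rcases (hadj c d).1 hcd with ⟨h1, h2, h3⟩ | ⟨rfl, rfl⟩ | ⟨rfl, rfl⟩
    · have h4 := key c d h1 h2 h3
      by_cases h5 : nx T y c = y'
      · simp only [if_pos h5, if_pos (h4.1 h5)]
      · simp only [if_neg h5, if_neg (fun e => h5 (h4.2 e))]
        exact nx_congr_adj hT h1 hc.symm hd.symm
    · simp [hside, e1]
    · simp [hside, e1]
  have hom : om T' r ≤ om T r := by
    refine om_le_of_anc r (Equiv.refl V) (fun w => ?_) (fun w => ?_) ?_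
    · rcases hσ w with e | e <;> omega
    · rcases hσ w with e | e <;> omega
    · intro b v hb hv hne hanc
      refine anc_of_contract hT' _ (hf b ((hbr b).1 hb)) hne ?_ ?_ hanc
      · simp only [hfb r hroot]
      · simp only [hfb v ((hbr v).1 hv)]
        rfl
  have hr' : 3 ≤ dg T' r := (hbr r).2 hroot
  have hy'2 : dg T y' ≤ 2 := by
    by_contra hcon
    exact hleg y' (by omega) e1
  have hadjw : ∀ w, 3 ≤ dg T w → ∀ q, T'.Adj w q ↔ T.Adj w q := by
    intro w hw q
    have h1 : w ≠ u := by rintro rfl; omega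
    have h2 : w ≠ y := by rintro rfl; omega
    have h3 : w ≠ y' := by rintro rfl; omega
    rw [hadj]
    simp [h1, h2, h3]
  have hnxr : ∀ w, 3 ≤ dg T w → nx T' w r = nx T w r := by
    intro w hw
    by_cases hwr : w = r
    · rw [hwr, nx_self, nx_self]
    refine nx_root_eq_of_contract hT hT' hwr _ (hf w hw) (fun q hq => ?_) (hfb r hroot)
    have h1 := (hadjw w hw q).1 hq
    refine ⟨h1, if_neg fun e => ?_⟩
    have h2 : w ≠ y := by rintro rfl; omega
    by_cases h3 : q = y
    · rw [h3, nx_self] at e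
      exact hyy' e
    · rw [← nx_congr_adj hT h1 h2.symm (Ne.symm h3)] at e
      exact hleg w hw e
  refine ⟨h.of_le hle hT' hr' hnb hsq.le hom (zb_le_of fun w hw hwr => ?_), hy1, hoth⟩
  have hw3 : 3 ≤ dg T w := (hbr w).1 hw.ge
  have h1 : w ≠ u := by rintro rfl; omega
  have h2 : w ≠ y := by rintro rfl; omega
  exact ⟨by rw [← hoth w h1 h2, hw], hadjw w hw3, hnxr w hw3⟩

/-- The sum of the distances between branch vertices and of the distances from cubic vertices to
their neighbours in `G`. -/
noncomputable def dd (G T : SimpleGraph V) (r : V) : ℕ :=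
  (∑ a, ∑ b, if 3 ≤ dg T a ∧ 3 ≤ dg T b then T.dist a b else 0) +
    ∑ x, ∑ v, if dg T x = 3 ∧ x ≠ r ∧ G.Adj x v then T.dist x v else 0

/-- Distances in the new tree are bounded below by functions, built from old distances, that grow by
at most one along an edge. -/
lemma le_add_dist {T' : SimpleGraph V} (hT' : T'.IsTree) (g : V → ℕ)
    (hg : ∀ c d, T'.Adj c d → g d ≤ g c + 1) (a c : V) : g c ≤ g a + T'.dist a c := by
  induction hn : T'.dist a c generalizing a with
  | zero =>
    rw [hT'.1.dist_eq_zero_iff] at hn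
    rw [hn]
    omega
  | succ n ih =>
    have hac : a ≠ c := by
      rintro rfl
      simp at hn
    have h1 := nx_dist hT' hac
    have h2 := hg _ _ (nx_adj hT' hac)
    have h3 := ih (nx T' a c) (by omega)
    omega

/-- Inserting a leaf `u`, whose neighbours in `G` include no cubic vertex, into an edge `y z` keeps
optimality and does not decrease distances. -/
lemma Opt.insert_leaf {r u u' y z : V} (h : Opt G T r) (hyz : T.Adj y z) (hu : dg T u = 1)
    (huu : T.Adj u u') (huy : G.Adj u y) (huz : G.Adj u z) (hy : u' ≠ y)
    (hz : u' ≠ z) (hc : ∀ x, dg T x = 3 → x ≠ r → ¬ G.Adj x u) :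
    Opt G (surg T [(u, u'), (y, z)] [(u, y), (u, z)]) r ∧
      (dd G T r ≤ dd G (surg T [(u, u'), (y, z)] [(u, y), (u, z)]) r) ∧
      ((∃ a c, (3 ≤ dg T a ∧ 3 ≤ dg T c ∨ dg T a = 3 ∧ a ≠ r ∧ G.Adj a c) ∧
        (nx T z a = y ∧ nx T z c ≠ y ∨ nx T z c = y ∧ nx T z a ≠ y)) →
        dd G T r < dd G (surg T [(u, u'), (y, z)] [(u, y), (u, z)]) r) := by
  have hT := h.tree
  have hroot := h.root
  have hyzn := hyz.ne
  have huyn := huy.ne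
  have huzn := huz.ne
  have huun := huu.ne
  have e1 := nx_self_adj hT hyz.symm
  obtain ⟨hT', hdg⟩ := surg_isTree hT (R := [(u, u'), (y, z)]) (A := [(u, y), (u, z)])
    (by simp [hyz, huu]) (by simp; grind) rfl (surg_connected hT (by
      intro κ hA hS
      have f1 := nx_ne_leaf hT hu huu.symm huyn.symm
      have f2 := nx_ne_leaf hT hu huu.symm huzn.symm
      by_cases hc : nx T z u' = y
      · have := hS u' y (by simp [f1, hc, e1, huun.symm])
        simp at hA ⊢
        grind
      · have := hS u' z (by simp [f2, hc, huun.symm, hyzn.symm])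
        simp at hA ⊢
        grind))
  have hle : surg T [(u, u'), (y, z)] [(u, y), (u, z)] ≤ G := surg_le h.le (by simp [huy, huz])
  have hadj : ∀ c d, (surg T [(u, u'), (y, z)] [(u, y), (u, z)]).Adj c d →
      (T.Adj c d ∧ c ≠ u ∧ d ≠ u ∧ ¬ (c = y ∧ d = z) ∧ ¬ (c = z ∧ d = y)) ∨
      (c = u ∧ (d = y ∨ d = z)) ∨ (d = u ∧ (c = y ∨ c = z)) := by
    intro c d
    rw [surg_adj]
    simp [huyn, huzn]
    have := fun q => eq_of_dg_one (b := q) hu huu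
    have := fun q (hq : T.Adj q u) => eq_of_dg_one (b := q) hu huu hq.symm
    grind
  have hadjw : ∀ w, w ≠ u → w ≠ u' → w ≠ y → w ≠ z → ∀ q,
      ((surg T [(u, u'), (y, z)] [(u, y), (u, z)]).Adj w q ↔ T.Adj w q) := by
    intro w h1 h2 h3 h4 q
    rw [surg_adj]
    simp [huyn, huzn]
    grind
  generalize surg T [(u, u'), (y, z)] [(u, y), (u, z)] = T' at *
  have hu2 : dg T' u = 2 := by
    have := hdg u
    simp [huun, huyn, huzn] at this
    omega
  -- Removing the leaf would lower a branch vertex `u'`, which a reduced tree forbids.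
  have hu' : dg T u' ≤ 2 := by
    by_contra hcon
    have h1 := h.reduced.min T' hle hT' (fun w => ?_) u' (by omega)
    · have := hdg u'
      simp [huun.symm, hy, hz] at this
      omega
    · have := hdg w
      by_cases hwu : w = u
      · subst hwu
        omega
      · simp [hwu] at this
        omega
  have hu'2 : dg T' u' ≤ 2 := by
    have := hdg u'
    simp [huun.symm, hy, hz] at this
    omega
  have hoth : ∀ w, w ≠ u → w ≠ u' → dg T' w = dg T w := by
    intro w h1 h2
    have := hdg w
    simp [h1, h2] at this
    omega
  have hσ : ∀ w, dg T' w = dg T (Equiv.refl V w) ∨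
      (dg T' w ≤ 2 ∧ dg T (Equiv.refl V w) ≤ 2) := by
    intro w
    rw [Equiv.refl_apply]
    by_cases h1 : w = u
    · subst h1
      omega
    · by_cases h2 : w = u'
      · subst h2
        omega
      · exact Or.inl (hoth w h1 h2)
  obtain ⟨hnb, hsq⟩ := sum_branch_comp hσ
  have hbr : ∀ w, 3 ≤ dg T' w ↔ 3 ≤ dg T w := by
    intro w
    have := hσ w
    rw [Equiv.refl_apply] at this
    omega
  have hcub : ∀ w, dg T' w = 3 ↔ dg T w = 3 := by
    intro w
    have := hσ w
    rw [Equiv.refl_apply] at this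
    omega
  have hfb : ∀ b w, w ≠ u → (if w = u then if b = y then z else y else w) = w :=
    fun b w hw => if_neg hw
  have hf : ∀ b, b ≠ u → ∀ c d, T'.Adj c d → c ≠ b → d ≠ b →
      nx T b ((fun w => if w = u then if b = y then z else y else w) c) =
      nx T b ((fun w => if w = u then if b = y then z else y else w) d) := by
    intro b hb c d hcd hc hd
    have key : b ≠ y → b ≠ z → nx T b y = nx T b z := fun h1 h2 => nx_congr_adj hT hyz h1 h2
    rcases hadj c d hcd with ⟨h1, h2, h3, -⟩ | ⟨rfl, h1⟩ | ⟨rfl, h1⟩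
    · simp only [if_neg h2, if_neg h3]
      exact nx_congr_adj hT h1 hc.symm hd.symm
    · grind
    · grind
  have hne : ∀ b, 3 ≤ dg T b → b ≠ u := by
    rintro b hb rfl
    omega
  have hne' : ∀ b, 3 ≤ dg T b → b ≠ u' := by
    rintro b hb rfl
    omega
  have hom : om T' r ≤ om T r := by
    refine om_le_of_anc r (Equiv.refl V) (fun w => ?_) (fun w => ?_) ?_
    · rcases hσ w with e | e <;> omega
    · rcases hσ w with e | e <;> omega
    · intro b v hb hv hnebv hanc
      refine anc_of_contract hT' _ (hf b (hne b ((hbr b).1 hb))) hnebv ?_ ?_ hanc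
      · simp only [hfb b r (hne r hroot)]
      · simp only [hfb b v (hne v ((hbr v).1 hv))]
        rfl
  have hr' : 3 ≤ dg T' r := (hbr r).2 hroot
  have hopt : Opt G T' r := by
    refine h.of_le hle hT' hr' hnb hsq.le hom (zb_le_of fun w hw hwr => ?_)
    have hw3 := (hcub w).1 hw
    have hwy : w ≠ y := by
      rintro rfl
      exact hc w hw3 hwr huy.symm
    have hwz : w ≠ z := by
      rintro rfl
      exact hc w hw3 hwr huz.symm
    have hwu := hne w hw3.ge
    have hwu' := hne' w hw3.ge
    refine ⟨hw3, hadjw w hwu hwu' hwy hwz, ?_⟩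
    refine nx_root_eq_of_contract hT hT' hwr _ (hf w hwu) (fun q hq => ?_)
      (hfb w r (hne r hroot))
    refine ⟨(hadjw w hwu hwu' hwy hwz q).1 hq, hfb w q ?_⟩
    rintro rfl
    rcases hadj _ _ hq with e | e | e <;> grind
  have hdist : ∀ a c, a ≠ u → c ≠ u → T.dist a c ≤ T'.dist a c := by
    intro a c ha hcu
    have := le_add_dist hT' (fun w => if w = u then T.dist a y else T.dist a w) ?_ a c
    · simpa [ha, hcu] using this
    · intro c d hcd
      have key : ∀ c d, T.Adj c d → T.dist a d ≤ T.dist a c + 1 := by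
        intro c d h1
        have := hT.dist_eq_dist_add_one_of_adj a h1
        omega
      rcases hadj c d hcd with ⟨h1, h2, h3, -⟩ | ⟨rfl, rfl | rfl⟩ | ⟨rfl, rfl | rfl⟩
      · simp only [if_neg h2, if_neg h3]
        exact key c d h1
      · simp [huyn.symm]
      · simp only [if_true, if_neg huzn.symm]
        exact key y d hyz
      · simp [huyn.symm]
      · simp only [if_true, if_neg huzn.symm]
        exact key c y hyz.symm
  have hdist' : ∀ a c, a ≠ u → c ≠ u → nx T z a = y → nx T z c ≠ y →
      T.dist a c < T'.dist a c := by
    intro a c ha hcu hay hcy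
    have := le_add_dist hT' (fun w => if w = u then T.dist a y + 1 else
      T.dist a w + if nx T z w = y then 0 else 1) ?_ a c
    · simp only [if_neg ha, if_neg hcu, if_pos hay, if_neg hcy, SimpleGraph.dist_self] at this
      omega
    · intro c d hcd
      have key : ∀ c d, T.Adj c d → T.dist a d ≤ T.dist a c + 1 := by
        intro c d h1
        have := hT.dist_eq_dist_add_one_of_adj a h1
        omega
      have ez : T.dist a z = T.dist a y + 1 := by
        have hza : z ≠ a := by
          rintro rfl
          rw [nx_self] at hay
          exact hyzn hay.symm
        have := nx_dist hT hza
        rw [hay, SimpleGraph.dist_comm, SimpleGraph.dist_comm (u := z)] at this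
        omega
      rcases hadj c d hcd with ⟨h1, h2, h3, h4, h5⟩ | ⟨rfl, rfl | rfl⟩ | ⟨rfl, rfl | rfl⟩
      · simp only [if_neg h2, if_neg h3]
        have h6 := side_adj_iff hT hyz h1 h4 h5
        rw [side_iff hT hyz, side_iff hT hyz] at h6
        have := key c d h1
        simp only [h6]
        omega
      · simp [huyn.symm, e1]
        omega
      · simp [huzn.symm, ez, hyzn.symm]
      · simp [huyn.symm, e1]
      · simp [huzn.symm, ez, hyzn.symm]
  -- This is why `u` may have no cubic neighbour apart from the root: the distances to the moved
  -- vertex itself never enter `dd`.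
  have hcu : ∀ x v, dg T x = 3 ∧ x ≠ r ∧ G.Adj x v → v ≠ u := by
    rintro x v ⟨h1, h2, h3⟩ rfl
    exact hc x h1 h2 h3
  have t1 : ∀ a b, (if 3 ≤ dg T a ∧ 3 ≤ dg T b then T.dist a b else 0) ≤
      if 3 ≤ dg T' a ∧ 3 ≤ dg T' b then T'.dist a b else 0 := by
    intro a b
    simp only [hbr]
    split_ifs with h1
    · exact hdist a b (hne a h1.1) (hne b h1.2)
    · exact le_rfl
  have t2 : ∀ x v, (if dg T x = 3 ∧ x ≠ r ∧ G.Adj x v then T.dist x v else 0) ≤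
      if dg T' x = 3 ∧ x ≠ r ∧ G.Adj x v then T'.dist x v else 0 := by
    intro a b
    simp only [hcub]
    split_ifs with h1
    · exact hdist a b (hne a h1.1.ge) (hcu a b h1)
    · exact le_rfl
  have s1 : (∑ a, ∑ b, if 3 ≤ dg T a ∧ 3 ≤ dg T b then T.dist a b else 0) ≤
      ∑ a, ∑ b, if 3 ≤ dg T' a ∧ 3 ≤ dg T' b then T'.dist a b else 0 :=
    Finset.sum_le_sum fun a _ => Finset.sum_le_sum fun b _ => t1 a b
  have s2 : (∑ x, ∑ v, if dg T x = 3 ∧ x ≠ r ∧ G.Adj x v then T.dist x v else 0) ≤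
      ∑ x, ∑ v, if dg T' x = 3 ∧ x ≠ r ∧ G.Adj x v then T'.dist x v else 0 :=
    Finset.sum_le_sum fun a _ => Finset.sum_le_sum fun b _ => t2 a b
  refine ⟨hopt, Nat.add_le_add s1 s2, ?_⟩
  rintro ⟨a, c, hac, hsep⟩
  have hau : a ≠ u := by
    rcases hac with h1 | h1
    · exact hne a h1.1
    · exact hne a h1.1.ge
  have hcu' : c ≠ u := by
    rcases hac with h1 | h1
    · exact hne c h1.2
    · exact hcu a c h1
  have hlt : T.dist a c < T'.dist a c := by
    rcases hsep with h1 | h1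
    · exact hdist' a c hau hcu' h1.1 h1.2
    · rw [SimpleGraph.dist_comm, SimpleGraph.dist_comm (G := T')]
      exact hdist' c a hcu' hau h1.1 h1.2
  rcases hac with h1 | h1
  · refine Nat.add_lt_add_of_lt_of_le ?_ s2
    refine Finset.sum_lt_sum (fun a _ => Finset.sum_le_sum fun b _ => t1 a b)
      ⟨a, Finset.mem_univ a, Finset.sum_lt_sum (fun b _ => t1 a b) ⟨c, Finset.mem_univ c, ?_⟩⟩
    simp only [hbr]
    rw [if_pos h1, if_pos h1]
    exact hlt
  · refine Nat.add_lt_add_of_le_of_lt s1 ?_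
    refine Finset.sum_lt_sum (fun a _ => Finset.sum_le_sum fun b _ => t2 a b)
      ⟨a, Finset.mem_univ a, Finset.sum_lt_sum (fun b _ => t2 a b) ⟨c, Finset.mem_univ c, ?_⟩⟩
    simp only [hcub]
    rw [if_pos h1, if_pos h1]
    exact hlt

end Neutral

/-! ### An edge oblique at one end to a leaf and to a cubic vertex -/

section ObliqueSame

variable {V : Type*} [Fintype V] {G T T' : SimpleGraph V}

/-- Not every neighbour of a branch vertex `y`, outside of one direction, is adjacent to a cubic
vertex in that direction. -/
lemma Opt.exists_arm {r y z : V} (h : Opt G T r) (hy : 3 ≤ dg T y) (hyz : T.Adj y z) :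
    ∃ w, T.Adj y w ∧ w ≠ z ∧ ∀ s, dg T s = 3 → nx T y s = z → ¬ G.Adj s w := by
  by_contra! hcon
  obtain ⟨w, hw, hwz⟩ := exists_ne_of_dg T y {z} (by simp; omega)
  obtain ⟨w', hw', hwz'⟩ := exists_ne_of_dg T y {z, w} ((Finset.card_le_two).trans_lt (by omega))
  simp only [Finset.mem_singleton, Finset.mem_insert, not_or] at hwz hwz'
  obtain ⟨s, hs, hsz, hsw⟩ := hcon w hw hwz
  obtain ⟨s', hs', hsz', hsw'⟩ := hcon w' hw' hwz'.1
  have key : ∀ s, nx T y s = z → s ≠ y := by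
    rintro s hs rfl
    rw [nx_self] at hs
    exact hyz.ne hs
  have e1 := hw.ne
  have e2 := hw'.ne
  have hsy := key s hsz
  have hsy' := key s' hsz'
  -- Degree four needs both arms moved, so that `y` stops branching. Otherwise moving one arm is
  -- already an improvement.
  by_cases h4 : dg T y = 4
  · refine h.not_surg_branch [(w, y), (w', y)] [(s, w), (s', w')] y ?_ ?_ ?_ ?_ ?_ ?_ ?_
    · simp [hw.symm, hw'.symm]
    · simp
      grind
    · simp [hsw, hsw']
    · omega
    · simp [h4, e1, e2, hsy.symm, hsy'.symm]
    · intro v hv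
      simp
      grind
    · intro κ hA hS
      have := hS s y (by simp [hsz, e1, e2, Ne.symm hwz, Ne.symm hwz'.1])
      have := hS s' y (by simp [hsz', e1, e2, Ne.symm hwz, Ne.symm hwz'.1])
      simp at hA ⊢
      grind
  · refine h.not_surg [(w, y)] [(s, w)] s s y 1 0 1 ?_ ?_ ?_ hy hs hs hsy hsy ?_ (absurd rfl) ?_ ?_
      ?_ ?_
    · simp [hw.symm]
    · simp
    · simp [hsw]
    · simp
      grind
    · simp [hsy.symm, e1]
    · by_cases h3 : dg T y = 3
      · exact Or.inl h3.le
      · right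
        obtain ⟨q, hq⟩ : ∃ q, dg T y = q + 5 := ⟨dg T y - 5, by omega⟩
        rw [hq, show q + 5 - 1 = q + 4 by omega]
        nlinarith
    · intro v hv
      simp
      grind
    · intro κ hA hS
      have := hS s y (by simp [hsz, e1, Ne.symm hwz])
      simp at hA ⊢
      grind

/-- Shifting one degree to a cubic vertex pays except at degree four, where the degrees are merely
permuted. Hence the separate treatment of degree four in many exchanges. -/
lemma five_le_or {d : ℕ} (hd : d = 3 ∨ 5 ≤ d) :
    d ≤ 1 + 2 ∨ (3 + 1) ^ 2 + (3 + 0) ^ 2 + (d - 1) ^ 2 < 18 + d ^ 2 := by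
  rcases hd with hd | hd
  · exact Or.inl hd.le
  · right
    obtain ⟨q, rfl⟩ : ∃ q, d = q + 5 := ⟨d - 5, by omega⟩
    rw [show q + 5 - 1 = q + 4 by omega]
    nlinarith

/-- No tree edge is oblique at the same end to a cubic vertex and to a leaf. -/
lemma Opt.oblique_leaf_same {r x u y z : V} (h : Opt G T r)
    (hdd : ∀ T', Opt G T' r → dd G T' r ≤ dd G T r) (hclaw : IsClawFree G)
    (hx : dg T x = 3) (hxr : x ≠ r) (hu : dg T u = 1) (hyz : T.Adj y z) (hxy : G.Adj x y)
    (huy : G.Adj u y) (hz : nx T y x = z) (hzu : nx T y u = z) : False := by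
  have hT := h.tree
  have hcu : ∀ x, dg T x = 3 → x ≠ r → ¬ G.Adj x u :=
    fun x hx hxr => h.not_adj_leaf (h.not_bad hclaw) hx hxr hu
  have hxu := hcu x hx hxr
  have hyx := hxy.ne'
  have hyu := huy.ne'
  have hxu' : x ≠ u := ne_of_dg (T := T) (by omega)
  have hzu' : z ≠ u := by
    rintro rfl
    exact nx_ne_leaf hT hu hyz hxu' hz
  have hTuy : ¬ T.Adj u y := fun e => hzu' (by rw [← hzu, nx_self_adj hT e.symm])
  have hz2 : dg T z = 2 := by
    have := (h.reduced.attach hu huy hTuy).1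
    rwa [hzu] at this
  have hzx : z ≠ x := ne_of_dg (T := T) (by omega)
  have hTxy : ¬ T.Adj x y := fun e => hzx (by rw [← hz, nx_self_adj hT e.symm])
  have hyzn := hyz.ne
  have hTuw : ∀ w, T.Adj y w → w ≠ z → ¬ T.Adj u w := by
    intro w hw hwz e
    have := nx_congr_adj hT e hyu hw.ne
    rw [hzu, nx_self_adj hT hw] at this
    exact hwz this.symm
  have hwx : ∀ w, T.Adj y w → w ≠ z → w ≠ x ∧ w ≠ u := by
    intro w hw hwz
    constructor <;> rintro rfl
    · exact hwz (by rw [← hz, nx_self_adj hT hw])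
    · exact hwz (by rw [← hzu, nx_self_adj hT hw])
  -- If `y` branched, an arm `w` from `exists_arm` would be non-adjacent to `x`, so the claw at `y`
  -- forces `uw`. Then `y` is the first vertex from `w` towards the leaf `u`, and `attach` gives it
  -- degree two.
  have hy2 : dg T y = 2 := by
    have h1 := one_le_dg hyz
    have h2 : dg T y ≠ 1 := fun e => h.reduced.leaves_not_adj hu e huy
    by_contra hcon
    obtain ⟨w, hw, hwz, hwn⟩ := h.exists_arm (y := y) (z := z) (by omega) hyz
    rcases hclaw.adj_or huy.symm hxy.symm (h.le hw) hxu'.symm (hwx w hw hwz).2.symm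
      (hwx w hw hwz).1.symm with e | e | e
    · exact hxu e.symm
    · have h3 := (h.reduced.attach hu e (hTuw w hw hwz)).1
      have h4 : nx T w u = y := by
        rw [nx_through hT (q := y) hw.ne (by rw [hzu, nx_self_adj hT hw]; exact hwz.symm),
          nx_self_adj hT hw.symm]
      rw [h4] at h3
      exact hcon h3
    · exact hwn x hx hz e
  obtain ⟨y', hyy, hyz', -⟩ := exists_second T hy2 hyz
  obtain ⟨hy'x, hy'u⟩ := hwx y' hyy hyz'
  have hyyn := hyy.ne
  have nyz := nx_self_adj hT hyz
  have nyy := nx_self_adj hT hyy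
  have huu := nx_adj hT hyu.symm
  generalize nx T u y = u' at huu
  have hu'y : u' ≠ y := by
    rintro rfl
    exact hTuy huu
  -- If a branch vertex lies beyond `y'`, inserting `u` into `yy'` increases its distance from `x`.
  -- Otherwise the leg moves to `u`, and `y` becomes a leaf adjacent to the cubic vertex `x`.
  by_cases huy' : G.Adj u y'
  · by_cases hb : ∃ b, 3 ≤ dg T b ∧ nx T y b = y'
    · obtain ⟨b, hb, hby⟩ := hb
      obtain ⟨h1, -, h2⟩ := h.insert_leaf hyy hu huu huy huy' hu'y
        (by rintro rfl; exact hTuw _ hyy hyz' huu) hcu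
      refine absurd (hdd _ h1) (not_le.2 (h2 ⟨x, b, Or.inl ⟨by omega, hb⟩, Or.inl ⟨?_, ?_⟩⟩))
      · by_contra hcon
        rw [← Ne, ← nx_swap hT hyy, hz] at hcon
        exact hyz' hcon.symm
      · exact (nx_swap hT hyy).1 hby
    · push Not at hb
      obtain ⟨h1, h2, h3⟩ := h.move_leg hy2 hyy hu huy' hyu.symm (by rw [hzu]; exact hyz'.symm) hb
      exact h1.not_adj_leaf (h1.not_bad hclaw) (by rw [h3 x hxu' hyx.symm, hx]) hxr h2 hxy
  have hxy' : G.Adj x y' := by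
    rcases hclaw.adj_or huy.symm hxy.symm (h.le hyy) hxu'.symm hy'u.symm hy'x.symm with e | e | e
    · exact absurd e.symm hxu
    · exact absurd e huy'
    · exact e
  -- Inserting `u` into `zy` would lengthen the distance from `x` to its neighbour `y`, which `dd`
  -- counts.
  by_cases huz : G.Adj u z
  · obtain ⟨h1, -, h2⟩ := h.insert_leaf hyz.symm hu huu huz huy (by
      rintro rfl
      obtain ⟨c, hc, hcy, hall⟩ := exists_second T hz2 hyz.symm
      have hcu : c = u := by
        rcases hall u huu.symm with e | e
        · exact absurd e.symm hyu
        · exact e.symm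
      rcases hall _ (nx_adj hT hzx) with e | e
      · exact (nx_swap hT hyz).1 hz e
      · exact nx_ne_leaf hT hu huu.symm hxu' (e.trans hcu)) hu'y hcu
    refine absurd (hdd _ h1) (not_le.2 (h2 ⟨x, y, Or.inr ⟨hx, hxr, hxy⟩, Or.inl ⟨hz, ?_⟩⟩))
    rw [nx_self]
    exact hyzn
  have hxz : G.Adj x z := by
    rcases hclaw.adj_or huy.symm hxy.symm (h.le hyz) hxu'.symm hzu'.symm hzx.symm with e | e | e
    · exact absurd e.symm hxu
    · exact absurd e huz
    · exact e
  obtain ⟨J, j1, j2, j3⟩ := exists_junction hT x u y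
  have hJy : J ≠ y := by
    rintro rfl
    exact j1 hyx hyu (hz.trans hzu.symm)
  have hJu : J ≠ u := by
    rintro rfl
    exact j2 hxu'.symm hyu.symm
      (eq_of_dg_one hu (nx_adj hT hxu'.symm) (nx_adj hT hyu.symm))
  -- If `x` separates `u` from `y`, two of its three tree neighbours are adjacent, and in each case
  -- `x` can be rid of its branching. Otherwise the branch vertex `J` is the one to be lowered.
  by_cases hJx : J = x
  · subst hJx
    have hd := nx_adj hT hyx.symm
    have hb := nx_adj hT hJu
    have hbd := j3 hJu hyx.symm
    obtain ⟨c, hc, hcd, hcb, -⟩ := exists_third T hx hd hb hbd.symm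
    have key : ∀ q, T.Adj J q → q ≠ y ∧ nx T y q = z := by
      intro q hq
      have : y ≠ q := by
        rintro rfl
        exact hTxy hq
      exact ⟨this.symm, by rw [← nx_congr_adj hT hq hyx this, hz]⟩
    have nd := nx_self_adj hT hd
    have nb := nx_self_adj hT hb
    have nc := nx_self_adj hT hc
    have nz : nx T J z = nx T J y := (nx_congr_adj hT hyz hyx.symm hzx.symm).symm
    obtain ⟨hdy, kd⟩ := key _ hd
    obtain ⟨hby, kb⟩ := key _ hb
    obtain ⟨hcy, kc⟩ := key _ hc
    generalize hde : nx T J y = d at *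
    generalize hbe : nx T J u = b at *
    have hdn := hd.ne
    have hbn := hb.ne
    have hcn := hc.ne
    by_cases hcb' : G.Adj c b
    · refine h.not_surg_branch [(y', y), (b, J), (c, J)] [(u, y), (J, y'), (b, c)] J
        ?_ ?_ ?_ ?_ ?_ ?_ ?_
      · simp [hyy.symm, hb.symm, hc.symm]
      · simp
        grind
      · simp [huy, hxy', hcb'.symm]
      · omega
      · simp [hx, hJu, hJy, hbn, hcn, hy'x.symm]
      · intro v hv
        simp
        grind
      · intro κ hA hS
        have := hS u b (by simp [hzu, kb, hbe, nb])
        have := hS J y (by simp [hz, hyyn, hyz'.symm, hde, hbd.symm, hcd.symm, hbn, hcn])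
        simp at hA ⊢
        grind
    by_cases hcd' : G.Adj c d
    · refine h.not_surg_branch [(y', y), (d, J), (c, J)] [(u, y), (J, y'), (d, c)] J
        ?_ ?_ ?_ ?_ ?_ ?_ ?_
      · simp [hyy.symm, hd.symm, hc.symm]
      · simp
        grind
      · simp [huy, hxy', hcd'.symm]
      · omega
      · simp [hx, hJu, hJy, hdn, hcn, hy'x.symm]
      · intro v hv
        simp
        grind
      · intro κ hA hS
        have := hS y d (by simp [hyyn, hyz'.symm, kd, hde, nd])
        have := hS u J (by simp [hzu, hz, hbe, hbd, hcb.symm, hdn, hcn])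
        simp at hA ⊢
        grind
    have hbd' : G.Adj b d := by
      rcases hclaw.adj_or (h.le hb) (h.le hd) (h.le hc) hbd hcb.symm hcd.symm with e | e | e
      · exact e
      · exact absurd e.symm hcb'
      · exact absurd e.symm hcd'
    refine h.not_surg_branch [(z, y), (d, J), (b, J)] [(u, y), (J, z), (d, b)] J
      ?_ ?_ ?_ ?_ ?_ ?_ ?_
    · simp [hyz.symm, hd.symm, hb.symm]
    · simp
      grind
    · simp [huy, hxz, hbd'.symm]
    · omega
    · simp [hx, hJu, hJy, hdn, hbn, hzx.symm]
    · intro v hv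
      simp
      grind
    · intro κ hA hS
      have := hS d z (by simp [kd, nyz, nz, nd])
      have := hS u b (by simp [hzu, kb, hbe, nb])
      simp at hA ⊢
      grind
  · have ha := nx_adj hT hJx
    have hb := nx_adj hT hJu
    have hc := nx_adj hT hJy
    have hab := j1 hJx hJu
    have hac := j2 hJx hJy
    have hbc := j3 hJu hJy
    have hJ3 := three_le_dg ha hb hc hab hac hbc
    have hJz : J ≠ z := ne_of_dg (T := T) (by omega)
    have hyJ : nx T y J = z := by
      rw [← nx_through hT hJy hac, hz]
    have hJy' : J ≠ y' := by
      rintro rfl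
      exact hyz' (by rw [← hyJ, nyy])
    have key : ∀ q, T.Adj J q → q ≠ y ∧ nx T y q = z := by
      intro q hq
      have : y ≠ q := by
        rintro rfl
        rw [nx_self_adj hT hq.symm] at hyJ
        exact hJz hyJ
      exact ⟨this.symm, by rw [← nx_congr_adj hT hq hJy.symm this, hyJ]⟩
    have na := nx_self_adj hT ha
    have nb := nx_self_adj hT hb
    have nc := nx_self_adj hT hc
    have nz : nx T J z = nx T J y := (nx_congr_adj hT hyz hJy hJz).symm
    obtain ⟨hay, ka⟩ := key _ ha
    obtain ⟨hby, kb⟩ := key _ hb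
    obtain ⟨hcy, kc⟩ := key _ hc
    generalize hae : nx T J x = a at *
    generalize hbe : nx T J u = b at *
    generalize hce : nx T J y = c at *
    have han := ha.ne
    have hbn := hb.ne
    have hcn := hc.ne
    by_cases hJ4 : dg T J = 4
    · obtain ⟨q, hq, hqn⟩ := exists_ne_of_dg T J {a, b, c}
        ((Finset.card_le_three).trans_lt (by omega))
      simp only [Finset.mem_insert, Finset.mem_singleton, not_or] at hqn
      obtain ⟨hqa, hqb, hqc⟩ := hqn
      have nq := nx_self_adj hT hq
      have hqn := hq.ne
      obtain ⟨hqy, kq⟩ := key _ hq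
      by_cases g1 : G.Adj b a
      · refine h.not_surg_branch [(y', y), (b, J), (a, J)] [(x, y'), (u, y), (b, a)] J
          ?_ ?_ ?_ ?_ ?_ ?_ ?_
        · simp [hyy.symm, ha.symm, hb.symm]
        · simp
          grind
        · simp [huy, hxy', g1]
        · omega
        · simp [hJ4, hJu, hJy, hJx, hJy', han, hbn]
        · intro v hv
          simp
          grind
        · intro κ hA hS
          have := hS u b (by simp [hzu, kb, hbe, nb])
          have := hS x a (by simp [hz, ka, hae, na])
          have := hS y J (by simp [hyyn, hyJ, hyz'.symm, hce, hbc.symm, hac.symm, han, hbn])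
          simp at hA ⊢
          grind
      by_cases g2 : G.Adj b q
      · refine h.not_surg_branch [(y', y), (b, J), (q, J)] [(x, y'), (u, y), (b, q)] J
          ?_ ?_ ?_ ?_ ?_ ?_ ?_
        · simp [hyy.symm, hq.symm, hb.symm]
        · simp
          grind
        · simp [huy, hxy', g2]
        · omega
        · simp [hJ4, hJu, hJy, hJx, hJy', hqn, hbn]
        · intro v hv
          simp
          grind
        · intro κ hA hS
          have := hS u b (by simp [hzu, kb, hbe, nb])
          have := hS x J (by simp [hz, hyJ, hae, hab, Ne.symm hqa, hbn, hqn])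
          have := hS y J (by simp [hyyn, hyJ, hyz'.symm, hce, hbc.symm, Ne.symm hqc, hqn, hbn])
          simp at hA ⊢
          grind
      by_cases g3 : G.Adj c q
      · refine h.not_surg_branch [(y', y), (c, J), (q, J)] [(x, y'), (u, y), (c, q)] J
          ?_ ?_ ?_ ?_ ?_ ?_ ?_
        · simp [hyy.symm, hq.symm, hc.symm]
        · simp
          grind
        · simp [huy, hxy', g3]
        · omega
        · simp [hJ4, hJu, hJy, hJx, hJy', hqn, hcn]
        · intro v hv
          simp
          grind
        · intro κ hA hS
          have := hS y c (by simp [hyyn, kc, hyz'.symm, hce, nc])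
          have := hS x J (by simp [hz, hyJ, hae, hac, Ne.symm hqa, hcn, hqn])
          have := hS u J (by simp [hzu, hyJ, hbe, hbc, Ne.symm hqb, hcn, hqn])
          simp at hA ⊢
          grind
      have g4 : G.Adj a q := by
        rcases hclaw.adj_or (h.le ha) (h.le hb) (h.le hq) hab (Ne.symm hqa) (Ne.symm hqb) with
          e | e | e
        · exact absurd e.symm g1
        · exact e
        · exact absurd e g2
      refine h.not_surg_branch [(z, y), (a, J), (q, J)] [(u, y), (x, z), (a, q)] J
        ?_ ?_ ?_ ?_ ?_ ?_ ?_
      · simp [hyz.symm, hq.symm, ha.symm]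
      · simp
        grind
      · simp [huy, hxz, g4]
      · omega
      · simp [hJ4, hJu, hJy, hJx, hJz, hqn, han]
      · intro v hv
        simp
        grind
      · intro κ hA hS
        have := hS x a (by simp [hz, ka, hae, na])
        have := hS z J (by simp [nyz, hyJ, nz, hac.symm, Ne.symm hqc, han, hqn])
        have := hS u J (by simp [hzu, hyJ, hbe, hab.symm, Ne.symm hqb, han, hqn])
        simp at hA ⊢
        grind
    · refine h.not_surg [(y', y), (b, J)] [(x, y'), (u, y)] x x J 1 0 1 ?_ ?_ ?_ hJ3 hx hx
        (Ne.symm hJx) (Ne.symm hJx) ?_ (absurd rfl) ?_ (five_le_or (by omega)) ?_ ?_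
      · simp [hyy.symm, hb.symm]
      · simp
        grind
      · simp [huy, hxy']
      · simp [hy'x.symm, hxu', hyx.symm]
      · simp [hJu, hJy, hJx, hJy', hbn]
      · intro v hv
        simp
        grind
      · intro κ hA hS
        have := hS x y (by simp [hz, hyz'.symm, hae, hce, hab, hbc.symm, hyyn])
        have := hS u b (by simp [hzu, kb, hbe, nb])
        have := hS y J (by simp [hyyn, hyJ, hyz'.symm, hce, hbc.symm, hbn])
        simp at hA ⊢
        grind

end ObliqueSame

/-! ### Blocked cubic vertices: non-adjacency and opposite ends -/

section Cubic

variable {V : Type*} [Fintype V] {G T T' : SimpleGraph V}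

/-- The branch vertex `c` lies between `x` and `x'`, and it is cubic or one of the two tree edges at
`c` towards `x` and `x'` can be separated from `c`. -/
def Blocks (G T : SimpleGraph V) (x x' c : V) : Prop :=
  3 ≤ dg T c ∧ c ≠ x ∧ c ≠ x' ∧ nx T c x ≠ nx T c x' ∧
    (dg T c = 3 ∨ ∃ q, T.Adj c q ∧ q ≠ nx T c x ∧ q ≠ nx T c x' ∧
      (G.Adj (nx T c x) q ∨ G.Adj (nx T c x') q))

lemma Blocks.symm {x x' c : V} (h : Blocks G T x x' c) : Blocks G T x' x c := by
  obtain ⟨h1, h2, h3, h4, h5⟩ := h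
  refine ⟨h1, h3, h2, h4.symm, h5.imp id ?_⟩
  rintro ⟨q, a1, a2, a3, a4⟩
  exact ⟨q, a1, a3, a2, a4.symm⟩

/-- Two cubic vertices may each gain one if a vertex of degree at least four loses two: degree four
stops branching, and from five on the squares drop. -/
lemma four_le_or {d : ℕ} (hd : 4 ≤ d) :
    d ≤ 2 + 2 ∨ (3 + 1) ^ 2 + (3 + 1) ^ 2 + (d - 2) ^ 2 < 18 + d ^ 2 := by
  by_cases h : d = 4
  · exact Or.inl h.le
  · right
    obtain ⟨q, rfl⟩ : ∃ q, d = q + 5 := ⟨d - 5, by omega⟩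
    rw [show q + 5 - 2 = q + 3 by omega]
    nlinarith

/-- Let `a = nx T c x`. The edge `aq` keeps these two neighbours of `c` together, so both can be cut
from `c`; the edge `xx'` reconnects them with the rest. -/
lemma Opt.not_adj_cubic_aux {r x x' c q : V} (h : Opt G T r) (hx : dg T x = 3) (hx' : dg T x' = 3)
    (hc : 4 ≤ dg T c) (hcx : c ≠ x) (hcx' : c ≠ x') (hne : nx T c x ≠ nx T c x')
    (hq : T.Adj c q) (hqx : q ≠ nx T c x) (hqx' : q ≠ nx T c x') (hadj : G.Adj (nx T c x) q) :
    ¬ G.Adj x x' := by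
  intro hxx
  have hT := h.tree
  have ha := nx_adj hT hcx
  have na := nx_self_adj hT ha
  have han := ha.ne
  have hqn := hq.ne
  have hxn := hxx.ne
  generalize hae : nx T c x = a at *
  refine h.not_surg [(a, c), (q, c)] [(x, x'), (a, q)] x x' c 1 1 2 ?_ ?_ ?_ (by omega) hx hx'
    hcx.symm hcx'.symm ?_ ?_ ?_ (four_le_or hc) ?_ ?_
  · simp [ha.symm, hq.symm]
  · simp
    grind
  · simp [hxx, hadj]
  · simp [hxn]
    grind
  · simp [hxn.symm]
    grind
  · simp [hcx, hcx', han, hqn]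
  · intro v hv
    simp
    grind
  · intro κ hA hS
    have := hS x a (by simp [hae, na])
    have := hS x' c (by simp [hne.symm, hqx'.symm, han, hqn])
    simp at hA ⊢
    grind

/-- Cubic vertices with a blocking vertex between them are not adjacent. -/
lemma Opt.not_adj_cubic {r x x' c : V} (h : Opt G T r) (hx : dg T x = 3) (hx' : dg T x' = 3)
    (hc : Blocks G T x x' c) : ¬ G.Adj x x' := by
  obtain ⟨h3, hcx, hcx', hne, hb⟩ := hc
  by_cases hc4 : 4 ≤ dg T c
  · obtain hb | ⟨q, hq, h1, h2, h4 | h4⟩ := hb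
    · omega
    · exact h.not_adj_cubic_aux hx hx' hc4 hcx hcx' hne hq h1 h2 h4
    · intro hxx
      exact h.not_adj_cubic_aux hx' hx hc4 hcx' hcx hne.symm hq h2 h1 h4 hxx.symm
  intro hxx
  have hc3 : dg T c = 3 := by omega
  have hT := h.tree
  have ha := nx_adj hT hcx
  have na := nx_self_adj hT ha
  have han := ha.ne
  have hxn := hxx.ne
  generalize hae : nx T c x = a at *
  refine h.not_surg [(a, c)] [(x, x')] x x' c 1 1 1 ?_ ?_ ?_ (by omega) hx hx'
    hcx.symm hcx'.symm ?_ ?_ ?_ (Or.inl hc3.le) ?_ ?_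
  · simp [ha.symm]
  · simp
  · simp [hxx]
  · simp [hxn]
  · simp [hxn.symm]
  · simp [hcx, hcx', han]
  · intro v hv
    simp
    grind
  · intro κ hA hS
    have := hS x a (by simp [hae, na])
    have := hS x' c (by simp [hne.symm, han])
    simp at hA ⊢
    grind

/-- The blocking vertex is the end `z`. Replacing `yz` by `xy` suffices unless `z` has degree four;
then `z` must lose two, by way of an adjacency among `x'`, `q` and the neighbour of `z` towards `x`.
-/
lemma Opt.oblique_cubic_opposite_at {r x x' y z q : V} (h : Opt G T r) (hclaw : IsClawFree G)
    (hx : dg T x = 3) (hx' : dg T x' = 3) (hyz : T.Adj y z) (hxy : G.Adj x y)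
    (hxz : G.Adj x' z) (hz : nx T z x ≠ y) (hy : nx T z x' = y) (hzx : z ≠ x) (hyx : y ≠ x')
    (h3 : 3 ≤ dg T z) (hq : T.Adj z q) (hqx : q ≠ nx T z x) (hqy : q ≠ y)
    (hadj : G.Adj (nx T z x) q ∨ G.Adj y q) : False := by
  have hT := h.tree
  have hzx' := hxz.ne'
  have hyxn := hxy.ne
  have hb := nx_adj hT hzx
  have nb := nx_self_adj hT hb
  have ny := nx_self_adj hT hyz.symm
  have nq := nx_self_adj hT hq
  have hbn := hb.ne
  have hqn := hq.ne
  have hyzn := hyz.ne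
  have hxx' : x ≠ x' := by
    rintro rfl
    exact hz hy
  generalize hbe : nx T z x = b at *
  by_cases h4 : dg T z = 4
  · by_cases g1 : G.Adj b q
    · refine h.not_surg_branch [(y, z), (b, z), (q, z)] [(x, y), (x', z), (b, q)] z
        ?_ ?_ ?_ h3 ?_ ?_ ?_
      · simp [hyz, hb.symm, hq.symm]
      · simp
        grind
      · simp [hxy, hxz, g1]
      · simp [h4, hzx, hzx', hyzn.symm, hbn, hqn]
      · intro v hv
        simp
        grind
      · intro κ hA hS
        have := hS x b (by simp [hbe, nb])
        have := hS x' y (by simp [hy, ny])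
        simp at hA ⊢
        grind
    by_cases g2 : G.Adj x' q
    · refine h.not_surg_branch [(y, z), (q, z)] [(x, y), (x', q)] z ?_ ?_ ?_ h3 ?_ ?_ ?_
      · simp [hyz, hq.symm]
      · simp
        grind
      · simp [hxy, g2]
      · simp [h4, hzx, hzx', hyzn.symm, hqn]
      · intro v hv
        simp
        grind
      · intro κ hA hS
        have := hS x z (by simp [hbe, hz, Ne.symm hqx, hyzn.symm, hqn])
        have := hS x' y (by simp [hy, ny])
        simp at hA ⊢
        grind
    have hbx' : b ≠ x' := by
      rintro rfl
      exact hz (nb.symm.trans hy)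
    have hqx' : q ≠ x' := by
      rintro rfl
      exact hqy (nq.symm.trans hy)
    have g3 : G.Adj b x' := by
      rcases hclaw.adj_or (h.le hb) hxz.symm (h.le hq) hbx' (Ne.symm hqx) hqx'.symm with e | e | e
      · exact e
      · exact absurd e g1
      · exact absurd e g2
    have g4 : G.Adj y q := hadj.resolve_left g1
    refine h.not_surg_branch [(y, z), (q, z), (b, z)] [(y, q), (x', z), (x', b)] z
      ?_ ?_ ?_ h3 ?_ ?_ ?_
    · simp [hyz, hb.symm, hq.symm]
    · simp
      grind
    · simp [g4, hxz, g3.symm]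
    · simp [h4, hzx', hyzn.symm, hbn, hqn]
    · intro v hv
      simp
      grind
    · intro κ hA hS
      have := hS x' y (by simp [hy, ny])
      simp at hA ⊢
      grind
  · refine h.not_surg [(y, z)] [(x, y)] x x z 1 0 1 ?_ ?_ ?_ h3 hx hx hzx.symm hzx.symm
      ?_ (absurd rfl) ?_ (five_le_or (by omega)) ?_ ?_
    · simp [hyz]
    · simp
    · simp [hxy]
    · simp [hyxn]
    · simp [hzx, hyzn.symm]
    · intro v hv
      simp
      grind
    · intro κ hA hS
      have := hS x z (by simp [hbe, hz, hyzn.symm])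
      simp at hA ⊢
      grind

/-- The part of `oblique_cubic_opposite` where the blocking vertex lies between `x` and `z`. -/
lemma Opt.oblique_cubic_opposite_side {r x x' y z c : V} (h : Opt G T r)
    (hx : dg T x = 3) (hx' : dg T x' = 3) (hyz : T.Adj y z) (hxy : G.Adj x y)
    (hxz : G.Adj x' z) (hz : nx T y x = z) (hy : nx T z x' = y) (hzx : z ≠ x) (hyx : y ≠ x')
    (hc : Blocks G T x x' c) (hcz : c ≠ z) (hcy : nx T y c = z) : False := by
  have hT := h.tree
  have hyxn := hxy.ne
  have hzx' := hxz.ne'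
  obtain ⟨h3, hcx, hcx', hne, hb⟩ := hc
  have hyzn := hyz.ne
  have hcyn : c ≠ y := by
    rintro rfl
    rw [nx_self] at hcy
    exact hyzn hcy
  have hxx' : x ≠ x' := by
    rintro rfl
    exact hne rfl
  have hyx' : nx T y x' ≠ z := fun e => (nx_swap hT hyz).1 e hy
  have ny : nx T c y = nx T c x' := (nx_through hT hcyn.symm (by rw [hcy]; exact hyx')).symm
  have nz : nx T c z = nx T c x' := by rw [← ny, nx_congr_adj hT hyz hcyn hcz]
  have nyz := nx_self_adj hT hyz
  have ha := nx_adj hT hcx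
  have hb' := nx_adj hT hcx'
  have key : ∀ q, T.Adj c q → q ≠ y ∧ nx T y q = z := by
    intro q hq
    have : y ≠ q := by
      rintro rfl
      rw [nx_self_adj hT hq.symm] at hcy
      exact hcz hcy
    exact ⟨this.symm, by rw [← nx_congr_adj hT hq hcyn.symm this, hcy]⟩
  have na := nx_self_adj hT ha
  have nb := nx_self_adj hT hb'
  obtain ⟨hay, ka⟩ := key _ ha
  obtain ⟨hby, kb⟩ := key _ hb'
  generalize hae : nx T c x = a at *
  generalize hbe : nx T c x' = b at *
  have han := ha.ne
  have hbn := hb'.ne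
  by_cases hc3 : dg T c = 3
  · refine h.not_surg [(z, y), (a, c)] [(x, y), (x', z)] x x' c 1 1 1 ?_ ?_ ?_ h3 hx hx'
      hcx.symm hcx'.symm ?_ ?_ ?_ (Or.inl hc3.le) ?_ ?_
    · simp [hyz.symm, ha.symm]
    · simp
      grind
    · simp [hxy, hxz]
    · simp [hyxn, hxx', hzx.symm]
    · simp [hzx'.symm, hxx'.symm, hyx.symm]
    · simp [hcx, hcx', hcyn, hcz, han]
    · intro v hv
      simp
      grind
    · intro κ hA hS
      have := hS x a (by simp [hz, ka, hae, na])
      have := hS c z (by simp [hcy, nyz, nz, hne.symm, han])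
      have := hS x' y (by simp [hyx', hyzn, ny, hbe])
      simp at hA ⊢
      grind
  · obtain ⟨q, hq, hqa, hqb, hadj⟩ := hb.resolve_left hc3
    have nq := nx_self_adj hT hq
    obtain ⟨hqy, kq⟩ := key _ hq
    have hqn := hq.ne
    rcases hadj with hadj | hadj
    · refine h.not_surg [(z, y), (a, c), (q, c)] [(x, y), (x', z), (a, q)] x x' c 1 1 2 ?_ ?_ ?_
        h3 hx hx' hcx.symm hcx'.symm ?_ ?_ ?_ (four_le_or (by omega)) ?_ ?_
      · simp [hyz.symm, ha.symm, hq.symm]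
      · simp
        grind
      · simp [hxy, hxz, hadj]
      · simp [hyxn, hxx', hzx.symm]
        grind
      · simp [hzx'.symm, hxx'.symm, hyx.symm]
        grind
      · simp [hcx, hcx', hcyn, hcz, han, hqn]
      · intro v hv
        simp
        grind
      · intro κ hA hS
        have := hS x a (by simp [hz, ka, hae, na])
        have := hS c z (by simp [hcy, nyz, nz, hne.symm, han, hqn, Ne.symm hqb])
        have := hS x' y (by simp [hyx', hyzn, ny, hbe])
        simp at hA ⊢
        grind
    · refine h.not_surg [(z, y), (b, c), (q, c)] [(x, y), (x', z), (b, q)] x x' c 1 1 2 ?_ ?_ ?_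
        h3 hx hx' hcx.symm hcx'.symm ?_ ?_ ?_ (four_le_or (by omega)) ?_ ?_
      · simp [hyz.symm, hb'.symm, hq.symm]
      · simp
        grind
      · simp [hxy, hxz, hadj]
      · simp [hyxn, hxx', hzx.symm]
        grind
      · simp [hzx'.symm, hxx'.symm, hyx.symm]
        grind
      · simp [hcx, hcx', hcyn, hcz, hbn, hqn]
      · intro v hv
        simp
        grind
      · intro κ hA hS
        have := hS x c (by simp [hz, hcy, hae, hne, Ne.symm hqa, hbn, hqn])
        have := hS b z (by simp [kb, nyz, nz, nb])
        have := hS x' y (by simp [hyx', hyzn, ny, hbe])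
        simp at hA ⊢
        grind

/-- No tree edge is oblique at opposite ends to two cubic vertices that are blocked. -/
lemma Opt.oblique_cubic_opposite {r x x' y z c : V} (h : Opt G T r) (hclaw : IsClawFree G)
    (hx : dg T x = 3) (hx' : dg T x' = 3) (hyz : T.Adj y z) (hxy : G.Adj x y)
    (hxz : G.Adj x' z) (hz : nx T y x = z) (hy : nx T z x' = y) (hc : Blocks G T x x' c) :
    False := by
  have hT := h.tree
  have hxx := h.not_adj_cubic hx hx' hc
  have hzx : z ≠ x := by
    rintro rfl
    exact hxx hxz.symm
  have hyx : y ≠ x' := by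
    rintro rfl
    exact hxx hxy
  have e1 : nx T z x ≠ y := (nx_swap hT hyz).1 hz
  have e2 : nx T y x' ≠ z := (nx_swap hT hyz.symm).1 hy
  by_cases hcz : c = z
  · subst hcz
    obtain ⟨h3, hcx, hcx', hne, hb⟩ := hc
    rcases hb with hb | ⟨q, hq, hqx, hqy, hadj⟩
    · refine h.not_surg_branch [(y, c)] [(x, y)] c ?_ ?_ ?_ h3 ?_ ?_ ?_
      · simp [hyz]
      · simp
      · simp [hxy]
      · simp [hb, hcx, hyz.ne']
      · intro v hv
        simp
        grind
      · intro κ hA hS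
        have := hS x c (by simp [e1, hyz.ne'])
        simp at hA ⊢
        grind
    · rw [hy] at hqy hadj
      exact h.oblique_cubic_opposite_at hclaw hx hx' hyz hxy hxz e1 hy hzx hyx h3 hq hqx hqy hadj
  by_cases hcy : c = y
  · subst hcy
    obtain ⟨h3, hcx, hcx', hne, hb⟩ := hc
    rcases hb with hb | ⟨q, hq, hqx, hqy, hadj⟩
    · refine h.not_surg_branch [(z, c)] [(x', z)] c ?_ ?_ ?_ h3 ?_ ?_ ?_
      · simp [hyz.symm]
      · simp
      · simp [hxz]
      · simp [hb, hcx', hyz.ne]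
      · intro v hv
        simp
        grind
      · intro κ hA hS
        have := hS x' c (by simp [e2, hyz.ne])
        simp at hA ⊢
        grind
    · rw [hz] at hqx hadj
      exact h.oblique_cubic_opposite_at hclaw hx' hx hyz.symm hxz hxy e2 hz hyx hzx h3 hq hqy hqx
        hadj.symm
  -- A blocking vertex off the edge lies on one of its two sides, and the configuration is symmetric
  -- under reversing the edge.
  by_cases hs : nx T y c = z
  · exact h.oblique_cubic_opposite_side hx hx' hyz hxy hxz hz hy hzx hyx hc hcz hs
  · refine h.oblique_cubic_opposite_side hx' hx hyz.symm hxz hxy hy hz hyx hzx hc.symm hcy ?_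
    by_contra hcon
    exact hs ((nx_swap hT hyz).2 hcon)

end Cubic

/-! ### Blocked cubic vertices at the same end of an edge -/

section CubicSame

variable {V : Type*} [Fintype V] {G T T' : SimpleGraph V}

/-- The paths to `x`, `x'` and `y` part at `z`, so `z` branches and is lowered by hanging `y` on
`x`. At degree four it must lose two: `y` then joins `x` to `x'`, and `y'` is hung on `s`. -/
lemma Opt.oblique_cubic_same_end {r x x' y y' z s : V} (h : Opt G T r)
    (hx : dg T x = 3) (hx' : dg T x' = 3) (hyz : T.Adj y z)
    (hyy : T.Adj y y') (hyz' : y' ≠ z) (hxy : G.Adj x y) (hxy' : G.Adj x' y)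
    (hz : nx T y x = z) (hz' : nx T y x' = z) (hzx : z ≠ x) (hzx' : z ≠ x')
    (hs : s = x ∨ s = x') (hsy : G.Adj s y') (hzz : nx T z x ≠ nx T z x')
    (hzy : nx T z x ≠ y) (hzy' : nx T z x' ≠ y) : False := by
  have hT := h.tree
  have hyxn := hxy.ne
  have hyxn' := hxy'.ne
  have hyzn := hyz.ne
  have hyyn := hyy.ne
  have ha := nx_adj hT hzx
  have hb := nx_adj hT hzx'
  have h3 := three_le_dg ha hb hyz.symm hzz hzy hzy'
  by_cases h4 : dg T z = 4
  · have nyz := nx_self_adj hT hyz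
    have nb := nx_self_adj hT hb
    have kb : nx T y (nx T z x') = z := by
      rw [← nx_congr_adj hT hb hyzn (Ne.symm hzy'), nyz]
    have hzy'' : z ≠ y' := hyz'.symm
    have hsz : s ≠ z := by rcases hs with rfl | rfl <;> simp [hzx.symm, hzx'.symm]
    generalize hbe : nx T z x' = b at *
    have hbn := hb.ne
    refine h.not_surg_branch [(z, y), (y', y), (b, z)] [(x, y), (x', y), (s, y')] z
      ?_ ?_ ?_ h3 ?_ ?_ ?_
    · simp [hyz.symm, hyy.symm, hb.symm]
    · simp
      grind
    · simp [hxy, hxy', hsy]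
    · simp [h4, hzx, hzx', hyzn.symm, hzy'', hbn, hsz.symm]
    · intro v hv
      simp
      grind
    · intro κ hA hS
      have := hS x z (by simp [hz, nyz, hzz, hbn])
      have := hS x' b (by simp [hz', kb, hbe, nb])
      simp at hA ⊢
      grind
  · refine h.not_surg [(z, y)] [(x, y)] x x z 1 0 1 ?_ ?_ ?_ h3 hx hx hzx.symm hzx.symm
      ?_ (absurd rfl) ?_ (five_le_or (by omega)) ?_ ?_
    · simp [hyz.symm]
    · simp
    · simp [hxy]
    · simp [hyxn, hzx.symm]
    · simp [hzx, hyzn.symm]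
    · intro v hv
      simp
      grind
    · intro κ hA hS
      have := hS x z (by simp [hz, nx_self_adj hT hyz])
      simp at hA ⊢
      grind

/-- The junction `J` pays for the degrees gained at `x` and `x'`. From degree four on, it can pay if
its neighbour towards `x` or towards `y` is adjacent to a further tree neighbour. Otherwise
claw-freeness makes the neighbour towards `x'` adjacent to a fourth one, and these two are cut off
instead. -/
lemma Opt.oblique_cubic_same_junction {r x x' y y' z J : V} (h : Opt G T r) (hclaw : IsClawFree G)
    (hx : dg T x = 3) (hx' : dg T x' = 3) (hxx : x ≠ x') (hyz : T.Adj y z)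
    (hyy : T.Adj y y') (hyz' : y' ≠ z) (hxy : G.Adj x y) (hxy' : G.Adj x' y)
    (hz : nx T y x = z) (hz' : nx T y x' = z) (hxz : G.Adj x z)
    (hs : G.Adj x y' ∨ G.Adj x' y') (hJy : J ≠ y) (hJx : J ≠ x) (hJx' : J ≠ x') (hJz : J ≠ z)
    (hab : nx T J x ≠ nx T J x') (hac : nx T J x ≠ nx T J y) (hbc : nx T J x' ≠ nx T J y) :
    False := by
  have hT := h.tree
  have hyxn := hxy.ne
  have hyxn' := hxy'.ne
  have hyzn := hyz.ne
  have hyyn := hyy.ne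
  have hzx := hxz.ne'
  have ha := nx_adj hT hJx
  have hb := nx_adj hT hJx'
  have hc := nx_adj hT hJy
  have h3 := three_le_dg ha hb hc hab hac hbc
  have nyz := nx_self_adj hT hyz
  have nyy := nx_self_adj hT hyy
  have hyJ : nx T y J = z := by rw [← nx_through hT hJy hac, hz]
  have hJy' : J ≠ y' := by
    rintro rfl
    exact hyz' (by rw [← hyJ, nyy])
  have key : ∀ q, T.Adj J q → q ≠ y ∧ nx T y q = z := by
    intro q hq
    have : y ≠ q := by
      rintro rfl
      rw [nx_self_adj hT hq.symm] at hyJ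
      exact hJz hyJ
    exact ⟨this.symm, by rw [← nx_congr_adj hT hq hJy.symm this, hyJ]⟩
  have hwx : x ≠ y' ∧ x' ≠ y' := by
    constructor <;> rintro rfl
    · exact hyz' (by rw [← hz, nyy])
    · exact hyz' (by rw [← hz', nyy])
  obtain ⟨hxy'n, hx'y'n⟩ := hwx
  have na := nx_self_adj hT ha
  have nb := nx_self_adj hT hb
  have nc := nx_self_adj hT hc
  have nz : nx T J z = nx T J y := (nx_congr_adj hT hyz hJy hJz).symm
  obtain ⟨hay, ka⟩ := key _ ha
  obtain ⟨hby, kb⟩ := key _ hb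
  obtain ⟨hcy, kc⟩ := key _ hc
  generalize hae : nx T J x = a at *
  generalize hbe : nx T J x' = b at *
  generalize hce : nx T J y = c at *
  have han := ha.ne
  have hbn := hb.ne
  have hcn := hc.ne
  have hx'z : x' ≠ z := by
    rintro rfl
    exact hbc (hbe.symm.trans nz)
  by_cases hJ3 : dg T J = 3
  · refine h.not_surg [(z, y), (a, J)] [(x', y), (x, z)] x x' J 1 1 1 ?_ ?_ ?_ h3 hx hx'
      hJx.symm hJx'.symm ?_ ?_ ?_ (Or.inl hJ3.le) ?_ ?_
    · simp [hyz.symm, ha.symm]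
    · simp
      grind
    · simp [hxy', hxz]
    · simp [hyxn, hxx, hzx.symm]
    · simp [hyxn', hxx.symm, hx'z]
    · simp [hJx, hJx', hJy, hJz, han]
    · intro v hv
      simp
      grind
    · intro κ hA hS
      have := hS x a (by simp [hz, ka, hae, na])
      have := hS x' J (by simp [hz', hyJ, hbe, hab.symm, han])
      have := hS z J (by simp [nyz, hyJ, nz, hac.symm, han])
      simp at hA ⊢
      grind
  have hJ4 : 4 ≤ dg T J := by omega
  have nonisolated : ∀ q, T.Adj J q → q ≠ a → q ≠ c → ¬ G.Adj a q ∧ ¬ G.Adj c q := by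
    intro q hq hqa hqc
    have nq := nx_self_adj hT hq
    obtain ⟨hqy, kq⟩ := key _ hq
    have hqn := hq.ne
    constructor
    · intro hadj
      refine h.not_surg [(z, y), (a, J), (q, J)] [(x', y), (x, z), (a, q)] x x' J 1 1 2
        ?_ ?_ ?_ h3 hx hx' hJx.symm hJx'.symm ?_ ?_ ?_ (four_le_or hJ4) ?_ ?_
      · simp [hyz.symm, ha.symm, hq.symm]
      · simp
        grind
      · simp [hxy', hxz, hadj]
      · simp [hyxn, hxx, hzx.symm]
        grind
      · simp [hyxn', hxx.symm, hx'z]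
        grind
      · simp [hJx, hJx', hJy, hJz, han, hqn]
      · intro v hv
        simp
        grind
      · intro κ hA hS
        have := hS x a (by simp [hz, ka, hae, na])
        have := hS z J (by simp [nyz, hyJ, nz, hac.symm, Ne.symm hqc, han, hqn])
        by_cases hqb : q = b
        · subst hqb
          have := hS x' q (by simp [hz', kq, hbe, nq])
          simp at hA ⊢
          grind
        · have := hS x' J (by simp [hz', hyJ, hbe, hab.symm, han, hqn, Ne.symm hqb])
          simp at hA ⊢
          grind
    · intro hadj
      refine h.not_surg [(z, y), (c, J), (q, J)] [(x', y), (x, z), (c, q)] x x' J 1 1 2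
        ?_ ?_ ?_ h3 hx hx' hJx.symm hJx'.symm ?_ ?_ ?_ (four_le_or hJ4) ?_ ?_
      · simp [hyz.symm, hc.symm, hq.symm]
      · simp
        grind
      · simp [hxy', hxz, hadj]
      · simp [hyxn, hxx, hzx.symm]
        grind
      · simp [hyxn', hxx.symm, hx'z]
        grind
      · simp [hJx, hJx', hJy, hJz, hcn, hqn]
      · intro v hv
        simp
        grind
      · intro κ hA hS
        have := hS x J (by simp [hz, hyJ, hae, hac, Ne.symm hqa, hcn, hqn])
        have := hS z c (by simp [nyz, kc, nz, nc])
        by_cases hqb : q = b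
        · subst hqb
          have := hS x' q (by simp [hz', kq, hbe, nq])
          simp at hA ⊢
          grind
        · have := hS x' J (by simp [hz', hyJ, hbe, hbc, hcn, hqn, Ne.symm hqb])
          simp at hA ⊢
          grind
  obtain ⟨q, hq, hqn⟩ := exists_ne_of_dg T J {a, b, c}
    ((Finset.card_le_three).trans_lt (by omega))
  simp only [Finset.mem_insert, Finset.mem_singleton, not_or] at hqn
  obtain ⟨hqa, hqb, hqc⟩ := hqn
  have nq := nx_self_adj hT hq
  have hqn := hq.ne
  obtain ⟨hqy, kq⟩ := key _ hq
  have hbq : G.Adj b q := by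
    rcases hclaw.adj_or (h.le ha) (h.le hb) (h.le hq) hab (Ne.symm hqa) (Ne.symm hqb) with e | e | e
    · exact absurd e (nonisolated b hb hab.symm hbc).1
    · exact absurd e (nonisolated q hq hqa hqc).1
    · exact e
  by_cases hxy'' : G.Adj x y'
  · refine h.not_surg [(y', y), (b, J), (q, J)] [(x, y'), (x', y), (b, q)] x x' J 1 1 2
      ?_ ?_ ?_ h3 hx hx' hJx.symm hJx'.symm ?_ ?_ ?_ (four_le_or hJ4) ?_ ?_
    · simp [hyy.symm, hb.symm, hq.symm]
    · simp
      grind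
    · simp [hxy', hxy'', hbq]
    · simp [hyxn, hxx, hxy'n]
      grind
    · simp [hyxn', hxx.symm, hx'y'n]
      grind
    · simp [hJx, hJx', hJy, hJy', hbn, hqn]
    · intro v hv
      simp
      grind
    · intro κ hA hS
      have := hS x' b (by simp [hz', kb, hbe, nb])
      have := hS x J (by simp [hz, hyJ, hae, hab, hbn, hqn, Ne.symm hqa])
      have := hS y J (by simp [hyyn, hyJ, hyz'.symm, hce, hbc.symm, hbn, hqn, Ne.symm hqc])
      simp at hA ⊢
      grind
  have hx'y' := hs.resolve_left hxy''
  -- With `x'` rising by two, a loss of two at `J` is enough at degree four and from six on. At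
  -- degree five `J` is brought down to degree two at once.
  by_cases hJ5 : dg T J = 5
  · refine h.not_surg_branch [(z, y), (y', y), (b, J), (q, J), (c, J)]
      [(x, y), (x', y), (x, z), (x', y'), (b, q)] J ?_ ?_ ?_ h3 ?_ ?_ ?_
    · simp [hyz.symm, hyy.symm, hb.symm, hq.symm, hc.symm]
    · simp
      grind
    · simp [hxy', hxy, hxz, hx'y', hbq]
    · simp [hJ5, hJx, hJx', hJy, hJy', hJz, hbn, hqn, hcn]
    · intro v hv
      simp
      grind
    · intro κ hA hS
      have := hS x' b (by simp [hz', kb, hbe, nb])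
      have := hS x J (by simp [hz, hyJ, hae, hab, hac, hbn, hqn, hcn, Ne.symm hqa])
      have := hS z c (by simp [nyz, kc, nz, nc])
      simp at hA ⊢
      grind
  · refine h.not_surg [(y', y), (b, J), (q, J)] [(x', y'), (x', y), (b, q)] x' x' J 2 0 2
      ?_ ?_ ?_ h3 hx' hx' hJx'.symm hJx'.symm ?_ (absurd rfl) ?_ ?_ ?_ ?_
    · simp [hyy.symm, hb.symm, hq.symm]
    · simp
      grind
    · simp [hxy', hx'y', hbq]
    · simp [hyxn', hx'y'n]
      grind
    · simp [hJx', hJy, hJy', hbn, hqn]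
    · by_cases e : dg T J = 4
      · exact Or.inl e.le
      · right
        obtain ⟨p, hp⟩ : ∃ p, dg T J = p + 6 := ⟨dg T J - 6, by omega⟩
        rw [hp, show p + 6 - 2 = p + 4 by omega]
        nlinarith
    · intro v hv
      simp
      grind
    · intro κ hA hS
      have := hS x' b (by simp [hz', kb, hbe, nb])
      have := hS y J (by simp [hyyn, hyJ, hyz'.symm, hce, hbc.symm, hbn, hqn, Ne.symm hqc])
      simp at hA ⊢
      grind

/-- Since `x` separates `x'` from `y`, the edges at `y` can usually take over the connection and
leave `x` with degree two. Only when `z` is adjacent to `x'` but not to `x` is the blocking vertex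
needed. -/
lemma Opt.oblique_cubic_same_between {r x x' y y' z c : V} (h : Opt G T r) (hclaw : IsClawFree G)
    (hx : dg T x = 3) (hx' : dg T x' = 3) (hy2 : dg T y = 2) (hyz : T.Adj y z)
    (hyy : T.Adj y y') (hyz' : y' ≠ z) (hxy : G.Adj x y) (hxy' : G.Adj x' y)
    (hz : nx T y x = z) (hz' : nx T y x' = z) (hxz : z = x ∨ G.Adj x z ∨ G.Adj x' z)
    (hs : G.Adj x y' ∨ G.Adj x' y') (hne : nx T x x' ≠ nx T x y) (hc : Blocks G T x x' c) :
    False := by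
  have hT := h.tree
  have hyxn := hxy.ne
  have hyxn' := hxy'.ne
  have hyzn := hyz.ne
  have hyyn := hyy.ne
  have hxx : x ≠ x' := by
    rintro rfl
    obtain ⟨-, -, -, e, -⟩ := hc
    exact e rfl
  have nyz := nx_self_adj hT hyz
  have nyy := nx_self_adj hT hyy
  obtain ⟨hxy'n, hx'y'n⟩ : x ≠ y' ∧ x' ≠ y' := by
    constructor <;> rintro rfl
    · exact hyz' (by rw [← hz, nyy])
    · exact hyz' (by rw [← hz', nyy])
  have ha := nx_adj hT hxx
  have hb := nx_adj hT hyxn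
  have na := nx_self_adj hT ha
  have nb := nx_self_adj hT hb
  obtain ⟨f, hf, hfa, hfb, -⟩ := exists_third T hx ha hb hne
  generalize hae : nx T x x' = a at *
  generalize hbe : nx T x y = b at *
  have han := ha.ne
  have hbn := hb.ne
  have hfn := hf.ne
  by_cases hTxy : T.Adj x y
  · have : b = y := by rw [← hbe, nx_self_adj hT hTxy]
    subst this
    refine h.not_surg_branch [(b, x)] [(x', b)] x ?_ ?_ ?_ (by omega) ?_ ?_ ?_
    · simp [hTxy.symm]
    · simp
    · simp [hxy']
    · simp [hx, hxx, hyxn]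
    · intro v hv
      simp
      grind
    · intro κ hA hS
      have := hS x' x (by simp [hae, hne, hbn])
      simp at hA ⊢
      grind
  have hzx : z ≠ x := by
    rintro rfl
    exact hTxy hyz.symm
  have nz : nx T x z = b := by rw [← nx_congr_adj hT hyz hyxn hzx.symm, hbe]
  have hx'z : x' ≠ z := by
    rintro rfl
    exact hne (hae.symm.trans nz)
  have key : ∀ q, T.Adj x q → q ≠ y ∧ nx T y q = z := by
    intro q hq
    have : y ≠ q := by
      rintro rfl
      exact hTxy hq
    exact ⟨this.symm, by rw [← nx_congr_adj hT hq hyxn.symm this, hz]⟩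
  obtain ⟨hay, ka⟩ := key _ ha
  obtain ⟨hby, kb⟩ := key _ hb
  obtain ⟨hfy, kf⟩ := key _ hf
  by_cases hx'y' : G.Adj x' y'
  · refine h.not_surg_branch [(y', y), (b, x)] [(x', y'), (x', y)] x ?_ ?_ ?_ (by omega) ?_ ?_ ?_
    · simp [hyy.symm, hb.symm]
    · simp
      grind
    · simp [hxy', hx'y']
    · simp [hx, hxx, hyxn, hbn, hxy'n]
    · intro v hv
      simp
      grind
    · intro κ hA hS
      have := hS x' x (by simp [hz', hz, hae, hne, hbn])
      have := hS y b (by simp [hyyn, kb, hyz'.symm, hbe, nb])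
      simp at hA ⊢
      grind
  have hxy'' := hs.resolve_right hx'y'
  by_cases g1 : G.Adj a f
  · refine h.not_surg_branch [(y', y), (a, x), (f, x)] [(x, y'), (x', y), (a, f)] x
      ?_ ?_ ?_ (by omega) ?_ ?_ ?_
    · simp [hyy.symm, ha.symm, hf.symm]
    · simp
      grind
    · simp [hxy', hxy'', g1]
    · simp [hx, hxx, hyxn, han, hfn, hxy'n]
    · intro v hv
      simp
      grind
    · intro κ hA hS
      have := hS x' a (by simp [hz', ka, hae, na])
      have := hS y x (by simp [hyyn, hz, hyz'.symm, hbe, hne.symm, Ne.symm hfb, han, hfn])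
      simp at hA ⊢
      grind
  by_cases g2 : G.Adj b f
  · refine h.not_surg_branch [(y', y), (b, x), (f, x)] [(x, y'), (x', y), (b, f)] x
      ?_ ?_ ?_ (by omega) ?_ ?_ ?_
    · simp [hyy.symm, hb.symm, hf.symm]
    · simp
      grind
    · simp [hxy', hxy'', g2]
    · simp [hx, hxx, hyxn, hbn, hfn, hxy'n]
    · intro v hv
      simp
      grind
    · intro κ hA hS
      have := hS x' x (by simp [hz', hz, hae, hne, Ne.symm hfa, hbn, hfn])
      have := hS y b (by simp [hyyn, kb, hyz'.symm, hbe, nb])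
      simp at hA ⊢
      grind
  have g3 : G.Adj a b := by
    rcases hclaw.adj_or (h.le ha) (h.le hb) (h.le hf) hne (Ne.symm hfa) (Ne.symm hfb) with e | e | e
    · exact e
    · exact absurd e g1
    · exact absurd e g2
  by_cases hxz' : G.Adj x z
  · refine h.not_surg_branch [(z, y), (a, x), (b, x)] [(x, z), (x', y), (a, b)] x
      ?_ ?_ ?_ (by omega) ?_ ?_ ?_
    · simp [hyz.symm, ha.symm, hb.symm]
    · simp
      grind
    · simp [hxy', hxz', g3]
    · simp [hx, hxx, hyxn, han, hbn, hzx.symm]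
    · intro v hv
      simp
      grind
    · intro κ hA hS
      have := hS x' a (by simp [hz', ka, hae, na])
      have := hS b z (by simp [kb, nyz, nz, nb])
      simp at hA ⊢
      grind
  have hx'z' : G.Adj x' z := (hxz.resolve_left hzx).resolve_left hxz'
  obtain ⟨hc3, hcx, hcx', hcne, hcb⟩ := hc
  have hcy : c ≠ y := ne_of_dg (T := T) (by omega)
  have hxc : nx T x c = a := by rw [← nx_through hT hcx hcne.symm, hae]
  have hcz : c ≠ z := by
    rintro rfl
    exact hne (hxc.symm.trans nz)
  have ncy : nx T c y = nx T c x := nx_through hT hcx.symm (by rw [hbe, hxc]; exact hne.symm)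
  have ncz : nx T c z = nx T c x := by rw [← ncy, nx_congr_adj hT hyz hcy hcz]
  have nyc : nx T y c = z := by
    rw [nx_through hT (p := y) (q := x) hyxn (by rw [hbe, hxc]; exact hne), hz]
  have key' : ∀ q, T.Adj c q → q ≠ y ∧ nx T y q = z := by
    intro q hq
    have : y ≠ q := by
      rintro rfl
      rw [nx_self_adj hT hq.symm] at nyc
      exact hcz nyc
    exact ⟨this.symm, by rw [← nx_congr_adj hT hq hcy.symm this, nyc]⟩
  have hd := nx_adj hT hcx
  have he := nx_adj hT hcx'
  have nd := nx_self_adj hT hd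
  have ne := nx_self_adj hT he
  obtain ⟨hdy, kd⟩ := key' _ hd
  obtain ⟨hey, ke⟩ := key' _ he
  generalize hde : nx T c x = d at *
  generalize hee : nx T c x' = e at *
  have hdn := hd.ne
  have hen := he.ne
  by_cases hc3' : dg T c = 3
  · refine h.not_surg [(z, y), (d, c)] [(x, y), (x', z)] x x' c 1 1 1 ?_ ?_ ?_ hc3 hx hx'
      hcx.symm hcx'.symm ?_ ?_ ?_ (Or.inl hc3'.le) ?_ ?_
    · simp [hyz.symm, hd.symm]
    · simp
      grind
    · simp [hxy, hx'z']
    · simp [hyxn, hxx, hzx.symm]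
    · simp [hyxn', hxx.symm, hx'z]
    · simp [hcx, hcx', hcy, hcz, hdn]
    · intro v hv
      simp
      grind
    · intro κ hA hS
      have := hS x d (by simp [hz, kd, hde, nd])
      have := hS x z (by simp [hz, nyz, hde, ncz])
      have := hS x' c (by simp [hz', nyc, hee, hcne.symm, hdn])
      simp at hA ⊢
      grind
  obtain ⟨q, hq, hqd, hqe, hadj⟩ := hcb.resolve_left hc3'
  have nq := nx_self_adj hT hq
  obtain ⟨hqy, kq⟩ := key' _ hq
  have hqn := hq.ne
  rcases hadj with hadj | hadj
  · refine h.not_surg [(z, y), (d, c), (q, c)] [(x, y), (x', z), (d, q)] x x' c 1 1 2 ?_ ?_ ?_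
      hc3 hx hx' hcx.symm hcx'.symm ?_ ?_ ?_ (four_le_or (by omega)) ?_ ?_
    · simp [hyz.symm, hd.symm, hq.symm]
    · simp
      grind
    · simp [hxy, hx'z', hadj]
    · simp [hyxn, hxx, hzx.symm]
      grind
    · simp [hyxn', hxx.symm, hx'z]
      grind
    · simp [hcx, hcx', hcy, hcz, hdn, hqn]
    · intro v hv
      simp
      grind
    · intro κ hA hS
      have := hS x d (by simp [hz, kd, hde, nd])
      have := hS x z (by simp [hz, nyz, hde, ncz])
      have := hS x' c (by simp [hz', nyc, hee, hcne.symm, hdn, hqn, Ne.symm hqe])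
      simp at hA ⊢
      grind
  · refine h.not_surg [(z, y), (e, c), (q, c)] [(x, y), (x', z), (e, q)] x x' c 1 1 2 ?_ ?_ ?_
      hc3 hx hx' hcx.symm hcx'.symm ?_ ?_ ?_ (four_le_or (by omega)) ?_ ?_
    · simp [hyz.symm, he.symm, hq.symm]
    · simp
      grind
    · simp [hxy, hx'z', hadj]
    · simp [hyxn, hxx, hzx.symm]
      grind
    · simp [hyxn', hxx.symm, hx'z]
      grind
    · simp [hcx, hcx', hcy, hcz, hen, hqn]
    · intro v hv
      simp
      grind
    · intro κ hA hS
      have := hS x' e (by simp [hz', ke, hee, ne])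
      have := hS x z (by simp [hz, nyz, hde, ncz])
      have := hS x c (by simp [hz, nyc, hde, hcne, hen, hqn, Ne.symm hqd])
      simp at hA ⊢
      grind

/-- No tree edge is oblique at the same end to two cubic vertices that are blocked. -/
lemma Opt.oblique_cubic_same {r x x' y z c : V} (h : Opt G T r) (hclaw : IsClawFree G)
    (hx : dg T x = 3) (hx' : dg T x' = 3) (hxr : x ≠ r) (hyz : T.Adj y z)
    (hxy : G.Adj x y) (hxy' : G.Adj x' y) (hz : nx T y x = z) (hz' : nx T y x' = z)
    (hc : Blocks G T x x' c) : False := by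
  have hT := h.tree
  have hnxx := h.not_adj_cubic hx hx' hc
  have hxx : x ≠ x' := by
    rintro rfl
    obtain ⟨-, -, -, e, -⟩ := hc
    exact e rfl
  have hyxn := hxy.ne'
  have hyxn' := hxy'.ne'
  have hwx : ∀ w, T.Adj y w → w ≠ z → w ≠ x ∧ w ≠ x' := by
    intro w hw hwz
    constructor <;> rintro rfl
    · exact hwz (by rw [← hz, nx_self_adj hT hw])
    · exact hwz (by rw [← hz', nx_self_adj hT hw])
  have harm : ∀ w, T.Adj y w → w ≠ z → G.Adj x w ∨ G.Adj x' w := by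
    intro w hw hwz
    obtain ⟨h1, h2⟩ := hwx w hw hwz
    rcases hclaw.adj_or hxy.symm hxy'.symm (h.le hw) hxx h1.symm h2.symm with e | e | e
    · exact absurd e hnxx
    · exact Or.inl e
    · exact Or.inr e
  -- A leaf would be adjacent to the cubic vertex `x`, and at a branch vertex `exists_arm`
  -- contradicts `harm`.
  have hy2 : dg T y = 2 := by
    have h1 := one_le_dg hyz
    have h2 : dg T y ≠ 1 := fun e => h.not_adj_leaf (h.not_bad hclaw) hx hxr e hxy
    by_contra hcon
    obtain ⟨w, hw, hwz, hwn⟩ := h.exists_arm (y := y) (z := z) (by omega) hyz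
    rcases harm w hw hwz with e | e
    · exact hwn x hx hz e
    · exact hwn x' hx' hz' e
  obtain ⟨y', hyy, hyz', -⟩ := exists_second T hy2 hyz
  have hs := harm y' hyy hyz'
  have hzadj : z = x ∨ z = x' ∨ G.Adj x z ∨ G.Adj x' z := by
    by_cases h1 : z = x
    · exact Or.inl h1
    by_cases h2 : z = x'
    · exact Or.inr (Or.inl h2)
    rcases hclaw.adj_or hxy.symm hxy'.symm (h.le hyz) hxx (Ne.symm h1) (Ne.symm h2) with e | e | e
    · exact absurd e hnxx
    · tauto
    · tauto
  obtain ⟨J, j1, j2, j3⟩ := exists_junction hT x x' y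
  have hJy : J ≠ y := by
    rintro rfl
    exact j1 hyxn hyxn' (hz.trans hz'.symm)
  by_cases hJx : J = x
  · subst hJx
    refine h.oblique_cubic_same_between hclaw hx hx' hy2 hyz hyy hyz' hxy hxy' hz hz' ?_ hs
      (j3 hxx hJy) hc
    rcases hzadj with e | rfl | e
    · exact Or.inl e
    · exfalso
      refine j3 hxx hJy (nx_congr_adj hT hyz.symm hxx hJy)
    · exact Or.inr e
  by_cases hJx' : J = x'
  · subst hJx'
    refine h.oblique_cubic_same_between hclaw hx' hx hy2 hyz hyy hyz' hxy' hxy hz' hz ?_ hs.symm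
      (j2 hJx hJy) hc.symm
    rcases hzadj with rfl | e | e
    · exfalso
      refine j2 hJx hJy (nx_congr_adj hT hyz.symm hJx hJy)
    · exact Or.inl e
    · exact Or.inr e.symm
  have hab := j1 hJx hJx'
  have hac := j2 hJx hJy
  have hbc := j3 hJx' hJy
  by_cases hJz : J = z
  · subst hJz
    rw [nx_self_adj hT hyz.symm] at hac hbc
    rcases hs with hs | hs
    · exact h.oblique_cubic_same_end hx hx' hyz hyy hyz' hxy hxy' hz hz' hJx hJx' (Or.inl rfl) hs
        hab hac hbc
    · exact h.oblique_cubic_same_end hx hx' hyz hyy hyz' hxy hxy' hz hz' hJx hJx' (Or.inr rfl) hs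
        hab hac hbc
  rcases hzadj with rfl | rfl | e | e
  · exact absurd (nx_congr_adj hT hyz.symm hJz hJy) hac
  · exact absurd (nx_congr_adj hT hyz.symm hJz hJy) hbc
  · exact h.oblique_cubic_same_junction hclaw hx hx' hxx hyz hyy hyz' hxy hxy' hz hz' e hs hJy
      hJx hJx' hJz hab hac hbc
  · exact h.oblique_cubic_same_junction hclaw hx' hx hxx.symm hyz hyy hyz' hxy' hxy hz' hz e
      hs.symm hJy hJx' hJx hJz hab.symm hbc hac

end CubicSame

/-! ### Edges at branch vertices that are oblique to no selected vertex -/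

section Unused

variable {V : Type*} [Fintype V] {G T T' : SimpleGraph V}

/-- The tree edge `vd` is oblique to `x`. -/
def Uses (G T : SimpleGraph V) (x v d : V) : Prop :=
  (G.Adj x v ∧ nx T v x = d) ∨ (G.Adj x d ∧ nx T d x = v)

lemma nx_root_of_child (hT : T.IsTree) {r d v : V} (h : T.Adj d v) (hv : v ≠ nx T d r) :
    v ≠ r ∧ nx T v r = d := by
  refine ⟨?_, nx_eq hT h.symm ?_⟩
  · rintro rfl
    exact hv (nx_self_adj hT h).symm
  · have := farther hT (s := r) h (Ne.symm hv)
    omega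

lemma anc_of_nx_child {r d v x : V} (hv : v ≠ nx T d r) (hx : d ≠ x) (h : nx T d x = v) :
    anc T r d x := ⟨hx, by rwa [h]⟩

/-- A tree edge from a cubic vertex to a paired tree neighbour is not oblique to another
branch vertex. -/
lemma Opt.cubic_unused {r d v w x : V} (h : Opt G T r) (hd : dg T d = 3) (hv : T.Adj d v)
    (hw : T.Adj d w) (hvw : G.Adj v w) (hx : dg T x = 3) (hxd : x ≠ d) : ¬ Uses G T x v d := by
  have hT := h.tree
  have hvn := hv.ne
  have hwn := hw.ne
  have nv := nx_self_adj hT hv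
  rintro (⟨hxv, hn⟩ | ⟨hxv, hn⟩)
  · have hdx : nx T d x ≠ v := (nx_swap hT hv.symm).1 hn
    have := hxv.ne
    refine h.not_surg_branch [(v, d)] [(x, v)] d ?_ ?_ ?_ (by omega) ?_ ?_ ?_
    · simp [hv.symm]
    · simp
    · simp [hxv]
    · simp [hd, hxd.symm, hvn]
    · intro v hv
      simp
      grind
    · intro κ hA hS
      have := hS x d (by simp [hdx, hvn])
      simp at hA ⊢
      grind
  · have := hvw.ne
    refine h.not_surg_branch [(v, d), (w, d)] [(x, d), (v, w)] d ?_ ?_ ?_ (by omega) ?_ ?_ ?_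
    · simp [hv.symm, hw.symm]
    · simp
      grind
    · simp [hxv, hvw]
    · simp [hd, hxd.symm, hvn, hwn]
    · intro v hv
      simp
      grind
    · intro κ hA hS
      have := hS x v (by simp [hn, nv])
      simp at hA ⊢
      grind

/-- Trading `dv`, `dw` for `xd`, `vw` takes place entirely at or below `d` and moves one degree from
`d` to `x`. -/
lemma Opt.not_adj_of_child {r d v w x : V} (h : Opt G T r) (hd : 3 ≤ dg T d) (hv : T.Adj d v)
    (hw : T.Adj d w) (hvr : v ≠ nx T d r) (hwr : w ≠ nx T d r) (hvw : G.Adj v w)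
    (hx : dg T x = 3) (hxd : x ≠ d) (hn : nx T d x = v) : ¬ G.Adj x d := by
  intro hxv
  have hT := h.tree
  have hvn := hv.ne
  have hwn := hw.ne
  have nv := nx_self_adj hT hv
  have nw := nx_self_adj hT hw
  have := hvw.ne
  have ax := anc_of_nx_child hvr hxd.symm hn
  have av := anc_of_nx_child hvr hvn nv
  have aw := anc_of_nx_child hwr hwn nw
  refine h.not_surg_below [(v, d), (w, d)] [(x, d), (v, w)] x d ?_ ?_ ?_ rfl hd hx ax
    ?_ ?_ ?_ ?_ ?_ ?_
  · simp [hv.symm, hw.symm]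
  · simp
    grind
  · simp [hxv, hvw]
  · simp [av, aw]
  · simp [av, aw, ax]
  · simp
    grind
  · simp [hxd.symm, hvn, hwn]
  · intro v hv
    simp
    grind
  · intro κ hA hS
    have := hS x v (by simp [hn, nv])
    simp at hA ⊢
    grind

/-- Here `x` lies below another child of `d`; hanging `v` on `x` moves degree downwards. -/
lemma Opt.not_adj_child_of_anc {r d v x : V} (h : Opt G T r) (hd : 3 ≤ dg T d) (hv : T.Adj d v)
    (hvr : v ≠ nx T d r) (hx : dg T x = 3) (hax : anc T r d x) (hn : nx T v x = d) :
    ¬ G.Adj x v := by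
  intro hxv
  have hT := h.tree
  have hvn := hv.ne
  have nv := nx_self_adj hT hv
  have av := anc_of_nx_child hvr hvn nv
  have hdx : nx T d x ≠ v := (nx_swap hT hv.symm).1 hn
  have := hxv.ne
  have hxd := hax.1
  refine h.not_surg_below [(v, d)] [(x, v)] x d ?_ ?_ ?_ rfl hd hx hax ?_ ?_ ?_ ?_ ?_ ?_
  · simp [hv.symm]
  · simp
  · simp [hxv]
  · simp [av]
  · simp [av, hax]
  · simp
    grind
  · simp [hxd, hvn]
  · intro v hv
    simp
    grind
  · intro κ hA hS
    have := hS x d (by simp [hdx, hvn])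
    simp at hA ⊢
    grind

lemma Opt.not_adj_child_of_five_le {r d v x : V} (h : Opt G T r) (hd : 5 ≤ dg T d)
    (hv : T.Adj d v) (hx : dg T x = 3) (hxd : x ≠ d) (hn : nx T v x = d) : ¬ G.Adj x v := by
  intro hxv
  have hT := h.tree
  have hvn := hv.ne
  have hdx : nx T d x ≠ v := (nx_swap hT hv.symm).1 hn
  have := hxv.ne
  refine h.not_surg [(v, d)] [(x, v)] x x d 1 0 1 ?_ ?_ ?_ (by omega) hx hx hxd hxd
    ?_ (absurd rfl) ?_ (five_le_or (by omega)) ?_ ?_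
  · simp [hv.symm]
  · simp
  · simp [hxv]
  · simp
    grind
  · simp [hxd.symm, hvn]
  · intro v hv
    simp
    grind
  · intro κ hA hS
    have := hS x d (by simp [hdx, hvn])
    simp at hA ⊢
    grind

/-- By `not_adj_child_of_anc` both `x` and `x'` lie towards the root, so both children can be rehung
at once and `d` stops branching. -/
lemma Opt.not_adj_children {r d v w x x' : V} (h : Opt G T r) (hd : dg T d = 4)
    (hv : T.Adj d v) (hw : T.Adj d w) (hvw : G.Adj v w) (hvr : v ≠ nx T d r) (hwr : w ≠ nx T d r)
    (hx : dg T x = 3) (hx' : dg T x' = 3) (hxd : x ≠ d) (hxd' : x' ≠ d) (hn : nx T v x = d)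
    (hn' : nx T w x' = d) (hxv : G.Adj x v) : ¬ G.Adj x' w := by
  intro hxw
  have hT := h.tree
  have hvn := hv.ne
  have hwn := hw.ne
  have := hvw.ne
  have := hxv.ne
  have := hxw.ne
  have a1 : nx T d x = nx T d r := by
    by_contra hne
    exact h.not_adj_child_of_anc (by omega) hv hvr hx ⟨hxd.symm, hne⟩ hn hxv
  have a2 : nx T d x' = nx T d r := by
    by_contra hne
    exact h.not_adj_child_of_anc (by omega) hw hwr hx' ⟨hxd'.symm, hne⟩ hn' hxw
  refine h.not_surg_branch [(v, d), (w, d)] [(x, v), (x', w)] d ?_ ?_ ?_ (by omega) ?_ ?_ ?_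
  · simp [hv.symm, hw.symm]
  · simp
    grind
  · simp [hxv, hxw]
  · simp [hd, hxd.symm, hxd'.symm, hvn, hwn]
  · intro v hv
    simp
    grind
  · intro κ hA hS
    have := hS x d (by simp [a1, hvr.symm, hwr.symm, hvn, hwn])
    have := hS x' d (by simp [a2, hvr.symm, hwr.symm, hvn, hwn])
    simp at hA ⊢
    grind

lemma exists_adj_children (hle : T ≤ G) (hclaw : IsClawFree G) {d p : V}
    (hd : 4 ≤ dg T d ∨ 3 ≤ dg T d ∧ ¬ T.Adj d p) :
    ∃ v w, T.Adj d v ∧ T.Adj d w ∧ v ≠ p ∧ w ≠ p ∧ G.Adj v w := by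
  have : 2 < ((Finset.univ.filter (T.Adj d)).erase p).card := by
    rcases hd with hd | ⟨hd, hp⟩
    · have := Finset.pred_card_le_card_erase (s := Finset.univ.filter (T.Adj d)) (a := p)
      unfold dg at hd
      omega
    · rw [Finset.erase_eq_of_notMem (by simpa using hp)]
      exact hd
  obtain ⟨a, b, c, ha, hb, hc, hab, hac, hbc⟩ := Finset.two_lt_card_iff.1 this
  simp only [Finset.mem_erase, Finset.mem_filter, Finset.mem_univ, true_and] at ha hb hc
  rcases hclaw.adj_or (hle ha.2) (hle hb.2) (hle hc.2) hab hac hbc with e | e | e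
  · exact ⟨a, b, ha.2, hb.2, ha.1, hb.1, e⟩
  · exact ⟨a, c, ha.2, hc.2, ha.1, hc.1, e⟩
  · exact ⟨b, c, hb.2, hc.2, hb.1, hc.1, e⟩

/-- Below every branch vertex `d` some edge is not oblique to any leaf or other cubic vertex. -/
lemma Opt.exists_unused {r d : V} (h : Opt G T r) (hclaw : IsClawFree G) (hd : 3 ≤ dg T d) :
    ∃ v, v ≠ r ∧ nx T v r = d ∧ (∃ w, T.Adj d w ∧ G.Adj v w) ∧
      ∀ x, dg T x = 3 → x ≠ d → ¬ Uses G T x v d := by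
  have hT := h.tree
  by_cases hd3 : dg T d = 3
  · have h1 := le_card_paired_fiber hT h.le hclaw r d hd
    obtain ⟨v, hv⟩ := Finset.card_pos.1 (lt_of_lt_of_le (by omega) h1)
    simp only [paired, Finset.mem_filter, Finset.mem_univ, true_and] at hv
    obtain ⟨⟨hvr, -, hw⟩, rfl⟩ := hv
    refine ⟨v, hvr, rfl, hw, fun x hx hxd => ?_⟩
    obtain ⟨w, hw1, hw2⟩ := hw
    exact h.cubic_unused hd3 (nx_adj hT hvr).symm hw1 hw2 hx hxd
  obtain ⟨v, w, hv, hw, hvr, hwr, hvw⟩ := exists_adj_children h.le hclaw (p := nx T d r)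
    (Or.inl (show 4 ≤ dg T d by omega))
  by_cases hu : ∃ x, dg T x = 3 ∧ x ≠ d ∧ Uses G T x v d
  · obtain ⟨x, hx, hxd, hxu⟩ := hu
    obtain ⟨h1, h2⟩ := nx_root_of_child hT hw hwr
    refine ⟨w, h1, h2, ⟨v, hv, hvw.symm⟩, fun x' hx' hxd' hxu' => ?_⟩
    rcases hxu with ⟨g1, g2⟩ | ⟨g1, g2⟩
    · rcases hxu' with ⟨g3, g4⟩ | ⟨g3, g4⟩
      · by_cases hd4 : dg T d = 4
        · exact h.not_adj_children hd4 hv hw hvw hvr hwr hx hx' hxd hxd' g2 g4 g1 g3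
        · exact h.not_adj_child_of_five_le (by omega) hv hx hxd g2 g1
      · exact h.not_adj_of_child hd hw hv hwr hvr hvw.symm hx' hxd' g4 g3
    · exact h.not_adj_of_child hd hv hw hvr hwr hvw hx hxd g2 g1
  · push Not at hu
    obtain ⟨h1, h2⟩ := nx_root_of_child hT hv hvr
    exact ⟨v, h1, h2, ⟨w, hw, hvw⟩, hu⟩

/-- At the root there are two edges not oblique to any leaf or other cubic vertex. -/
lemma Opt.exists_unused_root {r : V} (h : Opt G T r) (hclaw : IsClawFree G) :
    ∃ v w, v ≠ w ∧ ∀ u, u = v ∨ u = w → u ≠ r ∧ nx T u r = r ∧ (∃ w, T.Adj r w ∧ G.Adj u w) ∧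
      ∀ x, dg T x = 3 → x ≠ r → ¬ Uses G T x u r := by
  have hT := h.tree
  obtain ⟨v, w, hv, hw, hvr, hwr, hvw⟩ := exists_adj_children h.le hclaw (p := r)
    (Or.inr ⟨h.root, T.irrefl⟩)
  -- All other vertices lie below the root, so no user can come from above and both members of an
  -- adjacent pair of children qualify.
  have key : ∀ {v w}, T.Adj r v → T.Adj r w → v ≠ r → w ≠ r → G.Adj v w →
      v ≠ r ∧ nx T v r = r ∧ (∃ w, T.Adj r w ∧ G.Adj v w) ∧
      ∀ x, dg T x = 3 → x ≠ r → ¬ Uses G T x v r := by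
    intro v w hv hw hvr hwr hvw
    refine ⟨hvr, nx_self_adj hT hv.symm, ⟨w, hw, hvw⟩, fun x hx hxr hxu => ?_⟩
    rcases hxu with ⟨g1, g2⟩ | ⟨g1, g2⟩
    · refine h.not_adj_child_of_anc h.root hv (by rwa [nx_self]) hx ⟨hxr.symm, ?_⟩ g2 g1
      rw [nx_self]
      exact nx_ne_self hT hxr.symm
    · exact h.not_adj_of_child h.root hv hw (by rwa [nx_self]) (by rwa [nx_self]) hvw hx hxr g2 g1
  refine ⟨v, w, hvw.ne, ?_⟩
  rintro u (rfl | rfl)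
  · exact key hv hw hvr hwr hvw
  · exact key hw hv hwr hvr hvw.symm

end Unused

/-! ### Selecting pairwise blocked cubic vertices -/

section Selection

variable {V : Type*} [Fintype V] {G T T' : SimpleGraph V}

/-- A cubic vertex is linked, without a blocking vertex in between, to at most one other cubic
vertex that has no more branch vertices above it. -/
lemma Opt.linked_unique {r x x' x'' : V} (h : Opt G T r) (hclaw : IsClawFree G)
    (hx : dg T x = 3) (hx' : dg T x' = 3) (hx'' : dg T x'' = 3)
    (h1 : x' ≠ x) (h2 : x'' ≠ x) (hq1 : qd T r x' ≤ qd T r x) (hq2 : qd T r x'' ≤ qd T r x)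
    (hl1 : ∀ c, ¬ Blocks G T x x' c) (hl2 : ∀ c, ¬ Blocks G T x x'' c) : x' = x'' := by
  have hT := h.tree
  by_contra h3
  obtain ⟨c, j1, j2, j3⟩ := exists_junction hT x x' x''
  -- A vertex below `x` would have more branch vertices above it.
  have hup : ∀ v, v ≠ x → qd T r v ≤ qd T r x → nx T x v = nx T x r := by
    intro v hv hq
    by_contra hne
    have := qd_lt_of_anc hT (show 3 ≤ dg T x by omega) (v := v) (r := r) ⟨hv.symm, hne⟩
    omega
  by_cases c1 : c = x
  · subst c1
    exact j3 h1.symm h2.symm ((hup _ h1 hq1).trans (hup _ h2 hq2).symm)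
  by_cases c2 : c = x'
  · subst c2
    exact hl2 c ⟨hx'.ge, c1, h3, j2 c1 h3, Or.inl hx'⟩
  by_cases c3 : c = x''
  · subst c3
    exact hl1 c ⟨hx''.ge, c1, c2, j1 c1 c2, Or.inl hx''⟩
  have a1 := nx_adj hT c1
  have a2 := nx_adj hT c2
  have a3 := nx_adj hT c3
  have n1 := j1 c1 c2
  have n2 := j2 c1 c3
  have n3 := j3 c2 c3
  have hc := three_le_dg a1 a2 a3 n1 n2 n3
  -- Any adjacency among the three neighbours makes the junction a blocking vertex between `x` and
  -- one of the other two.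
  rcases hclaw.adj_or (h.le a1) (h.le a2) (h.le a3) n1 n2 n3 with e | e | e
  · exact hl2 c ⟨hc, c1, c3, n2, Or.inr ⟨_, a2, n1.symm, n3, Or.inl e⟩⟩
  · exact hl1 c ⟨hc, c1, c2, n1, Or.inr ⟨_, a3, n2.symm, n3.symm, Or.inl e⟩⟩
  · exact hl1 c ⟨hc, c1, c2, n1, Or.inr ⟨_, a3, n2.symm, n3.symm, Or.inr e⟩⟩

/-- If every element is related to at most one other element of no larger rank, then half of the
elements are pairwise unrelated. -/
lemma exists_unrelated_half {α : Type*} (R : α → α → Prop)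
    (hR : ∀ a b, R a b → R b a) (f : α → ℕ) (A : Finset α)
    (h : ∀ a ∈ A, ∀ b ∈ A, ∀ c ∈ A, b ≠ a → c ≠ a → f b ≤ f a → f c ≤ f a → R a b → R a c → b = c) :
    ∃ I ⊆ A, A.card ≤ 2 * I.card ∧ ∀ a ∈ I, ∀ b ∈ I, a ≠ b → ¬ R a b := by
  induction hn : A.card using Nat.strong_induction_on generalizing A with
  | _ n ih =>
    by_cases hA : A.Nonempty
    · obtain ⟨a, ha, hmax⟩ := A.exists_max_image f hA
      set A' := A.filter fun b => b ≠ a ∧ ¬ R a b with hA'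
      set N := A.filter fun b => b ≠ a ∧ R a b with hN
      have hN1 : N.card ≤ 1 := by
        rw [Finset.card_le_one]
        intro b hb c hc
        simp only [hN, Finset.mem_filter] at hb hc
        exact h a ha b hb.1 c hc.1 hb.2.1 hc.2.1 (hmax b hb.1) (hmax c hc.1) hb.2.2 hc.2.2
      have hsub : A ⊆ insert a (A' ∪ N) := by
        intro b hb
        simp only [hA', hN, Finset.mem_insert, Finset.mem_union, Finset.mem_filter]
        tauto
      have h1 := Finset.card_le_card hsub
      have h2 := Finset.card_insert_le a (A' ∪ N)
      have h3 := Finset.card_union_le A' N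
      have haA' : a ∉ A' := by simp [hA']
      have hlt : A'.card < n := by
        rw [← hn]
        exact Finset.card_lt_card ⟨Finset.filter_subset _ _, fun hs => haA' (hs ha)⟩
      have hss : A' ⊆ A := Finset.filter_subset _ _
      obtain ⟨I, hI, hc, hind⟩ := ih _ hlt A' (fun x hx y hy z hz =>
        h x (hss hx) y (hss hy) z (hss hz)) rfl
      refine ⟨insert a I, Finset.insert_subset ha (hI.trans hss), ?_, ?_⟩
      · rw [Finset.card_insert_of_notMem fun hi => haA' (hI hi)]
        omega
      · have hal : ∀ b ∈ I, ¬ R a b := fun b hb => (Finset.mem_filter.1 (hI hb)).2.2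
        intro x hx y hy hxy
        rcases Finset.mem_insert.1 hx with rfl | hx <;> rcases Finset.mem_insert.1 hy with rfl | hy
        · exact absurd rfl hxy
        · exact hal y hy
        · exact fun e => hal _ (by assumption) (hR _ _ e)
        · exact hind x hx y hy hxy
    · refine ⟨∅, Finset.empty_subset _, ?_, by simp⟩
      rw [Finset.not_nonempty_iff_eq_empty.1 hA] at hn
      simp at hn
      omega

/-- There are many cubic vertices that are pairwise separated by blocking vertices. -/
lemma Opt.exists_blocked {r : V} (h : Opt G T r) (hclaw : IsClawFree G) {t : ℕ}
    (ht : 2 * t ≤ (Finset.univ.filter fun v => dg T v = 3 ∧ v ≠ r).card + 1) :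
    ∃ X : Finset V, X.card = t ∧ (∀ x ∈ X, dg T x = 3 ∧ x ≠ r) ∧
      ∀ x ∈ X, ∀ x' ∈ X, x ≠ x' → ∃ c, Blocks G T x x' c := by
  obtain ⟨I, hI, hc, hind⟩ := exists_unrelated_half (fun x x' => ∀ c, ¬ Blocks G T x x' c)
    (fun a b hab c hc => hab c hc.symm) (qd T r) (Finset.univ.filter fun v => dg T v = 3 ∧ v ≠ r) (by
      intro a ha b hb c hc
      simp only [Finset.mem_filter, Finset.mem_univ, true_and] at ha hb hc
      exact h.linked_unique hclaw ha.1 hb.1 hc.1)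
  obtain ⟨X, hX, hXc⟩ := Finset.exists_subset_card_eq (show t ≤ I.card by omega)
  refine ⟨X, hXc, fun x hx => by simpa using hI (hX hx), fun x hx x' hx' hne => ?_⟩
  have := hind x (hX hx) x' (hX hx') hne
  push Not at this
  exact this

end Selection

/-! ### Existence of optimal trees -/

section Existence

variable {V : Type*} [Fintype V] {G T T' : SimpleGraph V}

/-- An optimal tree exists for every branch vertex of a tree with the fewest branch vertices. -/
lemma exists_opt {T₀ : SimpleGraph V} {r : V} (hle : T₀ ≤ G) (hT₀ : T₀.IsTree) (hr : 3 ≤ dg T₀ r)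
    (hmin : ∀ T' ≤ G, T'.IsTree → nb T₀ ≤ nb T') :
    ∃ T, Opt G T r ∧ ∀ T', Opt G T' r → dd G T' r ≤ dd G T r := by
  obtain ⟨T, hT, hT2⟩ := Finset.exists_min_image
    (Finset.univ.filter fun T : SimpleGraph V => T ≤ G ∧ T.IsTree ∧ 3 ≤ dg T r ∧ nb T = nb T₀)
    (fun T => toLex (sq T, toLex (om T r, zb G T r))) ⟨T₀, by simp [hle, hT₀, hr]⟩
  simp only [Finset.mem_filter, Finset.mem_univ, true_and] at hT hT2
  obtain ⟨h1, h2, h3, h4⟩ := hT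
  have hopt : Opt G T r := by
    refine ⟨h1, h2, h3, by rwa [h4], ?_, ?_, ?_⟩
    · intro T' a1 a2 a3 a4
      rcases Prod.Lex.toLex_le_toLex.1 (hT2 T' ⟨a1, a2, a3, a4.trans h4⟩) with e | e
      · exact e.le
      · exact e.1.le
    · intro T' a1 a2 a3 a4 a5
      rcases Prod.Lex.toLex_le_toLex.1 (hT2 T' ⟨a1, a2, a3, a4.trans h4⟩) with e | e
      · exact absurd a5 e.ne'
      · rcases Prod.Lex.toLex_le_toLex.1 e.2 with e | e
        · exact e.le
        · exact e.1.le
    · intro T' a1 a2 a3 a4 a5 a6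
      rcases Prod.Lex.toLex_le_toLex.1 (hT2 T' ⟨a1, a2, a3, a4.trans h4⟩) with e | e
      · exact absurd a5 e.ne'
      · rcases Prod.Lex.toLex_le_toLex.1 e.2 with e | e
        · exact absurd a6 e.ne'
        · exact e.2
  obtain ⟨T, hT, hT2⟩ := Finset.exists_max_image
    (Finset.univ.filter fun T : SimpleGraph V => Opt G T r) (fun T => dd G T r) ⟨T, by simp [hopt]⟩
  simp only [Finset.mem_filter, Finset.mem_univ, true_and] at hT hT2
  exact ⟨T, hT, hT2⟩

end Existence

/-! ### The final count -/

section Count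

variable {V : Type*} [Fintype V] {G T T' : SimpleGraph V}

/-- If no tree edge is oblique to two vertices of `S`, then the degree sum of `S` is bounded by the
number of tree edges that are oblique to some vertex of `S`. -/
lemma sum_dg_add_card_lt (hT : T.IsTree) {S W : Finset V} {r : V} (hW : ∀ v ∈ W, v ≠ r)
    (hS : ∀ s ∈ S, ∀ s' ∈ S, s ≠ s' → ∀ y z, T.Adj y z → G.Adj s y → nx T y s = z →
      ¬ (G.Adj s' y ∧ nx T y s' = z) ∧ ¬ (G.Adj s' z ∧ nx T z s' = y))
    (hun : ∀ s ∈ S, ∀ v ∈ W, ¬ Uses G T s v (nx T v r)) :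
    ∑ s ∈ S, dg G s + W.card + 1 ≤ Fintype.card V := by
  set A := S.sigma fun s => Finset.univ.filter (G.Adj s) with hA
  have hAmem : ∀ p : (_ : V) × V, p ∈ A ↔ p.1 ∈ S ∧ G.Adj p.1 p.2 := by
    intro p
    simp [hA]
  have hAcard : A.card = ∑ s ∈ S, dg G s := by
    rw [hA, Finset.card_sigma]
    rfl
  set f : (_ : V) × V → Sym2 V := fun p => s(p.2, nx T p.2 p.1) with hf
  set g : V → Sym2 V := fun v => s(v, nx T v r) with hg
  have hfinj : Set.InjOn f A := by
    rintro ⟨s, y⟩ hp ⟨s', y'⟩ hp' he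
    rw [Finset.mem_coe, hAmem] at hp hp'
    by_cases hss : s = s'
    · subst hss
      obtain rfl : y = y' := parent_edge_inj hT hp.2.ne' hp'.2.ne' he
      rfl
    · exfalso
      obtain ⟨h1, h2⟩ := hS s hp.1 s' hp'.1 hss y _ (nx_adj hT hp.2.ne') hp.2 rfl
      rw [hf, Sym2.eq_iff] at he
      dsimp only at he hp hp'
      rcases he with ⟨e1, e2⟩ | ⟨e1, e2⟩
      · subst e1
        exact h1 ⟨hp'.2, e2.symm⟩
      · rw [e2] at h2
        exact h2 ⟨hp'.2, e1.symm⟩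
  have hginj : Set.InjOn g W := fun v hv w hw he => parent_edge_inj hT (hW v hv) (hW w hw) he
  have hdisj : Disjoint (A.image f) (W.image g) := by
    rw [Finset.disjoint_left]
    intro e he he'
    obtain ⟨⟨s, y⟩, hp, rfl⟩ := Finset.mem_image.1 he
    obtain ⟨v, hv, hev⟩ := Finset.mem_image.1 he'
    rw [hAmem] at hp
    refine hun s hp.1 v hv ?_
    rw [hg, hf, Sym2.eq_iff] at hev
    dsimp only at hev hp
    rcases hev with ⟨e1, e2⟩ | ⟨e1, e2⟩
    · subst e1
      exact Or.inl ⟨hp.2, e2.symm⟩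
    · right
      rw [e2]
      exact ⟨hp.2, e1.symm⟩
  have hsub : A.image f ∪ W.image g ⊆ T.edgeFinset := by
    intro e he
    rw [SimpleGraph.mem_edgeFinset]
    rcases Finset.mem_union.1 he with he | he
    · obtain ⟨⟨s, y⟩, hp, rfl⟩ := Finset.mem_image.1 he
      rw [hAmem] at hp
      exact nx_adj hT hp.2.ne'
    · obtain ⟨v, hv, rfl⟩ := Finset.mem_image.1 he
      exact nx_adj hT (hW v hv)
  have h4 := Finset.card_le_card hsub
  rw [Finset.card_union_of_disjoint hdisj, Finset.card_image_of_injOn hfinj,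
    Finset.card_image_of_injOn hginj, hAcard] at h4
  have h5 : T.edgeFinset.card + 1 = Fintype.card V := by
    convert hT.card_edgeFinset
  omega

/-- Many edges of an optimal tree are not oblique to any leaf or vertex of `X`. -/
lemma Opt.exists_unused_set {r : V} (h : Opt G T r) (hclaw : IsClawFree G) {X : Finset V}
    (hX : ∀ x ∈ X, dg T x = 3 ∧ x ≠ r) :
    ∃ W : Finset V, nb T + 1 ≤ W.card + X.card ∧ (∀ v ∈ W, v ≠ r) ∧
      ∀ s, dg T s = 1 ∨ s ∈ X → ∀ v ∈ W, ¬ Uses G T s v (nx T v r) := by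
  choose! f hf using fun d (hd : 3 ≤ dg T d) => h.exists_unused hclaw hd
  obtain ⟨u, hur, hu⟩ : ∃ u, u ≠ f r ∧ u ≠ r ∧ nx T u r = r ∧ (∃ w, T.Adj r w ∧ G.Adj u w) ∧
      ∀ x, dg T x = 3 → x ≠ r → ¬ Uses G T x u r := by
    obtain ⟨v, w, hvw, hu⟩ := h.exists_unused_root hclaw
    by_cases hv : v = f r
    · exact ⟨w, fun e => hvw (hv.trans e.symm), hu w (Or.inr rfl)⟩
    · exact ⟨v, hv, hu v (Or.inl rfl)⟩
  -- Vertices of `X` are left out: an edge from such a vertex to a child is oblique to the vertex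
  -- itself.
  set D := (Finset.univ.filter fun v => 3 ≤ dg T v) \ X with hD
  have hDm : ∀ d ∈ D, 3 ≤ dg T d ∧ d ∉ X := by
    intro d hd
    simpa [hD] using hd
  have hrX : r ∉ X := fun hr => (hX r hr).2 rfl
  have hinj : Set.InjOn f D := by
    intro d hd d' hd' he
    rw [← (hf d (hDm d hd).1).2.1, ← (hf d' (hDm d' hd').1).2.1, he]
  have hu' : u ∉ D.image f := by
    intro hmem
    obtain ⟨d, hd, rfl⟩ := Finset.mem_image.1 hmem
    have e := (hf d (hDm d hd).1).2.1
    rw [hu.2.1] at e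
    rw [e] at hur
    exact hur rfl
  have hWm : ∀ v ∈ insert u (D.image f), ∃ d, 3 ≤ dg T d ∧ d ∉ X ∧ v ≠ r ∧ nx T v r = d ∧
      (∃ w, T.Adj d w ∧ G.Adj v w) ∧ ∀ x, dg T x = 3 → x ≠ d → ¬ Uses G T x v d := by
    intro v hv
    rcases Finset.mem_insert.1 hv with rfl | hv
    · exact ⟨r, h.root, hrX, hu⟩
    · obtain ⟨d, hd, rfl⟩ := Finset.mem_image.1 hv
      exact ⟨d, (hDm d hd).1, (hDm d hd).2, hf d (hDm d hd).1⟩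
  refine ⟨insert u (D.image f), ?_, ?_, ?_⟩
  · rw [Finset.card_insert_of_notMem hu', Finset.card_image_of_injOn hinj]
    have h1 : (Finset.univ.filter fun v => 3 ≤ dg T v) ⊆ D ∪ X := by
      intro d hd
      simp only [hD, Finset.mem_union, Finset.mem_sdiff]
      tauto
    have h2 := (Finset.card_le_card h1).trans (Finset.card_union_le D X)
    unfold nb
    omega
  · intro v hv
    obtain ⟨d, -, -, h1, -⟩ := hWm v hv
    exact h1
  · intro s hs v hv
    obtain ⟨d, hd, hdX, hvr, rfl, ⟨w, hw, hvw⟩, hun⟩ := hWm v hv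
    rcases hs with hs | hs
    · have := h.reduced.paired_unused hd (nx_adj h.tree hvr).symm hw hvw hs
      rintro (e | e)
      · exact this.1 e
      · exact this.2 e
    · exact hun s (hX s hs).1 fun e => hdX (e ▸ hs)

/-- The leaves of an optimal tree together with blocked cubic vertices form an independent set, and
no edge is oblique to two of them. -/
lemma Opt.independent {r : V} (h : Opt G T r)
    (hdd : ∀ T', Opt G T' r → dd G T' r ≤ dd G T r) (hclaw : IsClawFree G) {X : Finset V}
    (hX : ∀ x ∈ X, dg T x = 3 ∧ x ≠ r)
    (hb : ∀ x ∈ X, ∀ x' ∈ X, x ≠ x' → ∃ c, Blocks G T x x' c) {s s' : V}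
    (hs : dg T s = 1 ∨ s ∈ X) (hs' : dg T s' = 1 ∨ s' ∈ X) :
    ¬ G.Adj s s' ∧ (s ≠ s' → ∀ y z, T.Adj y z → G.Adj s y → nx T y s = z →
      ¬ (G.Adj s' y ∧ nx T y s' = z) ∧ ¬ (G.Adj s' z ∧ nx T z s' = y)) := by
  have hbad : ∀ x, ¬ Bad G T r x := fun x => h.not_bad hclaw
  rcases hs with hs | hs <;> rcases hs' with hs' | hs'
  · refine ⟨h.reduced.leaves_not_adj hs hs', fun hne y z hyz hy hz => ?_⟩
    constructor
    · rintro ⟨hy', hz'⟩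
      exact hne (h.reduced.oblique_unique hclaw hs hs' hy hy' (by rw [hz, hz'])).1
    · rintro ⟨hy', hz'⟩
      exact hne (h.reduced.oblique_unique hclaw hs hs' hy hy' (by rw [hz, hz', Sym2.eq_swap])).1
  · obtain ⟨h3, hr⟩ := hX s' hs'
    refine ⟨fun e => h.not_adj_leaf (hbad s') h3 hr hs e.symm, fun hne y z hyz hy hz => ?_⟩
    constructor
    · rintro ⟨hy', hz'⟩
      exact h.oblique_leaf_same hdd hclaw h3 hr hs hyz hy' hy hz' hz
    · rintro ⟨hy', hz'⟩
      exact h.oblique_leaf_opposite (hbad s') h3 hr hs hyz.symm hy' hy hz' hz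
  · obtain ⟨h3, hr⟩ := hX s hs
    refine ⟨h.not_adj_leaf (hbad s) h3 hr hs', fun hne y z hyz hy hz => ?_⟩
    constructor
    · rintro ⟨hy', hz'⟩
      exact h.oblique_leaf_same hdd hclaw h3 hr hs' hyz hy hy' hz hz'
    · rintro ⟨hy', hz'⟩
      exact h.oblique_leaf_opposite (hbad s) h3 hr hs' hyz hy hy' hz hz'
  · obtain ⟨h3, hr⟩ := hX s hs
    obtain ⟨h3', hr'⟩ := hX s' hs'
    by_cases hne : s = s'
    · subst hne
      exact ⟨G.irrefl, fun e => absurd rfl e⟩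
    obtain ⟨c, hc⟩ := hb s hs s' hs' hne
    refine ⟨h.not_adj_cubic h3 h3' hc, fun _ y z hyz hy hz => ?_⟩
    constructor
    · rintro ⟨hy', hz'⟩
      exact h.oblique_cubic_same hclaw h3 h3' hr hyz hy hy' hz hz' hc
    · rintro ⟨hy', hz'⟩
      exact h.oblique_cubic_opposite hclaw h3 h3' hyz hy hy' hz hz' hc

/-- The number of leaves in terms of the numbers of branch vertices and of cubic vertices. -/
lemma two_mul_nb_le (hT : T.IsTree) (hc : 2 ≤ Fintype.card V) (r : V) :
    2 * nb T + 1 ≤ (Finset.univ.filter fun v => dg T v = 1).card +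
      (Finset.univ.filter fun v => dg T v = 3 ∧ v ≠ r).card := by
  have h1 := sum_sub_two_leaves hT hc
  -- A branch vertex contributes at least two to the sum, a cubic one with the help of an indicator;
  -- the last term covers a cubic root.
  have h2 : 2 * nb T ≤ ∑ v, ((dg T v - 2) + (if dg T v = 3 ∧ v ≠ r then 1 else 0) +
      (if v = r then 1 else 0)) := by
    unfold nb
    rw [Finset.card_filter, Finset.mul_sum]
    refine Finset.sum_le_sum fun v _ => ?_
    by_cases hv : v = r
    · simp only [hv]
      split_ifs <;> grind
    · simp only [hv]
      split_ifs <;> grind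
  rw [Finset.sum_add_distrib, Finset.sum_add_distrib, ← Finset.card_filter] at h2
  simp at h2
  simp at h1 ⊢
  omega

/-- An optimal tree has few leaves and branch vertices if independent sets have large degree
sums. -/
theorem Opt.card_leaves_add_le {r : V} (h : Opt G T r)
    (hdd : ∀ T', Opt G T' r → dd G T' r ≤ dd G T r) (hclaw : IsClawFree G) {k m : ℕ}
    (hkm : k + 3 ≤ m) (hmk : 3 * m ≤ 4 * k + 8)
    (hσ : ((Fintype.card V + m : ℕ) : ℕ∞) ≤ sigma G (m + 1) + ((2 * k + 4 : ℕ) : ℕ∞)) :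
    (leaves T).card + (branchVertices T).card ≤ 2 * k + 3 := by
  have hT := h.tree
  have hcard : 2 ≤ Fintype.card V := by
    have h1 : dg T r ≤ Fintype.card V := Finset.card_le_univ _
    have := h.root
    omega
  rw [card_leaves, card_branchVertices]
  change _ + nb T ≤ _
  by_contra! hcon
  have hL := h.reduced.card_leaves_le hclaw hkm hσ
  have hC := two_mul_nb_le hT hcard r
  set U := Finset.univ.filter fun v => dg T v = 1 with hU
  -- The number of cubic vertices other than `r` is at least `2 * nb T + 1 - |U|`, hence at least
  -- `4k + 9 - 3|U|`. With `|U| ≤ m` and `3m ≤ 4k + 8` this leaves room for the required number.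
  obtain ⟨X, hXc, hX, hb⟩ := h.exists_blocked hclaw (t := m + 1 - U.card) (by omega)
  obtain ⟨W, hWc, hWr, hun⟩ := h.exists_unused_set hclaw hX
  have hUX : Disjoint U X := by
    rw [Finset.disjoint_left]
    intro v hv hvX
    have h1 := (hX v hvX).1
    simp only [hU, Finset.mem_filter, Finset.mem_univ, true_and] at hv
    omega
  have hmem : ∀ s ∈ U ∪ X, dg T s = 1 ∨ s ∈ X := by
    intro s hs
    simpa [hU] using hs
  have hSc : (U ∪ X).card = m + 1 := by
    rw [Finset.card_union_of_disjoint hUX]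
    omega
  have h1 := le_sum_of_sigma hσ (S := U ∪ X)
    (fun u hu v hv => (h.independent hdd hclaw hX hb (hmem u hu) (hmem v hv)).1) hSc
  rw [Nat.cast_le] at h1
  have h2 := sum_dg_add_card_lt hT hWr (S := U ∪ X)
    (fun u hu v hv => (h.independent hdd hclaw hX hb (hmem u hu) (hmem v hv)).2)
    (fun s hs => hun s (hmem s hs))
  -- The degree sum is at most `|V| - 1 - |W|`, with `|W| ≥ nb T + 1 - |X|` and `|X| = m + 1 - |U|`.
  -- As `|U| + nb T ≥ 2k + 4`, this is at most `|V| + m - 2k - 5`.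
  omega

end Count

end ClawFreeTrees

/-- The degree condition `σ_{m+1}(G) ≥ |G| - 2k + m - 4` is written in `ℕ∞` with the subtracted
terms moved to the other side, so that no subtraction is truncated. -/
theorem theorem1p11 {V : Type*} [Fintype V] (G : SimpleGraph V) (k m : ℕ)
    (hk : 0 < k) (hm : 0 < m) (hkm : k + 3 ≤ m)
    (hmk : (m : ℝ) ≤ (k : ℝ) + ((k : ℝ) - 1) / 3 + 3)
    (hconn : G.Connected) (hclaw : ClawFreeTrees.IsClawFree G)
    (hσ : ((Fintype.card V + m : ℕ) : ℕ∞) ≤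
      ClawFreeTrees.sigma G (m + 1) + ((2 * k + 4 : ℕ) : ℕ∞)) :
    ∃ T : SimpleGraph V, ClawFreeTrees.IsSpanningTree G T ∧
      (ClawFreeTrees.leaves T).card + (ClawFreeTrees.branchVertices T).card ≤ 2 * k + 3 := by
  classical
  obtain ⟨T₀, hle, hT₀⟩ := hconn.exists_isTree_le
  obtain ⟨T, hT, hmin⟩ := Finset.exists_min_image
    (Finset.univ.filter fun T : SimpleGraph V => T ≤ G ∧ T.IsTree) ClawFreeTrees.nb
    ⟨T₀, by simp [hle, hT₀]⟩
  simp only [Finset.mem_filter, Finset.mem_univ, true_and, and_imp] at hT hmin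
  by_cases hr : ∃ r, 3 ≤ ClawFreeTrees.dg T r
  · obtain ⟨r, hr⟩ := hr
    obtain ⟨T', h, hdd⟩ := ClawFreeTrees.exists_opt hT.1 hT.2 hr hmin
    refine ⟨T', ⟨h.le, h.tree⟩, h.card_leaves_add_le hdd hclaw hkm ?_ hσ⟩
    have : (3 * m : ℝ) ≤ 4 * k + 8 := by linarith
    exact_mod_cast this
  -- Without branch vertices the tree has two leaves, or the graph has a single vertex.
  · push Not at hr
    have hb : (ClawFreeTrees.branchVertices T).card = 0 := by
      rw [ClawFreeTrees.card_branchVertices, Finset.card_eq_zero, Finset.filter_eq_empty_iff]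
      exact fun v _ => not_le.2 (hr v)
    refine ⟨T, hT, ?_⟩
    by_cases hc : 2 ≤ Fintype.card V
    · have h1 := ClawFreeTrees.sum_sub_two_leaves hT.2 hc
      have h2 : ∑ v, (ClawFreeTrees.dg T v - 2) = 0 :=
        Finset.sum_eq_zero fun v _ => by have := hr v; omega
      rw [hb, ClawFreeTrees.card_leaves, h1, h2]
      omega
    · have := Finset.card_le_univ (ClawFreeTrees.leaves T)
      omega
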